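/- **Setting.** Let $P$ be the law of $\mathbf z$ on $\mathcal Z$, $\Phi:\mathcal Z\to\bar{\mathcal Z}\subset\mathbb R^{d_l}$ continuous with $\Phi(\mathbf z)$ supported on a bounded set, and let $\bar k_z$ be a bounded (measurable) reproducing kernel on $\bar{\mathcal Z}$ such that (a) the eigenvalues $\lambda_1\ge\lambda_2\ge\dots$ of its integral operator with respect to the law of $\Phi(\mathbf z)$ satisfy $\lambda_i\le D\,i^{-(\bar b+1)}$ for some $\bar b>0$, and (b) $\mathcal{GP}(0,\bar k_z)$ has jointly measurable samples with a.s. finite $L_\infty$ norm. Put $k_z(z,z')=\bar k_z(\Phi(z),\Phi(z'))$, with RKHS $\mathcal I$. Write $\mathrm{Proj}_r$ for the projection of $L_2(P)$ onto the top $r$ Mercer eigenfunctions $\psi_i$ of $k_z$ (those with $\lambda_i>0$), and $\|\mathrm{Proj}_r g\|_{\mathcal I}^2=\sum_{i\le r,\,\lambda_i>0}\lambda_i^{-1}\langle g,\psi_i\rangle_2^2$. A *regression oracle* is a (jointly measurable) algorithm which maps data $\{(\tilde z_i,g(\tilde z_i)+e_i)\}_{i\le n}$ to an estimator $\hat g_n$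 such that, for $g\sim\mathcal{GP}(0,k_z)$ and, given $g$, i.i.d. replicates $(\tilde z_i,e_i)$ of $(\mathbf z,\mathbf e)$ with $\mathbb E(\mathbf e\mid\mathbf z)=0$ and $g(\mathbf z)+\mathbf e$ $1$-subgaussian, one has $\mathbb E_g\mathbb E_{\mathrm{data}}\|\hat g_n-g\|_2^2\le\xi_n^2$, where $\xi_n\to0$. For each $n_1$ let $m=m_{n_1}$, with $m\to\infty$ and $\log m=o(\log^2 n_1)$ (for instance, $m\to\infty$ at most polynomially in $n_1$). Draw i.i.d. $g^{(1)},\dots,g^{(m)}\sim\mathcal{GP}(0,k_z)$, let $\mathcal D^{(n_1)}=\{(\tilde z_i,g^{(j)}(\tilde z_i)+\varepsilon_i^{(j)}):i\le n_1,\,j\le m\}$ with shared inputs $\tilde z_i$, the data of each task $j$ being of the above kind, and let $\hat g^{(j)}$ be the oracle's estimate for task $j$ truncated to $[-C_k\log n_1,C_k\log n_1]$, where $C_k>0$ is a constant. Put $\hat G=(\hat g^{(1)},\dots,\hat g^{(m)})$ and $\tilde{\mathcal I}=\{\theta^\top\hat G:\theta\in\mathbb R^m\}$ with norm $\|\theta^\top\hat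 G\|_{\tilde{\mathcal I}}=\sqrt m\,\|\theta\|_2$ (the least such value, if $\theta$ is not unique), with closed unit ball $\tilde{\mathcal I}_1$. For $n_2\ge1$, let $\mathbf z_1,\dots,\mathbf z_{n_2}\sim P$ be i.i.d. and independent of the above, and $\varepsilon_i$ independent uniform signs; let $$\bar R_{n_2}(\sigma)=\mathbb E_{\mathbf z,\varepsilon}\sup_{g\in\tilde{\mathcal I}_1,\ \|g\|_2\le\sigma}\Big|\frac1{n_2}\sum_{i=1}^{n_2}\varepsilon_i g(\mathbf z_i)\Big|,\qquad \delta_{n_2}=\inf\{\delta>0:\bar R_{n_2}(\delta)\le\delta^2\}$$ be the local Rademacher complexity of $\tilde{\mathcal I}_1$ and its critical radius. **Claim.** There are a universal constant $c_r>0$, a constant $C>0$ which depends only on $P,\Phi,\bar k_z,\bar b,D,C_k$ (and on no sample size, nor on $m$, the oracle, $\xi$ or the noise), and events $E_{n_1}$ determined by $g^{(1)},\dots,g^{(m)}$ and $\mathcal D^{(n_1)}$, with $\mathbb P(E_{n_1})\to1$ as $n_1\to\infty$, such that on $E_{n_1}$ both of the following hold. 1. (Approximation.) With $m'=\lfloor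 m/2\rfloor$, for every $g^*\in L_2(P)$ there is $\tilde g^*\in\tilde{\mathcal I}$ with $\|\tilde g^*\|_{\tilde{\mathcal I}}\le c_r\|\mathrm{Proj}_{m'}g^*\|_{\mathcal I}$ and $$\|\tilde g^*-g^*\|_2\le c_r\|\mathrm{Proj}_{m'}g^*\|_{\mathcal I}\,\big(\xi_{n_1}+m^{-(\bar b+1)/2}\big)\sqrt{\log n_1}+\|g^*-\mathrm{Proj}_{m'}g^*\|_2 .$$ 2. (Critical radius.) For every $n_2\ge1$, $$\delta_{n_2}\le C\sqrt{\log n_1}\,\Big(n_2^{-\frac{\bar b+1}{2(\bar b+2)}}+m^{-\frac{\bar b+1}{2}}+\xi_{n_1}\Big),$$ that is, $\delta_{n_2}=\tilde O\big(n_2^{-(\bar b+1)/2(\bar b+2)}+m^{-(\bar b+1)/2}+\xi_{n_1}\big)$. -/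

import Mathlib

open MeasureTheory ProbabilityTheory Filter Topology
open scoped ENNReal

noncomputable section

namespace KernelLearning

/-- A bounded (measurable) positive semidefinite kernel. -/
structure IsBoundedKernel {X : Type*} [MeasurableSpace X] (k : X → X → ℝ) : Prop where
  posSemidef : (Matrix.of k).PosSemidef
  measurable : Measurable (Function.uncurry k)
  bounded : ∃ K : ℝ, ∀ x y, |k x y| ≤ K

/-- `(lam i, ψ i)`, `i = 0, 1, …`, is a Mercer eigensystem of the kernel `k` with respect to `Q`,
i.e. the spectral decomposition `T f = ∑ i, lam i ⟨ψ i, f⟩ ψ i` of the integral operator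
`T f = ∫ k(·, y) f(y) Q(dy)` on `L²(Q)`, with eigenvalues repeated according to multiplicity and
listed in decreasing order. If `T` has finite rank the list is padded with `lam i = 0`, and
nothing is asked of the functions `ψ i` with `lam i = 0`. -/
structure IsMercerSystem {X : Type*} [MeasurableSpace X] (Q : Measure X) (k : X → X → ℝ)
    (lam : ℕ → ℝ) (ψ : ℕ → X → ℝ) : Prop where
  antitone : Antitone lam
  nonneg : ∀ i, 0 ≤ lam i
  memLp : ∀ i, lam i ≠ 0 → MemLp (ψ i) 2 Q
  orthonormal : ∀ i j, lam i ≠ 0 → lam j ≠ 0 →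
    ∫ x, ψ i x * ψ j x ∂Q = if i = j then 1 else 0
  eigen : ∀ i, lam i ≠ 0 → ∀ᵐ x ∂Q, ∫ y, k x y * ψ i y ∂Q = lam i * ψ i x
  complete : ∀ f : X → ℝ, MemLp f 2 Q → (∀ i, lam i ≠ 0 → ∫ x, ψ i x * f x ∂Q = 0) →
    ∀ᵐ x ∂Q, ∫ y, k x y * f y ∂Q = 0

/-- The latent-space kernel model: the feature map `Φ` is continuous, `Φ(z)` is supported on a
bounded set, the latent kernel `kbar` is bounded, and its Mercer eigenvalues with respect to the
law of `Φ(z)` satisfy `λ_i ≤ D i^{-(b+1)}`, `i = 1, 2, …`. -/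
structure IsLatentKernel {Z : Type*} [TopologicalSpace Z] [MeasurableSpace Z] (P : Measure Z)
    {d : ℕ} {Zbar : Set (EuclideanSpace ℝ (Fin d))} (Φ : Z → Zbar) (kbar : Zbar → Zbar → ℝ)
    (lam : ℕ → ℝ) (ψ : ℕ → Zbar → ℝ) (b D : ℝ) : Prop where
  continuous : Continuous Φ
  bounded_support : ∃ S : Set (EuclideanSpace ℝ (Fin d)), Bornology.IsBounded S ∧
    ∀ᵐ z ∂P, (Φ z : EuclideanSpace ℝ (Fin d)) ∈ S
  kernel : IsBoundedKernel kbar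
  mercer : IsMercerSystem (P.map Φ) kbar lam ψ
  b_pos : 0 < b
  decay : ∀ i : ℕ, lam i ≤ D * ((i : ℝ) + 1) ^ (-(b + 1))

/-- `u ↦ gp u` with `u ∼ ν` is a sample from `GP(0, k)`: a jointly measurable, centred Gaussian
process with covariance `k`, whose sample paths almost surely have a finite `L_∞(Q)` norm. -/
structure IsGPSample {U X : Type*} [MeasurableSpace U] [MeasurableSpace X] (ν : Measure U)
    (Q : Measure X) (k : X → X → ℝ) (gp : U → X → ℝ) : Prop where
  measurable : Measurable (Function.uncurry gp)
  gaussian : IsGaussianProcess (fun (x : X) (u : U) => gp u x) ν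
  mean_zero : ∀ x, ∫ u, gp u x ∂ν = 0
  cov : ∀ x y, ∫ u, gp u x * gp u y ∂ν = k x y
  bounded : ∀ᵐ u ∂ν, eLpNorm (gp u) ∞ Q < ∞

/-- Admissible noise for the regression task with random regression function
`g = gp u ∘ Φ`, `u ∼ ν`. An observation is generated from `u ∼ ν` and, independently,
`(z, w) ∼ P ⊗ₘ κ` (that is, `z ∼ P` and `w | z ∼ κ z`), and its noise is `e = η u z w`.
It is required that `E(e | z) = 0` for the given `g`, and that `g(z) + e` is `1`-subgaussian. -/
structure IsNoise {Z X U W : Type*} [MeasurableSpace Z] [MeasurableSpace U]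
    [MeasurableSpace W] (P : Measure Z) (Φ : Z → X) (ν : Measure U) (gp : U → X → ℝ)
    (κ : Kernel Z W) (η : U → Z → W → ℝ) : Prop where
  measurable : Measurable fun q : U × Z × W => η q.1 q.2.1 q.2.2
  cond_mean : ∀ᵐ p ∂(ν.prod P), Integrable (η p.1 p.2) (κ p.2) ∧ ∫ w, η p.1 p.2 w ∂(κ p.2) = 0
  subgaussian : HasSubgaussianMGF
    (fun q : U × Z × W => gp q.1 (Φ q.2.1) + η q.1 q.2.1 q.2.2) 1 (ν.prod (P ⊗ₘ κ))

/-- The regression data `(z_i, g(z_i) + e(z_i, w_i))`. -/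
def regressionData {Z W : Type*} {n : ℕ} (g : Z → ℝ) (e : Z → W → ℝ) (s : Fin n → Z × W) :
    Fin n → Z × ℝ :=
  fun i => ((s i).1, g (s i).1 + e (s i).1 (s i).2)

/-- The algorithm `A`, which maps a regression data set of size `n` to an estimator `Z → ℝ`, is a
regression oracle with error `ξ`: for all admissible noise,
`E_{g ∼ GP} E_{data} ‖ĝ - g‖_{L²(P)}² ≤ ξ n ^ 2`, where `ξ n → 0`. -/
structure IsRegressionOracle {Z X U W : Type*} [MeasurableSpace Z] [MeasurableSpace U]
    [MeasurableSpace W] (P : Measure Z) (Φ : Z → X) (ν : Measure U) (gp : U → X → ℝ)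
    (κ : Kernel Z W) (A : (n : ℕ) → (Fin n → Z × ℝ) → Z → ℝ) (ξ : ℕ → ℝ) : Prop where
  measurable : ∀ n, Measurable (Function.uncurry (A n))
  nonneg : ∀ n, 0 ≤ ξ n
  tendsto : Tendsto ξ atTop (𝓝 0)
  risk_le : ∀ η : U → Z → W → ℝ, IsNoise P Φ ν gp κ η → ∀ n : ℕ,
    ∫⁻ u, ∫⁻ s, eLpNorm
        (fun z => A n (regressionData (fun z => gp u (Φ z)) (η u) s) z - gp u (Φ z)) 2 P ^ 2
      ∂(Measure.pi fun _ : Fin n => P ⊗ₘ κ) ∂ν ≤ ENNReal.ofReal (ξ n ^ 2)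

/-- The sample space of the first stage: `m` independent GP samples (through `u_1, …, u_m ∼ ν`)
and, independently, `n` i.i.d. draws of `(z, w)`, shared by all the `m` regression tasks. -/
def sampleMeasure {Z U W : Type*} [MeasurableSpace Z] [MeasurableSpace U] [MeasurableSpace W]
    (P : Measure Z) (ν : Measure U) (κ : Kernel Z W) (m n : ℕ) :
    Measure ((Fin m → U) × (Fin n → Z × W)) :=
  (Measure.pi fun _ => ν).prod (Measure.pi fun _ => P ⊗ₘ κ)

/-- The GP samples `g^{(1)}, …, g^{(m)}`, as functions on the input space. -/
def gpPaths {Z X U W : Type*} (Φ : Z → X) (gp : U → X → ℝ) {m n : ℕ}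
    (ω : (Fin m → U) × (Fin n → Z × W)) : Fin m → Z → ℝ :=
  fun j z => gp (ω.1 j) (Φ z)

/-- The shared data set: task `j` has the data `(z_i, g^{(j)}(z_i) + ε^{(j)}_i)`, `i = 1, …, n`. -/
def dataset {Z X U W : Type*} (Φ : Z → X) (gp : U → X → ℝ) (η : ℕ → U → Z → W → ℝ) {m n : ℕ}
    (ω : (Fin m → U) × (Fin n → Z × W)) : Fin m → Fin n → Z × ℝ :=
  fun j => regressionData (gpPaths Φ gp ω j) (η j (ω.1 j)) ω.2

/-- The oracle's estimates, truncated to `[-Ck log n, Ck log n]`. -/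
def truncEstimates {Z : Type*} (A : (n : ℕ) → (Fin n → Z × ℝ) → Z → ℝ) (Ck : ℝ) {m n : ℕ}
    (data : Fin m → Fin n → Z × ℝ) : Fin m → Z → ℝ :=
  fun j z => max (-(Ck * Real.log n)) (min (Ck * Real.log n) (A n (data j) z))

/-- The closed ball of radius `R` of the learned RKHS `{θᵀ G : θ ∈ ℝ^m}`, whose norm is
`‖θᵀ G‖ = √m ‖θ‖₂` (the least such value if `θ` is not unique). -/
def learnedBall {Z : Type*} {m : ℕ} (G : Fin m → Z → ℝ) (R : ℝ) : Set (Z → ℝ) :=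
  {f | ∃ θ : EuclideanSpace ℝ (Fin m), √(m : ℝ) * ‖θ‖ ≤ R ∧ f = fun z => ∑ j, θ j * G j z}

/-- The projection of `g ∈ L²(P)` onto the top `r` Mercer eigenfunctions. -/
def mercerProj {Z : Type*} [MeasurableSpace Z] (P : Measure Z) (lam : ℕ → ℝ) (φ : ℕ → Z → ℝ)
    (r : ℕ) (g : Z → ℝ) : Z → ℝ :=
  fun z => ∑ i ∈ Finset.range r with lam i ≠ 0, (∫ x, φ i x * g x ∂P) * φ i z

/-- The RKHS norm `(∑_i λ_i⁻¹ a_i²)^{1/2}` of the projection `∑_i a_i φ_i` above. -/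
def mercerProjNorm {Z : Type*} [MeasurableSpace Z] (P : Measure Z) (lam : ℕ → ℝ)
    (φ : ℕ → Z → ℝ) (r : ℕ) (g : Z → ℝ) : ℝ :=
  √(∑ i ∈ Finset.range r with lam i ≠ 0, (lam i)⁻¹ * (∫ x, φ i x * g x ∂P) ^ 2)

/-- The approximation guarantee: every `g ∈ L²(P)` has an approximation `f` in the learned RKHS
with `‖f‖ ≤ c ‖Proj_r g‖_I` and
`‖f - g‖₂ ≤ c ‖Proj_r g‖_I (ξ + m^{-(b+1)/2}) √(log n) + ‖g - Proj_r g‖₂`, for `r = ⌊m/2⌋`. -/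
def ApproximationBound {Z : Type*} [MeasurableSpace Z] (P : Measure Z) (lam : ℕ → ℝ)
    (φ : ℕ → Z → ℝ) (b c ξ : ℝ) (n : ℕ) {m : ℕ} (G : Fin m → Z → ℝ) : Prop :=
  ∀ g : Z → ℝ, MemLp g 2 P →
    ∃ f ∈ learnedBall G (c * mercerProjNorm P lam φ (m / 2) g),
      eLpNorm (f - g) 2 P ≤
        ENNReal.ofReal (c * mercerProjNorm P lam φ (m / 2) g
          * (ξ + (m : ℝ) ^ (-((b + 1) / 2))) * √(Real.log n))
        + eLpNorm (g - mercerProj P lam φ (m / 2) g) 2 P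

/-- The local Rademacher complexity
`E_{z, ε} sup_{g ∈ F, ‖g‖₂ ≤ σ} |n⁻¹ ∑ i, ε_i g(z_i)|`, for `z_1, …, z_n ∼ P` i.i.d. and independent
uniform signs `ε_i`. -/
def localRademacher {Z : Type*} [MeasurableSpace Z] (P : Measure Z) (n : ℕ) (F : Set (Z → ℝ))
    (σ : ℝ) : ℝ≥0∞ :=
  ∫⁻ z, (∑ ε : Fin n → Bool, ⨆ g ∈ {g ∈ F | eLpNorm g 2 P ≤ ENNReal.ofReal σ},
      ENNReal.ofReal |(n : ℝ)⁻¹ * ∑ i, (if ε i then 1 else -1) * g (z i)|) / 2 ^ n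
    ∂(Measure.pi fun _ : Fin n => P)

/-- The critical radius: the smallest solution `δ` of `localRademacher P n F δ ≤ δ ^ 2`, as the
infimum of all the positive solutions (`∞` if there is none). -/
def criticalRadius {Z : Type*} [MeasurableSpace Z] (P : Measure Z) (n : ℕ) (F : Set (Z → ℝ)) :
    ℝ≥0∞ :=
  ⨅ (δ : ℝ) (_ : 0 < δ ∧ localRademacher P n F δ ≤ ENNReal.ofReal (δ ^ 2)), ENNReal.ofReal δ

end KernelLearning

end

/-!
Write `g_j = gp (u_j) ∘ Φ` for the sample paths, `ĝ_j` for the truncated estimates, `φ_i = ψ_i ∘ Φ`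
for the eigenfunctions and `Π_r` for the projection onto the first `r` of them. The proof exhibits
a single event, `IsGoodSample`, from which both guarantees follow deterministically, and bounds the
probability of its complement.

*The event.* With `L = log n₁`: (i) `∑ j, ‖ĝ_j - g_j‖² ≤ m L (ξ² + m^{-(b+1)})`; (ii) the matrix of
the whitened coefficients `λ_i^{-1/2} ⟨φ_i, g_j⟩`, `i < m / 2`, `j < m`, has singular values of
order `√m`; (iii) `‖∑ j, θ_j (g_j - Π_{m/2} g_j)‖² ≲ m · m^{-(b+1)} ‖θ‖²` for every `θ`;
(iv) `∑ j, ‖g_j - Π_r g_j‖² ≲ m r^{-b}` for every `r ≥ 1`. Properties (ii) and (iii) are only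
imposed for unit vectors in a finite net, which is enough (`norm_le_of_sphere_net`,
`le_norm_of_sphere_net`) and keeps the event measurable.

*Approximation* (`exists_mem_learnedBall`). By (ii) there is `θ` with `√m ‖θ‖ ≲ ‖Π_{m/2} g‖_I` such
that `∑ j, θ_j g_j` and `g` have the same coefficients along the first `m / 2` eigenfunctions
(`exists_adjoint_eq`). Then
`∑ j, θ_j ĝ_j - g = ∑ j, θ_j (ĝ_j - g_j) + ∑ j, θ_j (g_j - Π g_j) - (g - Π g)`, and the first two
terms are controlled by (i) and (iii).

*Critical radius* (`localRademacher_le`, `criticalRadius_le`). Split `f = Π_r f + (f - Π_r f)` on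
the learned ball: the first part contributes at most `δ²/4 + r / n₂` by Bessel's inequality, the
second one at most `δ²/4` plus the tail `m⁻¹ ∑ j, ‖ĝ_j - Π_r ĝ_j‖²` divided by `n₂ δ²`, and the tail
is controlled by (i) and (iv). The choice `r ≈ n₂^{1/(b+2)}` gives the rate.

*Probability* (`measure_not_isGoodSample_le`). The coefficients `⟨ψ_i, gp u⟩` are limits in `L²` of
linear combinations of values of the process, hence jointly Gaussian and independent with variances
`λ_i` (`IsGPSample.map_coef`, `IsGPSample.map_sum_coef`), and the paths almost surely lie in the
closed span of the eigenfunctions (`IsGPSample.ae_inMercerSpan`), so that Parseval's identity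
expresses the residuals through the coefficients. Exponential moments of Gaussian quadratic forms
(`lintegral_exp_sum_sq_le`, `IsGPSample.lintegral_exp_white`), Chernoff's bound and a union bound
over the nets give (ii)-(iv). Property (i) is Markov's inequality: the oracle controls the error
before truncation, and the truncation costs `exp (-(C_k L)² / (8 K))`, which is at most
`m^{-(b+1)}` for large `n₁` because `log m = o(log² n₁)`.
-/

set_option linter.unusedSectionVars false

noncomputable section

namespace KernelLearning

/-! ### Exponential moments of Gaussian quadratic forms -/

lemma lintegral_exp_mul_gaussianReal (t : ℝ) :
    ∫⁻ x, ENNReal.ofReal (Real.exp (t * x)) ∂(gaussianReal 0 1)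
      = ENNReal.ofReal (Real.exp (t ^ 2 / 2)) := by
  rw [← ofReal_integral_eq_lintegral_ofReal]
  · have := congrFun (mgf_fun_id_gaussianReal (μ := 0) (v := 1)) t
    simp only [mgf] at this
    rw [this]; simp
  · exact integrable_exp_mul_gaussianReal t
  · exact Filter.Eventually.of_forall fun x => (Real.exp_pos _).le

lemma lintegral_exp_sq_gaussianReal {p : ℝ} (hp : p < 1 / 2) :
    ∫⁻ x, ENNReal.ofReal (Real.exp (p * x ^ 2)) ∂(gaussianReal 0 1)
      = ENNReal.ofReal ((√(1 - 2 * p))⁻¹) := by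
  have hq : 0 < 1 / 2 - p := by linarith
  rw [gaussianReal_of_var_ne_zero 0 one_ne_zero,
    lintegral_withDensity_eq_lintegral_mul _ (measurable_gaussianPDF 0 1) (by fun_prop)]
  have h1 : ∀ x : ℝ, (gaussianPDF 0 1 * fun x => ENNReal.ofReal (Real.exp (p * x ^ 2))) x
      = ENNReal.ofReal ((√(2 * Real.pi))⁻¹ * Real.exp (-(1 / 2 - p) * x ^ 2)) := by
    intro x
    simp only [Pi.mul_apply, gaussianPDF, gaussianPDFReal]
    rw [← ENNReal.ofReal_mul (by positivity), mul_assoc, ← Real.exp_add]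
    congr 2
    · simp
    · congr 1; simp; ring
  simp_rw [h1]
  rw [← ofReal_integral_eq_lintegral_ofReal]
  · rw [integral_const_mul, integral_gaussian]
    congr 1
    rw [← Real.sqrt_inv, ← Real.sqrt_inv, ← Real.sqrt_mul (by positivity)]
    congr 1
    have := Real.pi_pos.ne'
    field_simp
  · exact (integrable_exp_neg_mul_sq hq).const_mul _
  · exact Filter.Eventually.of_forall fun x => by positivity

lemma lintegral_pi_prod {ι : Type*} [Fintype ι] {α : ι → Type*} [∀ i, MeasurableSpace (α i)]
    (μ : ∀ i, Measure (α i)) [∀ i, IsProbabilityMeasure (μ i)] {f : ∀ i, α i → ℝ≥0∞}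
    (hf : ∀ i, Measurable (f i)) :
    ∫⁻ x, ∏ i, f i (x i) ∂(Measure.pi μ) = ∏ i, ∫⁻ x, f i x ∂(μ i) := by
  refine (lintegral_prod_eq_prod_lintegral_of_indepFun Finset.univ
    (fun i (x : ∀ i, α i) => f i (x i)) (iIndepFun_pi fun i => (hf i).aemeasurable)
    fun i => (hf i).comp (measurable_pi_apply i)).trans ?_
  exact Finset.prod_congr rfl fun i _ =>
    (measurePreserving_eval μ i).lintegral_comp (hf i)

lemma exp_sum_ofReal {ι : Type*} (s : Finset ι) (f : ι → ℝ) :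
    ENNReal.ofReal (Real.exp (∑ i ∈ s, f i)) = ∏ i ∈ s, ENNReal.ofReal (Real.exp (f i)) := by
  rw [Real.exp_sum, ENNReal.ofReal_prod_of_nonneg fun i _ => (Real.exp_pos _).le]

/-- Exponential moments of the squared norm of a vector `Y` whose Laplace transform is dominated by
that of independent `N(0, l i)` variables: `exp (s y²)` is the average of `exp (√(2 s) ζ y)` over
a standard Gaussian `ζ`, so the order of integration can be exchanged. -/
lemma lintegral_exp_sum_sq_le {Ω ι : Type*} [MeasurableSpace Ω] [Fintype ι]
    {μ : Measure Ω} [SFinite μ] {Y : ι → Ω → ℝ} (hY : ∀ i, Measurable (Y i)) {l : ι → ℝ} {s : ℝ}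
    (hs : 0 ≤ s) (hl : ∀ i, 0 ≤ l i) (hsl : ∀ i, s * l i ≤ 1 / 4)
    (h : ∀ ζ : ι → ℝ, ∫⁻ ω, ENNReal.ofReal (Real.exp (∑ i, ζ i * Y i ω)) ∂μ
      ≤ ENNReal.ofReal (Real.exp (∑ i, ζ i ^ 2 * l i / 2))) :
    ∫⁻ ω, ENNReal.ofReal (Real.exp (s * ∑ i, Y i ω ^ 2)) ∂μ
      ≤ ENNReal.ofReal (Real.exp (2 * s * ∑ i, l i)) := by
  have h2 : √(2 * s) ^ 2 = 2 * s := Real.sq_sqrt (by positivity)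
  have key : ∀ ω, ENNReal.ofReal (Real.exp (s * ∑ i, Y i ω ^ 2))
      = ∫⁻ ζ, ENNReal.ofReal (Real.exp (∑ i, (√(2 * s) * ζ i) * Y i ω))
        ∂(Measure.pi fun _ : ι => gaussianReal 0 1) := by
    intro ω
    simp_rw [exp_sum_ofReal]
    rw [lintegral_pi_prod (fun _ : ι => gaussianReal 0 1)
      (f := fun i x => ENNReal.ofReal (Real.exp (√(2 * s) * x * Y i ω))) (fun i => by fun_prop),
      Finset.mul_sum, exp_sum_ofReal]
    refine Finset.prod_congr rfl fun i _ => ?_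
    have := lintegral_exp_mul_gaussianReal (√(2 * s) * Y i ω)
    rw [mul_pow, h2] at this
    rw [show s * Y i ω ^ 2 = 2 * s * Y i ω ^ 2 / 2 by ring, ← this]
    exact lintegral_congr fun x => by ring_nf
  simp_rw [key]
  rw [lintegral_lintegral_swap (by fun_prop)]
  calc _ ≤ ∫⁻ ζ, ENNReal.ofReal (Real.exp (∑ i, (s * l i) * ζ i ^ 2))
        ∂(Measure.pi fun _ : ι => gaussianReal 0 1) := by
        refine lintegral_mono fun ζ => (h fun i => √(2 * s) * ζ i).trans (le_of_eq ?_)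
        congr 3; ext i; rw [mul_pow, h2]; ring
    _ = ∏ i, ENNReal.ofReal ((√(1 - 2 * (s * l i)))⁻¹) := by
        simp_rw [exp_sum_ofReal]
        rw [lintegral_pi_prod (fun _ : ι => gaussianReal 0 1)
          (f := fun i x => ENNReal.ofReal (Real.exp (s * l i * x ^ 2))) (fun i => by fun_prop)]
        exact Finset.prod_congr rfl fun i _ =>
          lintegral_exp_sq_gaussianReal (by have := hsl i; linarith)
    _ ≤ ∏ i, ENNReal.ofReal (Real.exp (2 * (s * l i))) := by
        refine Finset.prod_le_prod' fun i _ => ENNReal.ofReal_le_ofReal ?_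
        have h0 : 0 ≤ s * l i := mul_nonneg hs (hl i)
        have h4 := hsl i
        set x := s * l i
        -- `(1 - 2 x) ^ (-1 / 2) ≤ exp (2 x)` for `0 ≤ x ≤ 1 / 4`
        rw [inv_le_comm₀ (by apply Real.sqrt_pos.2; linarith) (Real.exp_pos _), ← Real.exp_neg]
        apply Real.le_sqrt_of_sq_le
        rw [← Real.exp_nat_mul]
        have h5 : Real.exp (-(4 * x)) ≤ (1 + 4 * x)⁻¹ := by
          rw [Real.exp_neg]
          exact inv_anti₀ (by linarith) (by linarith [Real.add_one_le_exp (4 * x)])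
        have h6 : (1 + 4 * x)⁻¹ ≤ 1 - 2 * x := by
          rw [inv_le_comm₀ (by linarith) (by linarith), inv_le_iff_one_le_mul₀ (by linarith)]
          nlinarith
        calc _ = Real.exp (-(4 * x)) := by congr 1; push_cast; ring
          _ ≤ _ := h5.trans h6
    _ = _ := by rw [← exp_sum_ofReal, ← Finset.mul_sum, ← Finset.mul_sum, mul_assoc]

/-! ### Nets of the unit sphere and linear maps -/

/-- Volumetric bound for the cardinality of a separated subset of the unit ball. -/
lemma card_le_of_separated {E : Type*} [NormedAddCommGroup E] [NormedSpace ℝ E]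
    [FiniteDimensional ℝ E] {ε : ℝ} (hε : 0 < ε) (s : Finset E) (hs : ∀ c ∈ s, ‖c‖ ≤ 1)
    (h : ∀ c ∈ s, ∀ d ∈ s, c ≠ d → ε ≤ ‖c - d‖) :
    (s.card : ℝ) ≤ (1 + 2 / ε) ^ Module.finrank ℝ E := by
  borelize E
  let μ : Measure E := Measure.addHaar
  have hδ : 0 < ε / 2 := by positivity
  have hρ : 0 < 1 + ε / 2 := by positivity
  have D : Set.Pairwise (s : Set E)
      (Function.onFun Disjoint fun c => Metric.ball (c : E) (ε / 2)) := by
    rintro c hc d hd hcd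
    apply Metric.ball_disjoint_ball
    rw [dist_eq_norm]
    linarith [h c hc d hd hcd]
  have hsub : (⋃ c ∈ s, Metric.ball (c : E) (ε / 2)) ⊆ Metric.ball (0 : E) (1 + ε / 2) := by
    refine Set.iUnion₂_subset fun x hx => Metric.ball_subset_ball' ?_
    rw [dist_zero_right]
    linarith [hs x hx]
  have I : (s.card : ℝ≥0∞) * ENNReal.ofReal ((ε / 2) ^ Module.finrank ℝ E) * μ (Metric.ball 0 1)
      ≤ ENNReal.ofReal ((1 + ε / 2) ^ Module.finrank ℝ E) * μ (Metric.ball 0 1) :=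
    calc _ = μ (⋃ c ∈ s, Metric.ball (c : E) (ε / 2)) := by
          rw [measure_biUnion_finset D fun c _ => measurableSet_ball]
          simp only [μ.addHaar_ball_of_pos _ hδ, Finset.sum_const, nsmul_eq_mul, mul_assoc]
      _ ≤ μ (Metric.ball (0 : E) (1 + ε / 2)) := measure_mono hsub
      _ = _ := by simp only [μ.addHaar_ball_of_pos _ hρ]
  have J := (ENNReal.mul_le_mul_iff_left (Metric.measure_ball_pos _ _ zero_lt_one).ne'
    measure_ball_lt_top.ne).1 I
  have K := ENNReal.toReal_le_of_le_ofReal (pow_nonneg hρ.le _) J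
  rw [ENNReal.toReal_mul, ENNReal.toReal_ofReal (by positivity), ENNReal.toReal_natCast] at K
  rw [show 1 + 2 / ε = (1 + ε / 2) / (ε / 2) by field_simp; ring, div_pow,
    le_div_iff₀ (by positivity)]
  exact K

/-- The unit sphere of a finite-dimensional space has an `ε`-net of size `(1 + 2 / ε) ^ dim`, namely
a separated subset of maximal cardinality. -/
lemma exists_sphere_net (E : Type*) [NormedAddCommGroup E] [NormedSpace ℝ E]
    [FiniteDimensional ℝ E] {ε : ℝ} (hε : 0 < ε) :
    ∃ N : Finset E, (∀ x ∈ N, ‖x‖ = 1) ∧ (∀ x : E, ‖x‖ = 1 → ∃ y ∈ N, ‖x - y‖ ≤ ε) ∧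
      (N.card : ℝ) ≤ (1 + 2 / ε) ^ Module.finrank ℝ E := by
  classical
  let S : Set ℕ := {k | ∃ s : Finset E, (∀ c ∈ s, ‖c‖ = 1) ∧
    (∀ c ∈ s, ∀ d ∈ s, c ≠ d → ε ≤ ‖c - d‖) ∧ s.card = k}
  have hne : S.Nonempty := ⟨0, ∅, by simp⟩
  have hbdd : BddAbove S := by
    refine ⟨⌊(1 + 2 / ε) ^ Module.finrank ℝ E⌋₊, ?_⟩
    rintro _ ⟨s, h1, h2, rfl⟩
    exact Nat.le_floor (card_le_of_separated hε s (fun c hc => (h1 c hc).le) h2)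
  obtain ⟨s, h1, h2, h3⟩ := Nat.sSup_mem hne hbdd
  refine ⟨s, h1, fun x hx => ?_, card_le_of_separated hε s (fun c hc => (h1 c hc).le) h2⟩
  by_contra! hcon
  have hxs : x ∉ s := fun hxs => by
    have := hcon x hxs
    simp at this; linarith
  have : (insert x s).card ∈ S := by
    refine ⟨insert x s, ?_, ?_, rfl⟩
    · simp only [Finset.mem_insert]; rintro c (rfl | hc); exacts [hx, h1 c hc]
    · simp only [Finset.mem_insert]
      rintro c (rfl | hc) d (rfl | hd) hcd
      · exact absurd rfl hcd
      · exact (hcon d hd).le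
      · rw [norm_sub_rev]; exact (hcon c hc).le
      · exact h2 c hc d hd hcd
  have := le_csSup hbdd this
  rw [Finset.card_insert_of_notMem hxs, ← h3] at this
  omega

lemma norm_le_of_sphere_net {E F : Type*} [NormedAddCommGroup E] [NormedSpace ℝ E]
    [FiniteDimensional ℝ E] [NormedAddCommGroup F] [NormedSpace ℝ F] (L : E →ₗ[ℝ] F) {ε τ : ℝ}
    (hε : ε < 1) (hτ : 0 ≤ τ) {N : Finset E}
    (hN : ∀ x : E, ‖x‖ = 1 → ∃ y ∈ N, ‖x - y‖ ≤ ε) (h : ∀ y ∈ N, ‖L y‖ ≤ τ) (x : E) :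
    ‖L x‖ ≤ τ / (1 - ε) * ‖x‖ := by
  let T : E →L[ℝ] F := LinearMap.toContinuousLinearMap L
  have hT : ∀ x, T x = L x := fun x => rfl
  have h1 : ‖T‖ ≤ τ + ‖T‖ * ε := by
    have h0 : 0 ≤ τ + ‖T‖ * ε := by
      by_cases hE : ∃ x : E, ‖x‖ = 1
      · obtain ⟨x, hx⟩ := hE
        obtain ⟨y, -, hy⟩ := hN x hx
        have : 0 ≤ ε := (norm_nonneg _).trans hy
        positivity
      · have : ‖T‖ = 0 := by
          rw [norm_eq_zero]; ext x
          by_contra hx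
          have hx0 : x ≠ 0 := fun h => hx (by simp [h])
          exact hE ⟨‖x‖⁻¹ • x, by rw [norm_smul, norm_inv, norm_norm,
            inv_mul_cancel₀ (norm_ne_zero_iff.2 hx0)]⟩
        simpa [this] using hτ
    refine ContinuousLinearMap.opNorm_le_of_unit_norm h0 fun x hx => ?_
    obtain ⟨y, hy, hxy⟩ := hN x hx
    calc ‖T x‖ = ‖T y + T (x - y)‖ := by rw [← map_add]; congr 2; abel
      _ ≤ ‖T y‖ + ‖T (x - y)‖ := norm_add_le _ _
      _ ≤ τ + ‖T‖ * ε := add_le_add (h y hy)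
          ((T.le_opNorm _).trans (mul_le_mul_of_nonneg_left hxy (norm_nonneg _)))
  have h2 : ‖T‖ ≤ τ / (1 - ε) := by
    rw [le_div_iff₀ (by linarith)]; linarith
  rw [← hT]
  exact (T.le_opNorm x).trans (mul_le_mul_of_nonneg_right h2 (norm_nonneg _))

lemma le_norm_of_sphere_net {E F : Type*} [NormedAddCommGroup E] [NormedSpace ℝ E]
    [NormedAddCommGroup F] [NormedSpace ℝ F] (L : E →ₗ[ℝ] F) {ε τ M : ℝ} (hM : 0 ≤ M)
    {N : Finset E} (hN : ∀ x : E, ‖x‖ = 1 → ∃ y ∈ N, ‖x - y‖ ≤ ε) (h : ∀ y ∈ N, τ ≤ ‖L y‖)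
    (hL : ∀ x, ‖L x‖ ≤ M * ‖x‖) (x : E) : (τ - M * ε) * ‖x‖ ≤ ‖L x‖ := by
  rcases eq_or_ne x 0 with rfl | hx
  · simp
  have hx' : 0 < ‖x‖ := norm_pos_iff.2 hx
  have hu : ‖‖x‖⁻¹ • x‖ = 1 := by
    rw [norm_smul, norm_inv, norm_norm, inv_mul_cancel₀ hx'.ne']
  obtain ⟨y, hy, hxy⟩ := hN _ hu
  have h1 : τ - M * ε ≤ ‖L (‖x‖⁻¹ • x)‖ := by
    have h2 : ‖L y‖ ≤ ‖L (‖x‖⁻¹ • x)‖ + ‖L (‖x‖⁻¹ • x - y)‖ := by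
      rw [map_sub, norm_sub_rev]; exact norm_le_norm_add_norm_sub' _ _
    have h3 := (hL (‖x‖⁻¹ • x - y)).trans (mul_le_mul_of_nonneg_left hxy hM)
    linarith [h y hy]
  rw [map_smul, norm_smul, norm_inv, norm_norm, ← div_eq_inv_mul, le_div_iff₀ hx'] at h1
  exact h1

/-- A linear map which is bounded below has an adjoint with a bounded right inverse: `θ = L w`,
where `w` solves the normal equation `L† L w = v`. -/
lemma exists_adjoint_eq {E F : Type*} [NormedAddCommGroup E] [InnerProductSpace ℝ E]
    [FiniteDimensional ℝ E] [NormedAddCommGroup F] [InnerProductSpace ℝ F]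
    [FiniteDimensional ℝ F] (L : E →ₗ[ℝ] F) {c : ℝ} (hc : 0 < c)
    (hL : ∀ x, c * ‖x‖ ≤ ‖L x‖) (v : E) :
    ∃ θ : F, LinearMap.adjoint L θ = v ∧ c * ‖θ‖ ≤ ‖v‖ := by
  have hsq : ∀ x, inner ℝ ((LinearMap.adjoint L ∘ₗ L) x) x = ‖L x‖ ^ 2 := fun x => by
    rw [LinearMap.comp_apply, LinearMap.adjoint_inner_left, real_inner_self_eq_norm_sq]
  have hinj : Function.Injective (LinearMap.adjoint L ∘ₗ L) := by
    rw [← LinearMap.ker_eq_bot, LinearMap.ker_eq_bot']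
    intro x hx
    have h1 := hsq x
    rw [hx, inner_zero_left] at h1
    have h2 : ‖L x‖ = 0 := by
      rcases pow_eq_zero_iff (two_ne_zero) |>.1 h1.symm with h; exact h
    have h3 := hL x
    rw [h2] at h3
    have : ‖x‖ ≤ 0 := by nlinarith [norm_nonneg x]
    exact norm_le_zero_iff.1 this
  obtain ⟨w, hw⟩ := LinearMap.surjective_of_injective hinj v
  refine ⟨L w, hw, ?_⟩
  have h1 := hsq w
  rw [hw] at h1
  have h2 : ‖L w‖ ^ 2 ≤ ‖v‖ * ‖w‖ := h1 ▸ real_inner_le_norm v w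
  rcases eq_or_lt_of_le (norm_nonneg (L w)) with h0 | h0
  · rw [← h0]; simp
  · have h3 := mul_le_mul_of_nonneg_left (hL w) (norm_nonneg v)
    have : ‖L w‖ * (c * ‖L w‖) ≤ ‖L w‖ * ‖v‖ := by nlinarith
    exact le_of_mul_le_mul_left this h0

/-! ### Coefficients of a Gaussian process -/

lemma integral_norm_le_norm_Lp {U : Type*} [MeasurableSpace U] {ν : Measure U}
    [IsProbabilityMeasure ν] (Y : Lp ℝ 2 ν) : ∫ u, ‖Y u‖ ∂ν ≤ ‖Y‖ := by
  rw [Lp.norm_def, integral_norm_eq_lintegral_enorm (Lp.aestronglyMeasurable Y),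
    ← eLpNorm_one_eq_lintegral_enorm]
  exact ENNReal.toReal_mono (Lp.eLpNorm_ne_top Y)
    (eLpNorm_le_eLpNorm_of_exponent_le one_le_two (Lp.aestronglyMeasurable Y))

lemma norm_Lp_sq {U : Type*} [MeasurableSpace U] {ν : Measure U} (Y : Lp ℝ 2 ν) :
    ‖Y‖ ^ 2 = ∫ u, Y u ^ 2 ∂ν := by
  rw [← real_inner_self_eq_norm_sq, L2.inner_def]
  simp [sq]

lemma sq_integral_le {X : Type*} [MeasurableSpace X] {Q : Measure X} [IsProbabilityMeasure Q]
    {h : X → ℝ} (hh : MemLp h 2 Q) : (∫ x, h x ∂Q) ^ 2 ≤ ∫ x, h x ^ 2 ∂Q := by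
  have h1 := variance_nonneg h Q
  rw [variance_eq_sub hh] at h1
  simpa using h1

/-- The square integrable functions with the characteristic function of a centred Gaussian
variable form a closed subset of `L²`. -/
lemma isClosed_setOf_charFun_gaussian {U : Type*} [MeasurableSpace U] (ν : Measure U)
    [IsProbabilityMeasure ν] :
    IsClosed {Y : Lp ℝ 2 ν | ∀ t : ℝ, ∫ u, Complex.exp ((t * Y u : ℝ) * Complex.I) ∂ν
      = Complex.exp (-(t ^ 2 * ‖Y‖ ^ 2 / 2 : ℝ))} := by
  rw [show {Y : Lp ℝ 2 ν | ∀ t : ℝ, ∫ u, Complex.exp ((t * Y u : ℝ) * Complex.I) ∂ν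
      = Complex.exp (-(t ^ 2 * ‖Y‖ ^ 2 / 2 : ℝ))} = ⋂ t : ℝ, {Y : Lp ℝ 2 ν |
      ∫ u, Complex.exp ((t * Y u : ℝ) * Complex.I) ∂ν
      = Complex.exp (-(t ^ 2 * ‖Y‖ ^ 2 / 2 : ℝ))} by ext; simp]
  refine isClosed_iInter fun t => isClosed_eq ?_ (by fun_prop)
  have hint : ∀ Y : Lp ℝ 2 ν, Integrable (fun u => Complex.exp ((t * Y u : ℝ) * Complex.I)) ν := by
    intro Y
    refine Integrable.of_bound (C := 1) ?_ ?_
    · have := (Lp.aestronglyMeasurable Y)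
      have hc : Continuous fun y : ℝ => Complex.exp ((t * y : ℝ) * Complex.I) := by fun_prop
      exact hc.comp_aestronglyMeasurable this
    · exact Eventually.of_forall fun u => (Complex.norm_exp_ofReal_mul_I _).le
  have hL : LipschitzWith (Real.toNNReal |t|) fun Y : Lp ℝ 2 ν =>
      ∫ u, Complex.exp ((t * Y u : ℝ) * Complex.I) ∂ν := by
    refine LipschitzWith.of_dist_le_mul fun Y Y' => ?_
    rw [Real.coe_toNNReal _ (abs_nonneg t), dist_eq_norm, dist_eq_norm,
      ← integral_sub (hint Y) (hint Y')]
    have hmem : MemLp (Y - Y' : Lp ℝ 2 ν) 2 ν := Lp.memLp _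
    have hI : Integrable (fun u => ‖(Y - Y' : Lp ℝ 2 ν) u‖) ν := (hmem.integrable one_le_two).norm
    calc _ ≤ ∫ u, |t| * ‖(Y - Y' : Lp ℝ 2 ν) u‖ ∂ν := by
          refine norm_integral_le_of_norm_le (hI.const_mul _) ?_
          filter_upwards [Lp.coeFn_sub Y Y'] with u hu
          rw [hu, Pi.sub_apply]
          have h1 : Complex.exp ((t * Y u : ℝ) * Complex.I)
                - Complex.exp ((t * Y' u : ℝ) * Complex.I)
              = Complex.exp ((t * Y' u : ℝ) * Complex.I) *
                (Complex.exp (Complex.I * (t * (Y u - Y' u) : ℝ)) - 1) := by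
            rw [mul_sub, ← Complex.exp_add, mul_one]; congr 2; push_cast; ring
          rw [h1, norm_mul, Complex.norm_exp_ofReal_mul_I, one_mul]
          refine (Real.norm_exp_I_mul_ofReal_sub_one_le).trans ?_
          rw [norm_mul, Real.norm_eq_abs]
      _ = |t| * ∫ u, ‖(Y - Y' : Lp ℝ 2 ν) u‖ ∂ν := integral_const_mul _ _
      _ ≤ |t| * ‖Y - Y'‖ := by
          refine mul_le_mul_of_nonneg_left ?_ (abs_nonneg _)
          exact integral_norm_le_norm_Lp _
  exact hL.continuous

section GaussianProcess

variable {U X : Type*} [MeasurableSpace U] [MeasurableSpace X] {ν : Measure U}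
  [IsProbabilityMeasure ν] {Q : Measure X} [IsProbabilityMeasure Q] {k : X → X → ℝ}
  {gp : U → X → ℝ} {K : ℝ}

lemma IsGPSample.memLp_eval (hgp : IsGPSample ν Q k gp) (x : X) : MemLp (fun u => gp u x) 2 ν :=
  (hgp.gaussian.hasGaussianLaw_eval x).memLp_two

lemma IsGPSample.ae_memLp (hgp : IsGPSample ν Q k gp) : ∀ᵐ u ∂ν, MemLp (gp u) 2 Q := by
  filter_upwards [hgp.bounded] with u hu
  have : MemLp (gp u) ∞ Q :=
    ⟨(hgp.measurable.comp (measurable_const.prodMk measurable_id)).aestronglyMeasurable, hu⟩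
  exact this.mono_exponent le_top

lemma IsGPSample.charFun_of_mem_span (hgp : IsGPSample ν Q k gp) {Y : Lp ℝ 2 ν}
    (hY : Y ∈ Submodule.span ℝ (Set.range fun x => (hgp.memLp_eval x).toLp _)) (t : ℝ) :
    ∫ u, Complex.exp ((t * Y u : ℝ) * Complex.I) ∂ν
      = Complex.exp (-(t ^ 2 * ‖Y‖ ^ 2 / 2 : ℝ)) := by
  obtain ⟨c, rfl⟩ := Finsupp.mem_span_range_iff_exists_finsupp.1 hY
  rw [Finsupp.sum]
  set Y : Lp ℝ 2 ν := ∑ x ∈ c.support, c x • (hgp.memLp_eval x).toLp _ with hYdef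
  have h1 : Y =ᵐ[ν] fun u => ∑ x ∈ c.support, c x * gp u x := by
    have ha : ∀ᵐ u ∂ν, ∀ x ∈ c.support,
        (c x • (hgp.memLp_eval x).toLp _ : Lp ℝ 2 ν) u = c x * gp u x := by
      rw [Finset.eventually_all]
      intro x _
      filter_upwards [Lp.coeFn_smul (c x) ((hgp.memLp_eval x).toLp _),
        (hgp.memLp_eval x).coeFn_toLp] with u h1 h2
      rw [h1, Pi.smul_apply, h2, smul_eq_mul]
    filter_upwards [Lp.coeFn_finsetSum c.support fun x => c x • (hgp.memLp_eval x).toLp _, ha]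
      with u h1 h2
    rw [hYdef, h1, Finset.sum_apply]
    exact Finset.sum_congr rfl h2
  have h2 : HasGaussianLaw Y ν := by
    refine HasGaussianLaw.congr ?_ h1.symm
    exact (hgp.gaussian.smul c).hasGaussianLaw_fun_sum
  have h3 : ∫ u, Y u ∂ν = 0 := by
    rw [integral_congr_ae h1, integral_finsetSum]
    · simp [integral_const_mul, hgp.mean_zero]
    · exact fun x _ => ((hgp.memLp_eval x).integrable one_le_two).const_mul _
  have h4 := h2.map_eq_gaussianReal
  rw [h3] at h4
  have h5 : Var[Y; ν] = ‖Y‖ ^ 2 := by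
    rw [variance_of_integral_eq_zero h2.aemeasurable h3, norm_Lp_sq]
  have h6 := charFun_gaussianReal (μ := 0) (v := Var[Y; ν].toNNReal) t
  rw [← h4, charFun_apply_real, integral_map h2.aemeasurable
    (by apply Continuous.aestronglyMeasurable; fun_prop)] at h6
  convert h6 using 2
  · ext u; push_cast; rfl
  · rw [h5, Real.coe_toNNReal _ (by positivity)]; push_cast; ring

variable (Q gp) in
/-- The coefficient `⟨f, gp u⟩` in `L²(Q)`. -/
def coef (f : X → ℝ) (u : U) : ℝ := ∫ x, f x * gp u x ∂Q

lemma IsGPSample.measurable_coef (hgp : IsGPSample ν Q k gp) {f : X → ℝ} (hf : Measurable f) :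
    Measurable (coef Q gp f) := by
  have hm := hgp.measurable
  have : StronglyMeasurable (Function.uncurry fun u x => f x * gp u x) := by
    apply Measurable.stronglyMeasurable
    exact (hf.comp measurable_snd).mul hm
  exact this.integral_prod_right.measurable

lemma IsGPSample.integral_sq (hgp : IsGPSample ν Q k gp) (x : X) :
    ∫ u, gp u x ^ 2 ∂ν = k x x := by
  rw [← hgp.cov x x]; simp [sq]

/-- `f(x) g(u, x)` is square integrable on the product space. -/
lemma IsGPSample.integrable_sq_mul (hgp : IsGPSample ν Q k gp) (hK : ∀ x, k x x ≤ K)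
    {f : X → ℝ} (hf : Measurable f) (hf2 : MemLp f 2 Q) :
    Integrable (fun p : U × X => (f p.2 * gp p.1 p.2) ^ 2) (ν.prod Q) := by
  have hm := hgp.measurable
  have hmeas : Measurable fun p : U × X => (f p.2 * gp p.1 p.2) ^ 2 :=
    ((hf.comp measurable_snd).mul hm).pow_const 2
  rw [integrable_prod_iff' hmeas.aestronglyMeasurable]
  refine ⟨Eventually.of_forall fun x => ?_, ?_⟩
  · simp_rw [mul_pow]
    exact (hgp.memLp_eval x).integrable_sq.const_mul _
  · have : ∀ x, ∫ u, ‖(f x * gp u x) ^ 2‖ ∂ν = f x ^ 2 * k x x := fun x => by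
      rw [← hgp.integral_sq, ← integral_const_mul]
      congr 1; ext u; rw [Real.norm_of_nonneg (by positivity), mul_pow]
    simp_rw [this]
    have hk0 : ∀ x, 0 ≤ k x x := fun x => by
      rw [← hgp.integral_sq]; exact integral_nonneg fun u => by positivity
    refine Integrable.mono' (hf2.integrable_sq.const_mul K) ?_ (Eventually.of_forall fun x => ?_)
    · simp_rw [← this]
      have h1 : StronglyMeasurable fun p : X × U => ‖(f p.1 * gp p.2 p.1) ^ 2‖ :=
        (hmeas.comp measurable_swap).norm.stronglyMeasurable
      exact h1.integral_prod_right.aestronglyMeasurable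
    · rw [Real.norm_of_nonneg (mul_nonneg (by positivity) (hk0 x)), mul_comm]
      exact mul_le_mul_of_nonneg_right (hK x) (by positivity)

lemma IsGPSample.memLp_coef (hgp : IsGPSample ν Q k gp) (hK : ∀ x, k x x ≤ K)
    {f : X → ℝ} (hf : Measurable f) (hf2 : MemLp f 2 Q) : MemLp (coef Q gp f) 2 ν := by
  rw [memLp_two_iff_integrable_sq (hgp.measurable_coef hf).aestronglyMeasurable]
  have h1 := hgp.integrable_sq_mul hK hf hf2
  refine Integrable.mono' h1.integral_prod_left
    ((hgp.measurable_coef hf).pow_const 2).aestronglyMeasurable ?_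
  filter_upwards [h1.prod_right_ae] with u hu
  rw [Real.norm_of_nonneg (by positivity)]
  refine sq_integral_le ((memLp_two_iff_integrable_sq ?_).2 hu)
  exact (hf.mul (hgp.measurable.comp (measurable_const.prodMk measurable_id))).aestronglyMeasurable

lemma IsGPSample.integral_coef_mul (hgp : IsGPSample ν Q k gp) (hK : ∀ x, k x x ≤ K)
    {f : X → ℝ} (hf : Measurable f) (hf2 : MemLp f 2 Q) {Y : U → ℝ} (hY : MemLp Y 2 ν) :
    ∫ u, coef Q gp f u * Y u ∂ν = ∫ x, f x * ∫ u, gp u x * Y u ∂ν ∂Q := by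
  have h1 := hgp.integrable_sq_mul hK hf hf2
  have hm : Measurable fun p : U × X => f p.2 * gp p.1 p.2 :=
    (hf.comp measurable_snd).mul hgp.measurable
  have h2 : MemLp (fun p : U × X => f p.2 * gp p.1 p.2) 2 (ν.prod Q) :=
    (memLp_two_iff_integrable_sq hm.aestronglyMeasurable).2 h1
  have h3 : MemLp (fun p : U × X => Y p.1) 2 (ν.prod Q) := hY.comp_fst Q
  have h4 : Integrable (fun p : U × X => f p.2 * gp p.1 p.2 * Y p.1) (ν.prod Q) :=
    h2.integrable_mul h3
  simp_rw [coef, ← integral_mul_const, ← integral_const_mul]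
  rw [integral_integral_swap h4]
  simp_rw [mul_assoc]

/-- The `L²(Q)`-coefficients of a Gaussian process are limits of linear combinations of its
values, hence Gaussian. -/
lemma IsGPSample.map_coef (hgp : IsGPSample ν Q k gp) (hK : ∀ x, k x x ≤ K)
    {f : X → ℝ} (hf : Measurable f) (hf2 : MemLp f 2 Q) {v : NNReal}
    (hv : ∫ x, f x * ∫ y, k x y * f y ∂Q ∂Q = v) :
    ν.map (coef Q gp f) = gaussianReal 0 v := by
  have hmem := hgp.memLp_coef hK hf hf2
  set S := Submodule.span ℝ (Set.range fun x => (hgp.memLp_eval x).toLp _) with hS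
  -- a variable orthogonal to all values of the process is orthogonal to the coefficient
  have h1 : hmem.toLp _ ∈ S.topologicalClosure := by
    rw [← Submodule.orthogonal_orthogonal_eq_closure, Submodule.mem_orthogonal]
    intro W hW
    rw [Submodule.mem_orthogonal] at hW
    have h2 : ∀ x, ∫ u, gp u x * W u ∂ν = 0 := fun x => by
      have h3 := hW _ (Submodule.subset_span ⟨x, rfl⟩)
      rw [L2.inner_def] at h3
      rw [← h3]
      refine integral_congr_ae ?_
      filter_upwards [(hgp.memLp_eval x).coeFn_toLp] with u hu
      simp [hu, mul_comm]
    have h4 := hgp.integral_coef_mul hK hf hf2 (Lp.memLp W)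
    simp only [h2, mul_zero, integral_zero] at h4
    rw [L2.inner_def, ← h4]
    refine integral_congr_ae ?_
    filter_upwards [hmem.coeFn_toLp] with u hu
    simp [hu]
  have h5 := closure_minimal (fun Y hY t => hgp.charFun_of_mem_span hY t)
    (isClosed_setOf_charFun_gaussian ν) h1
  have h6 : ‖hmem.toLp _‖ ^ 2 = v := by
    rw [norm_Lp_sq, ← hv]
    have h7 : ∀ x, ∫ u, gp u x * coef Q gp f u ∂ν = ∫ y, k x y * f y ∂Q := fun x => by
      simp_rw [mul_comm (gp _ x)]
      rw [hgp.integral_coef_mul hK hf hf2 (hgp.memLp_eval x)]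
      congr 1; ext y; rw [mul_comm]; congr 1; rw [← hgp.cov]; congr 1; ext u; ring
    simp_rw [← h7]
    rw [← hgp.integral_coef_mul hK hf hf2 hmem]
    refine integral_congr_ae ?_
    filter_upwards [hmem.coeFn_toLp] with u hu
    rw [hu]; ring
  have hmc := hgp.measurable_coef hf
  have := Measure.isProbabilityMeasure_map (μ := ν) hmc.aemeasurable
  refine Measure.ext_of_charFun ?_
  ext t
  rw [charFun_gaussianReal, charFun_apply_real, integral_map hmc.aemeasurable
    (by apply Continuous.aestronglyMeasurable; fun_prop)]
  have h8 := h5 t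
  rw [h6] at h8
  refine Eq.trans (integral_congr_ae ?_) (h8.trans ?_)
  · filter_upwards [hmem.coeFn_toLp] with u hu
    rw [hu]; push_cast; rfl
  · push_cast; ring_nf

end GaussianProcess

/-! ### Mercer expansion of the sample paths -/

/-- Parseval's identity for an orthonormal family and a vector in its closed span; the latter is
expressed as orthogonality to the orthogonal complement of the family. -/
lemma hasSum_inner_sq {H ι : Type*} [NormedAddCommGroup H] [InnerProductSpace ℝ H]
    [CompleteSpace H] {e : ι → H} (he : Orthonormal ℝ e) {x : H}
    (hx : ∀ f, (∀ i, inner ℝ (e i) f = 0) → inner ℝ f x = 0) :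
    HasSum (fun i => (inner ℝ (e i) x) ^ 2) (‖x‖ ^ 2) := by
  obtain ⟨w, b, hw, hb⟩ := he.toSubtypeRange.exists_hilbertBasis_extension
  have h1 := b.hasSum_inner_mul_inner x x
  rw [real_inner_self_eq_norm_sq] at h1
  have hinj : Function.Injective fun i => (⟨e i, hw ⟨i, rfl⟩⟩ : w) := fun i j hij =>
    he.linearIndependent.injective (Subtype.ext_iff.1 hij)
  rw [← hinj.hasSum_iff] at h1
  · have h2 : (fun i => (inner ℝ (e i) x) ^ 2) = (fun i => inner ℝ x (b i) * inner ℝ (b i) x) ∘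
        fun i => (⟨e i, hw ⟨i, rfl⟩⟩ : w) := by
      funext i
      simp only [Function.comp_apply, hb, sq, real_inner_comm x]
    rw [h2]
    exact h1
  · intro f hf
    have h2 : inner ℝ (b f) x = 0 := by
      refine hx _ fun i => ?_
      have h3 : (⟨e i, hw ⟨i, rfl⟩⟩ : w) ≠ f := fun h => hf ⟨i, h⟩
      have := b.orthonormal.2 h3
      rwa [hb] at this ⊢
    rw [h2, mul_zero]

section Mercer

variable {X : Type*} [MeasurableSpace X] {Q : Measure X} [IsProbabilityMeasure Q]
  {k : X → X → ℝ} {lam : ℕ → ℝ} {ψ : ℕ → X → ℝ} {b D : ℝ}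

variable (Q lam ψ) in
/-- `g` lies in the closed linear span in `L²(Q)` of the eigenfunctions `ψ i` with `lam i ≠ 0`,
i.e. it is orthogonal to every function orthogonal to all of them. -/
structure InMercerSpan (g : X → ℝ) : Prop where
  memLp : MemLp g 2 Q
  integral_mul : ∀ f : X → ℝ, MemLp f 2 Q → (∀ i, lam i ≠ 0 → ∫ x, ψ i x * f x ∂Q = 0) →
    ∫ x, f x * g x ∂Q = 0

lemma InMercerSpan.sum {ι : Type*} {s : Finset ι} {g : ι → X → ℝ} (c : ι → ℝ)
    (h : ∀ i ∈ s, InMercerSpan Q lam ψ (g i)) :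
    InMercerSpan Q lam ψ (fun x => ∑ i ∈ s, c i * g i x) := by
  refine ⟨memLp_finsetSum s fun i hi => (h i hi).memLp.const_mul (c i), fun f hf hf0 => ?_⟩
  simp_rw [Finset.mul_sum]
  rw [integral_finsetSum]
  · refine Finset.sum_eq_zero fun i hi => ?_
    simp_rw [mul_left_comm _ (c i)]
    rw [integral_const_mul, (h i hi).integral_mul f hf hf0, mul_zero]
  · intro i hi
    exact hf.integrable_mul ((h i hi).memLp.const_mul (c i))

variable (Q lam ψ) in
/-- The functions `ψ i` with `lam i ≠ 0` are orthonormal in `L²(Q)`. This part of `IsMercerSystem`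
is all that is needed of the functions `ψ i ∘ Φ` on the input space. -/
structure IsOrthonormalSystem : Prop where
  memLp : ∀ i, lam i ≠ 0 → MemLp (ψ i) 2 Q
  orthonormal : ∀ i j, lam i ≠ 0 → lam j ≠ 0 →
    ∫ x, ψ i x * ψ j x ∂Q = if i = j then 1 else 0

lemma IsMercerSystem.isOrthonormalSystem (h : IsMercerSystem Q k lam ψ) :
    IsOrthonormalSystem Q lam ψ := ⟨h.memLp, h.orthonormal⟩

lemma IsOrthonormalSystem.integrable_mul (h : IsOrthonormalSystem Q lam ψ) {i : ℕ} (hi : lam i ≠ 0)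
    {g : X → ℝ} (hg : MemLp g 2 Q) : Integrable (fun x => ψ i x * g x) Q :=
  (h.memLp i hi).integrable_mul hg

lemma IsOrthonormalSystem.memLp_proj (h : IsOrthonormalSystem Q lam ψ) (r : ℕ) (g : X → ℝ) :
    MemLp (mercerProj Q lam ψ r g) 2 Q :=
  memLp_finsetSum _ fun i hi => (h.memLp i (Finset.mem_filter.1 hi).2).const_mul _

lemma IsOrthonormalSystem.integral_mul_proj (h : IsOrthonormalSystem Q lam ψ) (r : ℕ) (g : X → ℝ)
    {i : ℕ} (hi : lam i ≠ 0) :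
    ∫ x, ψ i x * mercerProj Q lam ψ r g x ∂Q = if i < r then ∫ x, ψ i x * g x ∂Q else 0 := by
  simp_rw [mercerProj, Finset.mul_sum, mul_left_comm (ψ i _)]
  rw [integral_finsetSum]
  · simp_rw [integral_const_mul]
    rw [Finset.sum_congr rfl fun j hj => by rw [h.orthonormal i j hi (Finset.mem_filter.1 hj).2]]
    simp [hi]
  · intro j hj
    exact (h.integrable_mul hi (h.memLp j (Finset.mem_filter.1 hj).2)).const_mul _

lemma lintegral_ofReal_sq_eq {g : X → ℝ} (hg : MemLp g 2 Q) :
    ∫⁻ x, ENNReal.ofReal (g x ^ 2) ∂Q = ENNReal.ofReal (‖hg.toLp g‖ ^ 2) := by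
  rw [norm_Lp_sq, ← ofReal_integral_eq_lintegral_ofReal hg.integrable_sq
    (Eventually.of_forall fun x => by positivity)]
  congr 1
  refine integral_congr_ae ?_
  filter_upwards [hg.coeFn_toLp] with x hx
  rw [hx]

lemma inner_toLp {f g : X → ℝ} (hf : MemLp f 2 Q) (hg : MemLp g 2 Q) :
    inner ℝ (hf.toLp f) (hg.toLp g) = ∫ x, f x * g x ∂Q := by
  rw [L2.inner_def]
  refine integral_congr_ae ?_
  filter_upwards [hg.coeFn_toLp, hf.coeFn_toLp] with x hx hx'
  simp [hx, hx', mul_comm]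

lemma IsOrthonormalSystem.orthonormal_toLp (h : IsOrthonormalSystem Q lam ψ) :
    Orthonormal ℝ fun i : {i // lam i ≠ 0} => (h.memLp i.1 i.2).toLp (ψ i.1) := by
  classical
  rw [orthonormal_iff_ite]
  intro i j
  rw [inner_toLp, h.orthonormal i.1 j.1 i.2 j.2]
  simp [Subtype.ext_iff]

/-- Parseval's identity in the span of the eigenfunctions. -/
lemma IsMercerSystem.lintegral_sq (h : IsMercerSystem Q k lam ψ) {g : X → ℝ}
    (hg : InMercerSpan Q lam ψ g) :
    ∫⁻ x, ENNReal.ofReal (g x ^ 2) ∂Q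
      = ∑' i, if lam i ≠ 0 then ENNReal.ofReal ((∫ x, ψ i x * g x ∂Q) ^ 2) else 0 := by
  rw [lintegral_ofReal_sq_eq hg.memLp]
  have h1 := hasSum_inner_sq h.isOrthonormalSystem.orthonormal_toLp (x := hg.memLp.toLp g) (by
    intro f hf
    have h2 := hg.integral_mul f (Lp.memLp f) fun i hi => by
      rw [← inner_toLp (h.memLp i hi) (Lp.memLp f), Lp.toLp_coeFn]
      exact hf ⟨i, hi⟩
    rwa [← inner_toLp (Lp.memLp f) hg.memLp, Lp.toLp_coeFn] at h2)
  rw [← h1.tsum_eq, ENNReal.ofReal_tsum_of_nonneg (fun i => by positivity) h1.summable]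
  simp_rw [inner_toLp]
  refine (tsum_subtype {i | lam i ≠ 0}
    fun i => ENNReal.ofReal ((∫ x, ψ i x * g x ∂Q) ^ 2)).trans (tsum_congr fun i => ?_)
  simp [Set.indicator_apply]

/-- The residual of a projection, as the supremum of the partial sums of the squares of the
remaining coefficients. -/
lemma IsMercerSystem.lintegral_sq_sub_proj (h : IsMercerSystem Q k lam ψ) {g : X → ℝ}
    (hg : InMercerSpan Q lam ψ g) (r : ℕ) :
    ∫⁻ x, ENNReal.ofReal ((g x - mercerProj Q lam ψ r g x) ^ 2) ∂Q
      = ⨆ M, ENNReal.ofReal (∑ i ∈ Finset.range M with r ≤ i ∧ lam i ≠ 0,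
        (∫ x, ψ i x * g x ∂Q) ^ 2) := by
  have hP := h.isOrthonormalSystem.memLp_proj r g
  have h1 : InMercerSpan Q lam ψ (fun x => g x - mercerProj Q lam ψ r g x) := by
    refine ⟨hg.memLp.sub hP, fun f hf hf0 => ?_⟩
    simp_rw [mul_sub]
    have e1 : Integrable (fun x => f x * g x) Q := hf.integrable_mul hg.memLp
    have e2 : Integrable (fun x => f x * mercerProj Q lam ψ r g x) Q := hf.integrable_mul hP
    rw [integral_sub e1 e2, hg.integral_mul f hf hf0, zero_sub, neg_eq_zero]
    simp_rw [mercerProj, Finset.mul_sum, mul_left_comm (f _)]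
    rw [integral_finsetSum]
    · refine Finset.sum_eq_zero fun i hi => ?_
      rw [integral_const_mul]
      simp_rw [mul_comm (f _)]
      rw [hf0 i (Finset.mem_filter.1 hi).2, mul_zero]
    · intro i hi
      exact (hf.integrable_mul (h.memLp i (Finset.mem_filter.1 hi).2)).const_mul _
  rw [h.lintegral_sq h1, ENNReal.tsum_eq_iSup_nat]
  congr 1; ext M
  rw [ENNReal.ofReal_sum_of_nonneg (fun i _ => by positivity), Finset.sum_filter]
  refine Finset.sum_congr rfl fun i _ => ?_
  by_cases hi : lam i = 0
  · simp [hi]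
  · simp_rw [mul_sub]
    rw [integral_sub (h.isOrthonormalSystem.integrable_mul hi hg.memLp)
        (h.isOrthonormalSystem.integrable_mul hi hP),
      h.isOrthonormalSystem.integral_mul_proj r g hi]
    by_cases hr : i < r
    · simp [hi, hr, not_le.2 hr]
    · simp [hi, hr, not_lt.1 hr]

lemma IsOrthonormalSystem.integral_proj_mul (h : IsOrthonormalSystem Q lam ψ) (r : ℕ) (g : X → ℝ)
    {f : X → ℝ} (hf : MemLp f 2 Q) :
    ∫ x, mercerProj Q lam ψ r g x * f x ∂Q = ∑ i ∈ Finset.range r with lam i ≠ 0,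
      (∫ x, ψ i x * g x ∂Q) * ∫ x, ψ i x * f x ∂Q := by
  simp_rw [mercerProj, Finset.sum_mul, mul_assoc]
  rw [integral_finsetSum]
  · simp_rw [integral_const_mul]
  · exact fun i hi => (h.integrable_mul (Finset.mem_filter.1 hi).2 hf).const_mul _

lemma IsOrthonormalSystem.integral_sq_sub_proj (h : IsOrthonormalSystem Q lam ψ) {g : X → ℝ}
    (hg : MemLp g 2 Q) (r : ℕ) :
    ∫ x, (g x - mercerProj Q lam ψ r g x) ^ 2 ∂Q = ∫ x, g x ^ 2 ∂Q
      - ∑ i ∈ Finset.range r with lam i ≠ 0, (∫ x, ψ i x * g x ∂Q) ^ 2 := by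
  have hP := h.memLp_proj r g
  have e1 : Integrable (fun x => mercerProj Q lam ψ r g x * g x) Q := hP.integrable_mul hg
  have e2 : Integrable (fun x => mercerProj Q lam ψ r g x * mercerProj Q lam ψ r g x) Q :=
    hP.integrable_mul hP
  have h1 : ∀ x, (g x - mercerProj Q lam ψ r g x) ^ 2 = g x ^ 2
      - 2 * (mercerProj Q lam ψ r g x * g x)
      + mercerProj Q lam ψ r g x * mercerProj Q lam ψ r g x := fun x => by ring
  simp_rw [h1]
  have e3 : Integrable (fun x => g x ^ 2 - 2 * (mercerProj Q lam ψ r g x * g x)) Q :=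
    hg.integrable_sq.sub (e1.const_mul 2)
  rw [integral_add e3 e2, integral_sub hg.integrable_sq (e1.const_mul 2), integral_const_mul,
    h.integral_proj_mul r g hg, h.integral_proj_mul r g hP]
  have h2 : ∀ i ∈ Finset.filter (fun i => lam i ≠ 0) (Finset.range r), (∫ x, ψ i x * g x ∂Q) *
      ∫ x, ψ i x * mercerProj Q lam ψ r g x ∂Q = (∫ x, ψ i x * g x ∂Q) ^ 2 := fun i hi => by
    rw [Finset.mem_filter, Finset.mem_range] at hi
    rw [h.integral_mul_proj r g hi.2, if_pos hi.1, sq]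
  rw [Finset.sum_congr rfl h2]
  simp_rw [← sq]
  ring

/-- Bessel's inequality. -/
lemma IsOrthonormalSystem.sum_sq_le (h : IsOrthonormalSystem Q lam ψ) {g : X → ℝ}
    (hg : MemLp g 2 Q) (r : ℕ) :
    ∑ i ∈ Finset.range r with lam i ≠ 0, (∫ x, ψ i x * g x ∂Q) ^ 2 ≤ ∫ x, g x ^ 2 ∂Q := by
  have h1 := h.integral_sq_sub_proj hg r
  have h2 : 0 ≤ ∫ x, (g x - mercerProj Q lam ψ r g x) ^ 2 ∂Q :=
    integral_nonneg fun x => by positivity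
  linarith

lemma IsOrthonormalSystem.integral_sq_sub_proj_le (h : IsOrthonormalSystem Q lam ψ) {g : X → ℝ}
    (hg : MemLp g 2 Q) (r : ℕ) :
    ∫ x, (g x - mercerProj Q lam ψ r g x) ^ 2 ∂Q ≤ ∫ x, g x ^ 2 ∂Q := by
  rw [h.integral_sq_sub_proj hg r]
  exact sub_le_self _ (Finset.sum_nonneg fun i _ => by positivity)

variable {U : Type*} [MeasurableSpace U] {ν : Measure U} [IsProbabilityMeasure ν]
  {gp : U → X → ℝ} {K : ℝ}

/-- The sample paths lie in the span of the eigenfunctions: their components along a countable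
dense set of functions orthogonal to it have variance zero. -/
lemma IsGPSample.ae_inMercerSpan [MeasurableSpace.CountablyGenerated X]
    (hgp : IsGPSample ν Q k gp) (hK : ∀ x, k x x ≤ K) (h : IsMercerSystem Q k lam ψ) :
    ∀ᵐ u ∂ν, InMercerSpan Q lam ψ (gp u) := by
  let W : Set (Lp ℝ 2 Q) := {F | ∀ i, lam i ≠ 0 → ∫ x, ψ i x * F x ∂Q = 0}
  have : Nonempty W := ⟨⟨0, fun i _ => by
    rw [integral_eq_zero_of_ae]
    filter_upwards [Lp.coeFn_zero ℝ 2 Q] with x hx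
    rw [hx, Pi.zero_apply, mul_zero]⟩⟩
  have : Fact ((2 : ℝ≥0∞) ≠ ∞) := ⟨ENNReal.ofNat_ne_top⟩
  have : SecondCountableTopology (Lp ℝ 2 Q) := inferInstance
  let F := TopologicalSpace.denseSeq W
  have h1 : ∀ n, ∀ᵐ u ∂ν, coef Q gp (F n : Lp ℝ 2 Q) u = 0 := by
    intro n
    have hm : Measurable (F n : Lp ℝ 2 Q) := (Lp.stronglyMeasurable (F n).1).measurable
    have hmap := hgp.map_coef hK hm (Lp.memLp (F n).1) (v := 0) (by
      rw [integral_eq_zero_of_ae, NNReal.coe_zero]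
      filter_upwards [h.complete _ (Lp.memLp (F n).1) (F n).2] with x hx
      rw [hx, mul_zero]; rfl)
    rw [gaussianReal_zero_var] at hmap
    have h2 : ∀ᵐ y ∂(ν.map (coef Q gp (F n : Lp ℝ 2 Q))), y = 0 := by
      rw [hmap, ae_dirac_iff (measurableSet_eq)]
    exact ae_of_ae_map (hgp.measurable_coef hm).aemeasurable h2
  filter_upwards [ae_all_iff.2 h1, hgp.ae_memLp] with u hu hu2
  refine ⟨hu2, fun f hf hf0 => ?_⟩
  have h3 : (fun G : W => inner ℝ (G : Lp ℝ 2 Q) (hu2.toLp _)) = fun _ => 0 := by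
    refine (TopologicalSpace.denseRange_denseSeq W).equalizer (by fun_prop) (by fun_prop) ?_
    ext n
    have h4 := inner_toLp (Lp.memLp (F n).1) hu2
    rw [Lp.toLp_coeFn] at h4
    exact h4.trans (hu n)
  have hfW : hf.toLp f ∈ W := fun i hi => by
    rw [← hf0 i hi]
    refine integral_congr_ae ?_
    filter_upwards [hf.coeFn_toLp] with x hx
    rw [hx]
  rw [← inner_toLp hf hu2]
  exact congrFun h3 ⟨_, hfW⟩

/-- Linear combinations of the coefficients along the eigenfunctions are Gaussian, with the
variance of a combination of independent `N(0, lam i)` variables. -/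
lemma IsGPSample.map_sum_coef (hgp : IsGPSample ν Q k gp) (hK : ∀ x, k x x ≤ K)
    (hk : IsBoundedKernel k) (h : IsMercerSystem Q k lam ψ) (hψ : ∀ i, Measurable (ψ i))
    {I : Finset ℕ} (hI : ∀ i ∈ I, lam i ≠ 0) (ζ : ℕ → ℝ) :
    (∀ᵐ u ∂ν, ∑ i ∈ I, ζ i * coef Q gp (ψ i) u = coef Q gp (fun x => ∑ i ∈ I, ζ i * ψ i x) u) ∧
    ν.map (fun u => ∑ i ∈ I, ζ i * coef Q gp (ψ i) u)
      = gaussianReal 0 (∑ i ∈ I, ζ i ^ 2 * lam i).toNNReal := by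
  have hf : Measurable fun x => ∑ i ∈ I, ζ i * ψ i x :=
    Finset.measurable_sum _ fun i _ => (hψ i).const_mul _
  have hf2 : MemLp (fun x => ∑ i ∈ I, ζ i * ψ i x) 2 Q :=
    memLp_finsetSum _ fun i hi => (h.memLp i (hI i hi)).const_mul _
  have h1 : ∀ᵐ u ∂ν, ∑ i ∈ I, ζ i * coef Q gp (ψ i) u
      = coef Q gp (fun x => ∑ i ∈ I, ζ i * ψ i x) u := by
    filter_upwards [hgp.ae_memLp] with u hu
    simp_rw [coef, Finset.sum_mul, mul_assoc]
    rw [integral_finsetSum]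
    · simp_rw [integral_const_mul]
    · exact fun i hi => (h.isOrthonormalSystem.integrable_mul (hI i hi) hu).const_mul _
  refine ⟨h1, ?_⟩
  rw [Measure.map_congr h1]
  refine hgp.map_coef hK hf hf2 ?_
  rw [Real.coe_toNNReal _ (Finset.sum_nonneg fun i _ => mul_nonneg (by positivity) (h.nonneg i))]
  have h2 : ∀ᵐ x ∂Q, ∫ y, k x y * ∑ i ∈ I, ζ i * ψ i y ∂Q = ∑ i ∈ I, ζ i * lam i * ψ i x := by
    have h3 : ∀ᵐ x ∂Q, ∀ i ∈ I, ∫ y, k x y * ψ i y ∂Q = lam i * ψ i x :=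
      (Finset.eventually_all I).2 fun i hi => h.eigen i (hI i hi)
    obtain ⟨B, hB⟩ := hk.bounded
    filter_upwards [h3] with x hx
    simp_rw [Finset.mul_sum, mul_left_comm (k x _)]
    rw [integral_finsetSum]
    · refine Finset.sum_congr rfl fun i hi => ?_
      rw [integral_const_mul, hx i hi, mul_assoc]
    · refine fun i hi => Integrable.const_mul ?_ _
      refine ((h.memLp i (hI i hi)).integrable one_le_two).bdd_mul (c := B) ?_
        (Eventually.of_forall fun y => hB x y)
      exact (hk.measurable.comp (measurable_const.prodMk measurable_id)).aestronglyMeasurable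
  calc _ = ∫ x, ∑ i ∈ I, ∑ j ∈ I, ζ i * (ζ j * lam j) * (ψ i x * ψ j x) ∂Q := by
        refine integral_congr_ae ?_
        filter_upwards [h2] with x hx
        rw [hx, Finset.sum_mul_sum]
        refine Finset.sum_congr rfl fun i _ => Finset.sum_congr rfl fun j _ => by ring
    _ = ∑ i ∈ I, ∑ j ∈ I, ζ i * (ζ j * lam j) * ∫ x, ψ i x * ψ j x ∂Q := by
        have hij : ∀ i ∈ I, ∀ j ∈ I,
            Integrable (fun x => ζ i * (ζ j * lam j) * (ψ i x * ψ j x)) Q := fun i hi j hj =>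
          (h.isOrthonormalSystem.integrable_mul (hI i hi) (h.memLp j (hI j hj))).const_mul _
        rw [integral_finsetSum _ fun i hi => integrable_finsetSum _ (hij i hi)]
        refine Finset.sum_congr rfl fun i hi => ?_
        rw [integral_finsetSum _ (hij i hi)]
        simp_rw [integral_const_mul]
    _ = _ := by
        refine Finset.sum_congr rfl fun i hi => ?_
        rw [Finset.sum_congr rfl fun j hj => by rw [h.orthonormal i j (hI i hi) (hI j hj)]]
        simp [hi]; ring

end Mercer

/-! ### Deviation bounds for the sample paths -/

lemma lintegral_exp_of_map_eq {U : Type*} [MeasurableSpace U] {ν : Measure U} {Y : U → ℝ}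
    (hYm : Measurable Y) {v : ℝ} (hv : 0 ≤ v) (hY : ν.map Y = gaussianReal 0 v.toNNReal) :
    ∫⁻ u, ENNReal.ofReal (Real.exp (Y u)) ∂ν = ENNReal.ofReal (Real.exp (v / 2)) := by
  have h1 : ∫⁻ y, ENNReal.ofReal (Real.exp y) ∂(ν.map Y)
      = ∫⁻ u, ENNReal.ofReal (Real.exp (Y u)) ∂ν := lintegral_map (by fun_prop) hYm
  rw [← h1, hY, ← ofReal_integral_eq_lintegral_ofReal]
  · have := congrFun (mgf_fun_id_gaussianReal (μ := 0) (v := v.toNNReal)) 1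
    simp only [mgf, one_mul] at this
    rw [this, Real.coe_toNNReal _ hv]; simp
  · simpa using integrable_exp_mul_gaussianReal (μ := 0) (v := v.toNNReal) 1
  · exact Filter.Eventually.of_forall fun x => (Real.exp_pos _).le

/-- Chernoff's bound. -/
lemma measure_le_of_lintegral_exp_le {Ω : Type*} [MeasurableSpace Ω] {μ : Measure Ω} {S : Ω → ℝ}
    (hS : Measurable S) {s B : ℝ}
    (h : ∫⁻ ω, ENNReal.ofReal (Real.exp (s * S ω)) ∂μ ≤ ENNReal.ofReal (Real.exp B)) (t : ℝ) :
    μ {ω | s * t ≤ s * S ω} ≤ ENNReal.ofReal (Real.exp (B - s * t)) := by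
  have h1 := meas_ge_le_lintegral_div (μ := μ)
    (f := fun ω => ENNReal.ofReal (Real.exp (s * S ω))) (by fun_prop)
    (ε := ENNReal.ofReal (Real.exp (s * t)))
    (ENNReal.ofReal_pos.2 (Real.exp_pos _)).ne' ENNReal.ofReal_ne_top
  refine (measure_mono fun ω hω => ?_).trans (h1.trans ?_)
  · exact ENNReal.ofReal_le_ofReal (Real.exp_le_exp.2 hω)
  · rw [Real.exp_sub, ENNReal.ofReal_div_of_pos (Real.exp_pos _)]
    gcongr

/-- Chernoff's bound for a variable dominated by a monotone limit. -/
lemma measure_lt_of_lintegral_exp_le {Ω : Type*} [MeasurableSpace Ω] {μ : Measure Ω} {S : ℕ → Ω → ℝ}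
    {R : Ω → ℝ≥0∞} (hS : ∀ M, Measurable (S M)) (hmono : ∀ ω, Monotone fun M => S M ω)
    {s B : ℝ} (hs : 0 ≤ s) (hR : ∀ᵐ ω ∂μ, R ω ≤ ⨆ M, ENNReal.ofReal (S M ω))
    (h : ∀ M, ∫⁻ ω, ENNReal.ofReal (Real.exp (s * S M ω)) ∂μ ≤ ENNReal.ofReal (Real.exp B))
    (t : ℝ) :
    μ {ω | ENNReal.ofReal t < R ω} ≤ ENNReal.ofReal (Real.exp (B - s * t)) := by
  have h1 : μ {ω | ENNReal.ofReal t < R ω} ≤ μ (⋃ M, {ω | t ≤ S M ω}) := by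
    refine measure_mono_ae ?_
    filter_upwards [hR] with ω hω hlt
    obtain ⟨M, hM⟩ := lt_iSup_iff.1 (lt_of_lt_of_le hlt hω)
    exact Set.mem_iUnion.2 ⟨M, ((ENNReal.ofReal_lt_ofReal_iff'.1 hM).1).le⟩
  refine h1.trans ?_
  rw [Monotone.measure_iUnion]
  · refine iSup_le fun M => (measure_mono fun ω hω => ?_).trans
      (measure_le_of_lintegral_exp_le (hS M) (h M) t)
    exact mul_le_mul_of_nonneg_left hω hs
  · intro M M' hM ω hω
    exact le_trans hω (hmono ω hM)

/-- A sum over a subtype, as a sum over the ambient finite set of the extension by zero. -/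
lemma sum_coe_eq_sum_dite (I : Finset ℕ) (ζ : I → ℝ) (F : ℝ → ℕ → ℝ) :
    ∑ i : I, F (ζ i) i = ∑ i ∈ I, F (if h : i ∈ I then ζ ⟨i, h⟩ else 0) i := by
  rw [← Finset.sum_coe_sort I]
  refine Finset.sum_congr rfl fun i _ => ?_
  rw [dif_pos i.2]

lemma IsOrthonormalSystem.integral_mul_sum {X : Type*} [MeasurableSpace X] {Q : Measure X}
    [IsProbabilityMeasure Q] {lam : ℕ → ℝ} {ψ : ℕ → X → ℝ}
    (h : IsOrthonormalSystem Q lam ψ) {i : ℕ} (hi : lam i ≠ 0) {ι : Type*} {s : Finset ι}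
    (c : ι → ℝ) {g : ι → X → ℝ} (hg : ∀ j ∈ s, MemLp (g j) 2 Q) :
    ∫ x, ψ i x * ∑ j ∈ s, c j * g j x ∂Q = ∑ j ∈ s, c j * ∫ x, ψ i x * g j x ∂Q := by
  simp_rw [Finset.mul_sum, mul_left_comm (ψ i _)]
  rw [integral_finsetSum _ fun j hj => (h.integrable_mul hi (hg j hj)).const_mul _]
  simp_rw [integral_const_mul]

lemma IsOrthonormalSystem.mercerProj_sum {X : Type*} [MeasurableSpace X] {Q : Measure X}
    [IsProbabilityMeasure Q] {lam : ℕ → ℝ} {ψ : ℕ → X → ℝ}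
    (h : IsOrthonormalSystem Q lam ψ) (r : ℕ) {ι : Type*} {s : Finset ι} (c : ι → ℝ)
    {g : ι → X → ℝ} (hg : ∀ j ∈ s, MemLp (g j) 2 Q) (x : X) :
    mercerProj Q lam ψ r (fun x => ∑ j ∈ s, c j * g j x) x
      = ∑ j ∈ s, c j * mercerProj Q lam ψ r (g j) x := by
  simp only [mercerProj]
  rw [Finset.sum_congr rfl fun i hi => by
    rw [h.integral_mul_sum (Finset.mem_filter.1 hi).2 c hg, Finset.sum_mul], Finset.sum_comm]
  refine Finset.sum_congr rfl fun j _ => ?_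
  rw [Finset.mul_sum]
  exact Finset.sum_congr rfl fun i _ => by ring

section Concentration

variable {X : Type*} [MeasurableSpace X] {Q : Measure X} [IsProbabilityMeasure Q]
  {k : X → X → ℝ} {lam : ℕ → ℝ} {ψ : ℕ → X → ℝ}
  {U : Type*} [MeasurableSpace U] {ν : Measure U} [IsProbabilityMeasure ν]
  {gp : U → X → ℝ} {K : ℝ}

lemma IsGPSample.lintegral_exp_sum_coef (hgp : IsGPSample ν Q k gp) (hK : ∀ x, k x x ≤ K)
    (hk : IsBoundedKernel k) (h : IsMercerSystem Q k lam ψ) (hψ : ∀ i, Measurable (ψ i))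
    {I : Finset ℕ} (hI : ∀ i ∈ I, lam i ≠ 0) (ζ : ℕ → ℝ) :
    ∫⁻ u, ENNReal.ofReal (Real.exp (∑ i ∈ I, ζ i * coef Q gp (ψ i) u)) ∂ν
      = ENNReal.ofReal (Real.exp (∑ i ∈ I, ζ i ^ 2 * lam i / 2)) := by
  rw [lintegral_exp_of_map_eq (Finset.measurable_sum _ fun i _ =>
      (hgp.measurable_coef (hψ i)).const_mul _)
    (Finset.sum_nonneg fun i _ => mul_nonneg (by positivity) (h.nonneg i))
    (hgp.map_sum_coef hK hk h hψ hI ζ).2, Finset.sum_div]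

/-- For a unit vector `θ`, the `i`-th coefficient of `∑ j, θ j * gp (u j)` has variance `lam i`, as
that of a single path. -/
lemma IsGPSample.lintegral_exp_sum_sq_coef (hgp : IsGPSample ν Q k gp) (hK : ∀ x, k x x ≤ K)
    (hk : IsBoundedKernel k) (h : IsMercerSystem Q k lam ψ) (hψ : ∀ i, Measurable (ψ i))
    {I : Finset ℕ} (hI : ∀ i ∈ I, lam i ≠ 0) {m : ℕ} {θ : Fin m → ℝ} (hθ : ∑ j, θ j ^ 2 = 1)
    {s : ℝ} (hs : 0 ≤ s) (hsl : ∀ i ∈ I, s * lam i ≤ 1 / 4) :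
    ∫⁻ ω, ENNReal.ofReal (Real.exp (s * ∑ i ∈ I, (∑ j, θ j * coef Q gp (ψ i) (ω j)) ^ 2))
        ∂(Measure.pi fun _ : Fin m => ν)
      ≤ ENNReal.ofReal (Real.exp (2 * s * ∑ i ∈ I, lam i)) := by
  have hc := fun i => hgp.measurable_coef (hψ i)
  have key := lintegral_exp_sum_sq_le (μ := Measure.pi fun _ : Fin m => ν) (ι := I)
    (Y := fun i ω => ∑ j, θ j * coef Q gp (ψ i) (ω j)) (l := fun i => lam i) (s := s)
    (fun i => Finset.measurable_sum _ fun j _ =>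
      ((hc i).comp (measurable_pi_apply j)).const_mul _) hs (fun i => h.nonneg i)
    (fun i => hsl i i.2) ?_
  · simp_rw [Finset.sum_coe_sort I (fun i => lam i)] at key
    refine le_of_eq_of_le (lintegral_congr fun ω => ?_) key
    rw [Finset.sum_coe_sort I (fun i => (∑ j, θ j * coef Q gp (ψ i) (ω j)) ^ 2)]
  · intro ζ
    set z : ℕ → ℝ := fun i => if h : i ∈ I then ζ ⟨i, h⟩ else 0
    have h1 : ∀ ω : Fin m → U, ENNReal.ofReal (Real.exp
        (∑ i : I, ζ i * ∑ j, θ j * coef Q gp (ψ i) (ω j)))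
        = ∏ j, ENNReal.ofReal (Real.exp (∑ i ∈ I, (θ j * z i) * coef Q gp (ψ i) (ω j))) := by
      intro ω
      rw [← exp_sum_ofReal, Finset.sum_comm,
        sum_coe_eq_sum_dite I ζ (fun a i => a * ∑ j, θ j * coef Q gp (ψ i) (ω j))]
      congr 2
      refine Finset.sum_congr rfl fun i _ => ?_
      rw [Finset.mul_sum]
      exact Finset.sum_congr rfl fun j _ => by simp only [z]; ring
    simp_rw [h1]
    rw [lintegral_pi_prod (fun _ : Fin m => ν)
      (f := fun j u => ENNReal.ofReal (Real.exp (∑ i ∈ I, (θ j * z i) * coef Q gp (ψ i) u)))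
      (fun j => by
        have := Finset.measurable_sum I fun i _ => (hc i).const_mul (θ j * z i)
        exact (Real.measurable_exp.comp this).ennreal_ofReal)]
    simp_rw [hgp.lintegral_exp_sum_coef hK hk h hψ hI]
    rw [← exp_sum_ofReal, Finset.sum_comm,
      sum_coe_eq_sum_dite I ζ (fun a i => a ^ 2 * lam i / 2)]
    refine ENNReal.ofReal_le_ofReal (Real.exp_le_exp.2 (le_of_eq ?_))
    refine Finset.sum_congr rfl fun i _ => ?_
    calc _ = (∑ j, θ j ^ 2) * (z i ^ 2 * lam i / 2) := by
          rw [Finset.sum_mul]; exact Finset.sum_congr rfl fun j _ => by ring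
      _ = _ := by rw [hθ, one_mul]

lemma IsGPSample.lintegral_exp_sum_sum_sq_coef (hgp : IsGPSample ν Q k gp) (hK : ∀ x, k x x ≤ K)
    (hk : IsBoundedKernel k) (h : IsMercerSystem Q k lam ψ) (hψ : ∀ i, Measurable (ψ i))
    {I : Finset ℕ} (hI : ∀ i ∈ I, lam i ≠ 0) (m : ℕ)
    {s : ℝ} (hs : 0 ≤ s) (hsl : ∀ i ∈ I, s * lam i ≤ 1 / 4) :
    ∫⁻ ω, ENNReal.ofReal (Real.exp (s * ∑ j, ∑ i ∈ I, coef Q gp (ψ i) (ω j) ^ 2))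
        ∂(Measure.pi fun _ : Fin m => ν)
      ≤ ENNReal.ofReal (Real.exp (m * (2 * s * ∑ i ∈ I, lam i))) := by
  have hc := fun i => hgp.measurable_coef (hψ i)
  have h1 : ∫⁻ u, ENNReal.ofReal (Real.exp (s * ∑ i ∈ I, coef Q gp (ψ i) u ^ 2)) ∂ν
      ≤ ENNReal.ofReal (Real.exp (2 * s * ∑ i ∈ I, lam i)) := by
    have h2 := hgp.lintegral_exp_sum_sq_coef hK hk h hψ hI (m := 1) (θ := fun _ => 1) (by simp)
      hs hsl
    simp only [Finset.univ_unique, Finset.sum_singleton, one_mul] at h2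
    rwa [(measurePreserving_eval (fun _ : Fin 1 => ν) default).lintegral_comp
      (f := fun u => ENNReal.ofReal (Real.exp (s * ∑ i ∈ I, coef Q gp (ψ i) u ^ 2)))
      (by fun_prop)] at h2
  simp_rw [Finset.mul_sum Finset.univ, exp_sum_ofReal]
  rw [lintegral_pi_prod (fun _ : Fin m => ν)
    (f := fun _ u => ENNReal.ofReal (Real.exp (s * ∑ i ∈ I, coef Q gp (ψ i) u ^ 2)))
    (fun j => by fun_prop)]
  calc _ ≤ ∏ _j : Fin m, ENNReal.ofReal (Real.exp (2 * s * ∑ i ∈ I, lam i)) :=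
        Finset.prod_le_prod' fun _ _ => h1
    _ = _ := by rw [← exp_sum_ofReal]; simp

/-- Deviation bound for the residual of a fixed unit combination of the sample paths. -/
lemma IsGPSample.measure_residual_comb (hX : MeasurableSpace.CountablyGenerated X)
    (hgp : IsGPSample ν Q k gp) (hK : ∀ x, k x x ≤ K)
    (hk : IsBoundedKernel k) (h : IsMercerSystem Q k lam ψ) (hψ : ∀ i, Measurable (ψ i))
    {m : ℕ} {θ : Fin m → ℝ} (hθ : ∑ j, θ j ^ 2 = 1) {r : ℕ}
    {s τ : ℝ} (hs : 0 ≤ s) (hsl : ∀ i, r ≤ i → s * lam i ≤ 1 / 4)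
    (hτ : ∀ M, ∑ i ∈ Finset.range M with r ≤ i ∧ lam i ≠ 0, lam i ≤ τ) (t : ℝ) :
    (Measure.pi fun _ : Fin m => ν) {ω | ENNReal.ofReal t < ∫⁻ x, ENNReal.ofReal
        ((∑ j, θ j * (gp (ω j) x - mercerProj Q lam ψ r (gp (ω j)) x)) ^ 2) ∂Q}
      ≤ ENNReal.ofReal (Real.exp (2 * s * τ - s * t)) := by
  have hc := fun i => hgp.measurable_coef (hψ i)
  refine measure_lt_of_lintegral_exp_le (S := fun M ω =>
    ∑ i ∈ Finset.range M with r ≤ i ∧ lam i ≠ 0, (∑ j, θ j * coef Q gp (ψ i) (ω j)) ^ 2)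
    (fun M => by fun_prop) (fun ω => ?_) hs ?_ (fun M => ?_) t
  · intro M M' hM
    refine Finset.sum_le_sum_of_subset_of_nonneg ?_ fun i _ _ => by positivity
    exact Finset.filter_subset_filter _ (Finset.range_mono hM)
  · have hall : ∀ᵐ ω ∂(Measure.pi fun _ : Fin m => ν), ∀ j, InMercerSpan Q lam ψ (gp (ω j)) :=
      ae_all_iff.2 fun j =>
        (measurePreserving_eval (fun _ : Fin m => ν) j).quasiMeasurePreserving.ae
          (hgp.ae_inMercerSpan hK h)
    filter_upwards [hall] with ω hω
    have h1 := h.lintegral_sq_sub_proj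
      (InMercerSpan.sum (s := Finset.univ) θ fun j _ => hω j) r
    refine le_of_eq (Eq.trans (lintegral_congr fun x => ?_) (h1.trans (iSup_congr fun M => ?_)))
    · congr 2
      simp_rw [mul_sub, Finset.sum_sub_distrib]
      rw [h.isOrthonormalSystem.mercerProj_sum r θ fun j _ => (hω j).memLp]
    · congr 1
      refine Finset.sum_congr rfl fun i hi => ?_
      rw [h.isOrthonormalSystem.integral_mul_sum (Finset.mem_filter.1 hi).2.2 θ
        fun j _ => (hω j).memLp]
      rfl
  · refine (hgp.lintegral_exp_sum_sq_coef hK hk h hψ (fun i hi => (Finset.mem_filter.1 hi).2.2) hθ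
      hs fun i hi => hsl i (Finset.mem_filter.1 hi).2.1).trans ?_
    refine ENNReal.ofReal_le_ofReal (Real.exp_le_exp.2 ?_)
    exact mul_le_mul_of_nonneg_left (hτ M) (by positivity)

/-- Deviation bound for the total residual of the sample paths. -/
lemma IsGPSample.measure_residual_sum (hX : MeasurableSpace.CountablyGenerated X)
    (hgp : IsGPSample ν Q k gp) (hK : ∀ x, k x x ≤ K)
    (hk : IsBoundedKernel k) (h : IsMercerSystem Q k lam ψ) (hψ : ∀ i, Measurable (ψ i))
    (m : ℕ) {r : ℕ} {s τ : ℝ} (hs : 0 ≤ s) (hsl : ∀ i, r ≤ i → s * lam i ≤ 1 / 4)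
    (hτ : ∀ M, ∑ i ∈ Finset.range M with r ≤ i ∧ lam i ≠ 0, lam i ≤ τ) (t : ℝ) :
    (Measure.pi fun _ : Fin m => ν) {ω | ENNReal.ofReal t < ∑ j, ∫⁻ x, ENNReal.ofReal
        ((gp (ω j) x - mercerProj Q lam ψ r (gp (ω j)) x) ^ 2) ∂Q}
      ≤ ENNReal.ofReal (Real.exp (m * (2 * s * τ) - s * t)) := by
  have hc := fun i => hgp.measurable_coef (hψ i)
  have hmono : ∀ u, Monotone fun M => ∑ i ∈ Finset.range M with r ≤ i ∧ lam i ≠ 0,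
      coef Q gp (ψ i) u ^ 2 := fun u M M' hM => by
    refine Finset.sum_le_sum_of_subset_of_nonneg ?_ fun i _ _ => by positivity
    exact Finset.filter_subset_filter _ (Finset.range_mono hM)
  refine measure_lt_of_lintegral_exp_le (S := fun M ω =>
    ∑ j, ∑ i ∈ Finset.range M with r ≤ i ∧ lam i ≠ 0, coef Q gp (ψ i) (ω j) ^ 2)
    (fun M => by fun_prop) (fun ω M M' hM => Finset.sum_le_sum fun j _ => hmono (ω j) hM)
    hs ?_ (fun M => ?_) t
  · have hall : ∀ᵐ ω ∂(Measure.pi fun _ : Fin m => ν), ∀ j, InMercerSpan Q lam ψ (gp (ω j)) :=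
      ae_all_iff.2 fun j =>
        (measurePreserving_eval (fun _ : Fin m => ν) j).quasiMeasurePreserving.ae
          (hgp.ae_inMercerSpan hK h)
    filter_upwards [hall] with ω hω
    simp_rw [fun j => h.lintegral_sq_sub_proj (hω j) r]
    rw [ENNReal.finsetSum_iSup_of_monotone (f := fun j M => ENNReal.ofReal
      (∑ i ∈ Finset.range M with r ≤ i ∧ lam i ≠ 0, (∫ x, ψ i x * gp (ω j) x ∂Q) ^ 2))
      fun j M M' hM => ENNReal.ofReal_le_ofReal (hmono (ω j) hM)]
    refine iSup_mono fun M => ?_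
    rw [ENNReal.ofReal_sum_of_nonneg fun j _ => Finset.sum_nonneg fun i _ => by positivity]
    rfl
  · refine (hgp.lintegral_exp_sum_sum_sq_coef hK hk h hψ (fun i hi => (Finset.mem_filter.1 hi).2.2)
      m hs fun i hi => hsl i (Finset.mem_filter.1 hi).2.1).trans ?_
    refine ENNReal.ofReal_le_ofReal (Real.exp_le_exp.2 ?_)
    gcongr
    exact hτ M

/-- The unit combinations of the whitened coefficients of a path are standard Gaussian variables;
the sum of their squares over the paths has a chi-squared law with `m` degrees of freedom. -/
lemma IsGPSample.lintegral_exp_white (hgp : IsGPSample ν Q k gp) (hK : ∀ x, k x x ≤ K)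
    (hk : IsBoundedKernel k) (h : IsMercerSystem Q k lam ψ) (hψ : ∀ i, Measurable (ψ i))
    {I : Finset ℕ} (hI : ∀ i ∈ I, lam i ≠ 0) {v : I → ℝ} (hv : ∑ i, v i ^ 2 = 1)
    (m : ℕ) {p : ℝ} (hp : p < 1 / 2) :
    ∫⁻ ω, ENNReal.ofReal (Real.exp
          (p * ∑ j, (∑ i : I, v i * (coef Q gp (ψ i) (ω j) / √(lam i))) ^ 2))
        ∂(Measure.pi fun _ : Fin m => ν)
      = ENNReal.ofReal ((√(1 - 2 * p))⁻¹ ^ m) := by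
  have hc := fun i => hgp.measurable_coef (hψ i)
  set z : ℕ → ℝ := fun i => if h : i ∈ I then v ⟨i, h⟩ else 0 with hz
  set Y : U → ℝ := fun u => ∑ i ∈ I, (z i / √(lam i)) * coef Q gp (ψ i) u with hY
  have hYm : Measurable Y := Finset.measurable_sum _ fun i _ => (hc i).const_mul _
  have h1 : ∀ u, ∑ i : I, v i * (coef Q gp (ψ i) u / √(lam i)) = Y u := fun u => by
    rw [sum_coe_eq_sum_dite I v (fun a i => a * (coef Q gp (ψ i) u / √(lam i)))]
    exact Finset.sum_congr rfl fun i _ => by simp only [hz]; ring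
  have h2 : ν.map Y = gaussianReal 0 1 := by
    rw [(hgp.map_sum_coef hK hk h hψ hI _).2]
    congr 1
    rw [← Real.toNNReal_one, ← hv, sum_coe_eq_sum_dite I v (fun a i => a ^ 2)]
    congr 1
    refine Finset.sum_congr rfl fun i hi => ?_
    rw [div_pow, Real.sq_sqrt (h.nonneg i), div_mul_cancel₀ _ (hI i hi)]
  have h3 : ∫⁻ u, ENNReal.ofReal (Real.exp (p * Y u ^ 2)) ∂ν
      = ENNReal.ofReal ((√(1 - 2 * p))⁻¹) := by
    rw [← lintegral_exp_sq_gaussianReal hp, ← h2, lintegral_map (by fun_prop) hYm]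
  simp_rw [h1, Finset.mul_sum, exp_sum_ofReal]
  rw [lintegral_pi_prod (fun _ : Fin m => ν)
    (f := fun _ u => ENNReal.ofReal (Real.exp (p * Y u ^ 2))) (fun j => by fun_prop)]
  simp_rw [h3]
  rw [Finset.prod_const, Finset.card_univ, Fintype.card_fin, ENNReal.ofReal_pow (by positivity)]

end Concentration

/-! ### Approximation by the learned space -/

section Approximation

variable {Z : Type*} [MeasurableSpace Z] {P : Measure Z} [IsProbabilityMeasure P]
  {lam : ℕ → ℝ} {φ : ℕ → Z → ℝ} {m : ℕ}

lemma eLpNorm_two_eq {g : Z → ℝ} (hg : MemLp g 2 P) :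
    eLpNorm g 2 P = ENNReal.ofReal ‖hg.toLp g‖ := by
  rw [Lp.norm_toLp, ENNReal.ofReal_toReal hg.2.ne]

lemma lintegral_sq_le_iff {g : Z → ℝ} (hg : MemLp g 2 P) {a : ℝ} (ha : 0 ≤ a) :
    ∫⁻ x, ENNReal.ofReal (g x ^ 2) ∂P ≤ ENNReal.ofReal (a ^ 2)
      ↔ eLpNorm g 2 P ≤ ENNReal.ofReal a := by
  rw [lintegral_ofReal_sq_eq hg, eLpNorm_two_eq hg, ENNReal.ofReal_le_ofReal_iff (by positivity),
    ENNReal.ofReal_le_ofReal_iff ha, sq_le_sq₀ (norm_nonneg _) ha]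

lemma lintegral_sq_sum_le {d : Fin m → Z → ℝ} (hd : ∀ j, MemLp (d j) 2 P)
    (θ : EuclideanSpace ℝ (Fin m)) {a : ℝ}
    (h : ∑ j, ∫⁻ x, ENNReal.ofReal (d j x ^ 2) ∂P ≤ ENNReal.ofReal a) :
    ∫⁻ x, ENNReal.ofReal ((∑ j, θ j * d j x) ^ 2) ∂P ≤ ENNReal.ofReal (‖θ‖ ^ 2 * a) := by
  calc _ ≤ ∫⁻ x, ENNReal.ofReal (‖θ‖ ^ 2) * ∑ j, ENNReal.ofReal (d j x ^ 2) ∂P := by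
        refine lintegral_mono fun x => ?_
        rw [← ENNReal.ofReal_sum_of_nonneg fun j _ => by positivity,
          ← ENNReal.ofReal_mul (by positivity), EuclideanSpace.real_norm_sq_eq]
        exact ENNReal.ofReal_le_ofReal (Finset.sum_mul_sq_le_sq_mul_sq _ _ _)
    _ = ENNReal.ofReal (‖θ‖ ^ 2) * ∑ j, ∫⁻ x, ENNReal.ofReal (d j x ^ 2) ∂P := by
        rw [lintegral_const_mul' _ _ ENNReal.ofReal_ne_top, lintegral_finsetSum' _ fun j _ =>
          ((hd j).1.aemeasurable.pow_const 2).ennreal_ofReal]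
    _ ≤ _ := by
        rw [ENNReal.ofReal_mul (by positivity)]
        gcongr

/-- If all combinations over a net of unit vectors are small, so are all combinations. -/
lemma eLpNorm_sum_le_of_net {d : Fin m → Z → ℝ} (hd : ∀ j, MemLp (d j) 2 P)
    {N : Finset (EuclideanSpace ℝ (Fin m))} {ε : ℝ} (hε : ε ≤ 1 / 2)
    (hN : ∀ x : EuclideanSpace ℝ (Fin m), ‖x‖ = 1 → ∃ y ∈ N, ‖x - y‖ ≤ ε) {a : ℝ} (ha : 0 ≤ a)
    (h : ∀ θ ∈ N, ∫⁻ x, ENNReal.ofReal ((∑ j, θ j * d j x) ^ 2) ∂P ≤ ENNReal.ofReal (a ^ 2))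
    (θ : EuclideanSpace ℝ (Fin m)) :
    eLpNorm (fun x => ∑ j, θ j * d j x) 2 P ≤ ENNReal.ofReal (2 * a * ‖θ‖) := by
  have hmem : ∀ θ : EuclideanSpace ℝ (Fin m), MemLp (fun x => ∑ j, θ j * d j x) 2 P :=
    fun θ => memLp_finsetSum _ fun j _ => (hd j).const_mul _
  let T : EuclideanSpace ℝ (Fin m) →ₗ[ℝ] Lp ℝ 2 P :=
    { toFun := fun θ => (hmem θ).toLp _
      map_add' := fun θ θ' => by
        rw [← MemLp.toLp_add]
        congr 1; ext x; simp [add_mul, Finset.sum_add_distrib]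
      map_smul' := fun c θ => by
        rw [RingHom.id_apply, ← MemLp.toLp_const_smul]
        congr 1; ext x; simp [Finset.mul_sum, mul_assoc] }
  have h1 := norm_le_of_sphere_net T (ε := ε) (τ := a) (by linarith) ha hN (fun y hy => by
    have := (lintegral_sq_le_iff (hmem y) ha).1 (h y hy)
    rwa [eLpNorm_two_eq (hmem y), ENNReal.ofReal_le_ofReal_iff ha] at this) θ
  rw [eLpNorm_two_eq (hmem θ)]
  refine ENNReal.ofReal_le_ofReal (h1.trans ?_)
  refine mul_le_mul_of_nonneg_right ?_ (norm_nonneg _)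
  rw [div_le_iff₀ (by linarith)]
  nlinarith

/-- If the matrix of the whitened coefficients of the sample paths is well-conditioned, the
residuals of the sample paths are small in operator norm and the estimates are close to the sample
paths, then every `g` has a good approximation in the learned space. -/
lemma exists_mem_learnedBall (h : IsOrthonormalSystem P lam φ) (hlam : ∀ i, 0 ≤ lam i)
    (hm : 0 < m) {r : ℕ} {G Ghat : Fin m → Z → ℝ} (hG : ∀ j, MemLp (G j) 2 P)
    (hGhat : ∀ j, MemLp (Ghat j) 2 P)
    {I : Finset ℕ} (hI : I = {i ∈ Finset.range r | lam i ≠ 0})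
    {N : Finset (EuclideanSpace ℝ I)}
    (hN : ∀ x : EuclideanSpace ℝ I, ‖x‖ = 1 → ∃ y ∈ N, ‖x - y‖ ≤ 1 / 10000)
    (hA : ∀ v ∈ N, (m : ℝ) / 250000
        ≤ ∑ j, (∑ i : I, v i * ((∫ z, φ i z * G j z ∂P) / √(lam i))) ^ 2 ∧
      ∑ j, (∑ i : I, v i * ((∫ z, φ i z * G j z ∂P) / √(lam i))) ^ 2 ≤ 36 * m)
    {N' : Finset (EuclideanSpace ℝ (Fin m))}
    (hN' : ∀ x : EuclideanSpace ℝ (Fin m), ‖x‖ = 1 → ∃ y ∈ N', ‖x - y‖ ≤ 1 / 10000)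
    {ρ τ : ℝ} (hρ : 0 ≤ ρ) (hτ : 0 ≤ τ)
    (hres : ∀ θ ∈ N', ∫⁻ z, ENNReal.ofReal ((∑ j, θ j * (G j z - mercerProj P lam φ r (G j) z)) ^ 2)
      ∂P ≤ ENNReal.ofReal (m * ρ ^ 2))
    (herr : ∑ j, ∫⁻ z, ENNReal.ofReal ((Ghat j z - G j z) ^ 2) ∂P ≤ ENNReal.ofReal (m * τ ^ 2))
    {g : Z → ℝ} (hg : MemLp g 2 P) :
    ∃ f ∈ learnedBall Ghat (1000 * mercerProjNorm P lam φ r g),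
      eLpNorm (f - g) 2 P ≤ ENNReal.ofReal (1000 * mercerProjNorm P lam φ r g * (τ + 2 * ρ))
        + eLpNorm (g - mercerProj P lam φ r g) 2 P := by
  have hm' : (0 : ℝ) < m := by exact_mod_cast hm
  have hsm : 0 < √(m : ℝ) := Real.sqrt_pos.2 hm'
  have hsm2 : √(m : ℝ) ^ 2 = m := Real.sq_sqrt hm'.le
  have hI0 : ∀ i : I, lam i ≠ 0 := fun i =>
    (Finset.mem_filter.1 (hI.le i.2)).2
  -- the transposed matrix of the whitened coefficients, as a linear map
  set M : Matrix (Fin m) I ℝ := Matrix.of fun j i => (∫ z, φ i z * G j z ∂P) / √(lam i) with hM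
  set A : EuclideanSpace ℝ I →ₗ[ℝ] EuclideanSpace ℝ (Fin m) := Matrix.toEuclideanLin M with hAdef
  have hAapp : ∀ v j, A v j = ∑ i : I, v i * ((∫ z, φ i z * G j z ∂P) / √(lam i)) := fun v j => by
    rw [hAdef, Matrix.toLpLin_apply]
    simp [Matrix.mulVec, dotProduct, hM, mul_comm]
  have hAsq : ∀ v, ‖A v‖ ^ 2
      = ∑ j, (∑ i : I, v i * ((∫ z, φ i z * G j z ∂P) / √(lam i))) ^ 2 := fun v => by
    rw [EuclideanSpace.real_norm_sq_eq]
    simp_rw [hAapp]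
  have hup : ∀ v, ‖A v‖ ≤ 7 * √m * ‖v‖ := fun v => by
    have h1 := norm_le_of_sphere_net A (ε := 1 / 10000) (τ := 6 * √m) (by norm_num)
      (by positivity) hN (fun y hy => by
        refine (sq_le_sq₀ (norm_nonneg _) (by positivity)).1 ?_
        rw [hAsq, mul_pow, hsm2]; linarith [(hA y hy).2]) v
    refine h1.trans (mul_le_mul_of_nonneg_right ?_ (norm_nonneg _))
    rw [div_le_iff₀ (by norm_num)]; nlinarith
  have hlow : ∀ v, √m / 1000 * ‖v‖ ≤ ‖A v‖ := fun v => by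
    have h1 := le_norm_of_sphere_net A (ε := 1 / 10000) (τ := √m / 500) (M := 7 * √m)
      (by positivity) hN (fun y hy => by
        refine (sq_le_sq₀ (by positivity) (norm_nonneg _)).1 ?_
        rw [hAsq, div_pow, hsm2]; linarith [(hA y hy).1]) hup v
    refine (mul_le_mul_of_nonneg_right ?_ (norm_nonneg _)).trans h1
    linarith
  set v : EuclideanSpace ℝ I := WithLp.toLp 2 fun i => (∫ z, φ i z * g z ∂P) / √(lam i) with hv
  have hvnorm : ‖v‖ = mercerProjNorm P lam φ r g := by
    rw [EuclideanSpace.norm_eq, mercerProjNorm]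
    congr 1
    rw [← hI, ← Finset.sum_coe_sort I]
    refine Finset.sum_congr rfl fun i _ => ?_
    rw [hv, Real.norm_eq_abs, sq_abs]
    show ((∫ z, φ i z * g z ∂P) / √(lam i)) ^ 2 = _
    rw [div_pow, Real.sq_sqrt (hlam i), div_eq_inv_mul]
  obtain ⟨θ, hθ, hθn⟩ := exists_adjoint_eq A (by positivity) hlow v
  have hθ' : √m * ‖θ‖ ≤ 1000 * mercerProjNorm P lam φ r g := by rw [← hvnorm]; linarith
  have hθnorm : ‖θ‖ ≤ 1000 * mercerProjNorm P lam φ r g / √m := by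
    rw [le_div_iff₀ hsm]; linarith
  have hcoef : ∀ i : I, ∑ j, θ j * ∫ z, φ i z * G j z ∂P = ∫ z, φ i z * g z ∂P := fun i => by
    have h1 : (LinearMap.adjoint A θ) i = (∫ z, φ i z * g z ∂P) / √(lam i) := by rw [hθ]
    rw [hAdef, ← Matrix.toEuclideanLin_conjTranspose_eq_adjoint, Matrix.toLpLin_apply] at h1
    have hs : √(lam i) ≠ 0 := (Real.sqrt_pos.2 ((hlam i).lt_of_ne (hI0 i).symm)).ne'
    simp only [Matrix.mulVec, dotProduct, hM, Matrix.conjTranspose_apply, Matrix.of_apply,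
      star_trivial] at h1
    rw [eq_div_iff hs, Finset.sum_mul] at h1
    rw [← h1]
    refine Finset.sum_congr rfl fun j _ => ?_
    field_simp
  have hproj : ∀ z, ∑ j, θ j * mercerProj P lam φ r (G j) z = mercerProj P lam φ r g z := by
    intro z
    simp only [mercerProj, Finset.mul_sum]
    rw [Finset.sum_comm]
    refine Finset.sum_congr rfl fun i hi => ?_
    rw [← hcoef ⟨i, hI ▸ hi⟩, Finset.sum_mul]
    exact Finset.sum_congr rfl fun j _ => by ring
  refine ⟨fun z => ∑ j, θ j * Ghat j z, ⟨θ, hθ', rfl⟩, ?_⟩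
  have hd1 : ∀ j, MemLp (fun z => Ghat j z - G j z) 2 P := fun j => (hGhat j).sub (hG j)
  have hd2 : ∀ j, MemLp (fun z => G j z - mercerProj P lam φ r (G j) z) 2 P :=
    fun j => (hG j).sub (h.memLp_proj r (G j))
  have hs1 : MemLp (fun z => ∑ j, θ j * (Ghat j z - G j z)) 2 P :=
    memLp_finsetSum _ fun j _ => (hd1 j).const_mul _
  have hs2 : MemLp (fun z => ∑ j, θ j * (G j z - mercerProj P lam φ r (G j) z)) 2 P :=
    memLp_finsetSum _ fun j _ => (hd2 j).const_mul _
  have hdecomp : (fun z => ∑ j, θ j * Ghat j z) - g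
      = ((fun z => ∑ j, θ j * (Ghat j z - G j z))
        + fun z => ∑ j, θ j * (G j z - mercerProj P lam φ r (G j) z))
        - (g - mercerProj P lam φ r g) := by
    ext z
    simp only [Pi.sub_apply, Pi.add_apply, mul_sub, Finset.sum_sub_distrib, hproj]
    ring
  have hb1 : eLpNorm (fun z => ∑ j, θ j * (Ghat j z - G j z)) 2 P
      ≤ ENNReal.ofReal (1000 * mercerProjNorm P lam φ r g * τ) := by
    have h1 := lintegral_sq_sum_le hd1 θ herr
    have h2 : ‖θ‖ ^ 2 * (m * τ ^ 2) = (√m * ‖θ‖ * τ) ^ 2 := by rw [mul_pow, mul_pow, hsm2]; ring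
    rw [h2, lintegral_sq_le_iff hs1 (by positivity)] at h1
    exact h1.trans (ENNReal.ofReal_le_ofReal (mul_le_mul_of_nonneg_right hθ' hτ))
  have hb2 : eLpNorm (fun z => ∑ j, θ j * (G j z - mercerProj P lam φ r (G j) z)) 2 P
      ≤ ENNReal.ofReal (1000 * mercerProjNorm P lam φ r g * (2 * ρ)) := by
    have h1 := eLpNorm_sum_le_of_net hd2 (by norm_num) hN' (a := √m * ρ) (by positivity)
      (fun θ hθ => by rw [mul_pow, hsm2]; exact hres θ hθ) θ
    refine h1.trans (ENNReal.ofReal_le_ofReal ?_)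
    have := mul_le_mul_of_nonneg_right hθ' hρ
    linarith
  have hnn : 0 ≤ mercerProjNorm P lam φ r g := Real.sqrt_nonneg _
  rw [hdecomp]
  refine (eLpNorm_sub_le (hs1.add hs2).1 (hg.sub (h.memLp_proj r g)).1 one_le_two).trans ?_
  gcongr
  refine (eLpNorm_add_le hs1.1 hs2.1 one_le_two).trans ?_
  rw [mul_add, ENNReal.ofReal_add (by positivity) (by positivity)]
  exact add_le_add hb1 hb2

end Approximation

/-! ### Local Rademacher complexity of the learned space -/

section Rademacher

variable {Z : Type*} [MeasurableSpace Z] {P : Measure Z} [IsProbabilityMeasure P]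
  {lam : ℕ → ℝ} {φ : ℕ → Z → ℝ} {m : ℕ}

/-- Orthogonality of the uniform signs. -/
lemma sum_signs_sq : ∀ (n : ℕ) (a : Fin n → ℝ),
    ∑ ε : Fin n → Bool, (∑ i, (if ε i then 1 else -1) * a i) ^ 2 = 2 ^ n * ∑ i, a i ^ 2
  | 0, a => by simp
  | n + 1, a => by
    rw [← (Fin.consEquiv fun _ : Fin (n + 1) => Bool).sum_comp, Fintype.sum_prod_type]
    simp only [Fin.consEquiv_apply, Fin.sum_univ_succ, Fin.cons_zero, Fin.cons_succ,
      Fintype.sum_bool, if_true, Bool.false_eq_true, if_false]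
    rw [← Finset.sum_add_distrib]
    have ih := sum_signs_sq n fun i => a i.succ
    calc _ = ∑ ε : Fin n → Bool, (2 * a 0 ^ 2
          + 2 * (∑ i, (if ε i then 1 else -1) * a i.succ) ^ 2) :=
          Finset.sum_congr rfl fun ε _ => by ring
      _ = _ := by
          rw [Finset.sum_add_distrib, Finset.sum_const, ← Finset.mul_sum, ih]
          simp
          ring

/-- The Cauchy-Schwarz and arithmetic-geometric mean inequalities, with a free weight `t`. -/
lemma abs_sum_mul_le {ι : Type*} (s : Finset ι) (c A : ι → ℝ) {t : ℝ} (ht : 0 < t) :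
    |∑ i ∈ s, c i * A i| ≤ t / 4 * ∑ i ∈ s, c i ^ 2 + t⁻¹ * ∑ i ∈ s, A i ^ 2 := by
  rw [Finset.mul_sum, Finset.mul_sum, ← Finset.sum_add_distrib]
  refine (Finset.abs_sum_le_sum_abs _ _).trans (Finset.sum_le_sum fun i _ => ?_)
  rw [abs_mul, ← sq_abs (c i), ← sq_abs (A i)]
  have h1 : 0 ≤ t⁻¹ * (t / 2 * |c i| - |A i|) ^ 2 := by positivity
  have h2 : t⁻¹ * (t / 2 * |c i| - |A i|) ^ 2
      = t / 4 * |c i| ^ 2 + t⁻¹ * |A i| ^ 2 - |c i| * |A i| := by field_simp; ring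
  linarith

/-- The local Rademacher complexity is bounded through the split `f = Π f + (f - Π f)`, where `Π` is
the projection onto the top `r` eigenfunctions: the first part lives in an `r`-dimensional space,
and the second one is small. -/
lemma localRademacher_le (h : IsOrthonormalSystem P lam φ) (hφ : ∀ i, Measurable (φ i))
    (hm : 0 < m) {Ghat : Fin m → Z → ℝ} (hGm : ∀ j, Measurable (Ghat j))
    (hGhat : ∀ j, MemLp (Ghat j) 2 P) {r n : ℕ} (hn : 0 < n) {δ T : ℝ} (hδ : 0 < δ) (hT : 0 ≤ T)
    (htail : ∑ j, ∫⁻ z, ENNReal.ofReal ((Ghat j z - mercerProj P lam φ r (Ghat j) z) ^ 2) ∂P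
      ≤ ENNReal.ofReal (m * T)) :
    localRademacher P n (learnedBall Ghat 1) δ
      ≤ ENNReal.ofReal (δ ^ 2 / 2 + r / n + T / (n * δ ^ 2)) := by
  have hm' : (0 : ℝ) < m := by exact_mod_cast hm
  have hn' : (0 : ℝ) < n := by exact_mod_cast hn
  set I := {i ∈ Finset.range r | lam i ≠ 0} with hI
  set H : Fin m → Z → ℝ := fun j z => Ghat j z - mercerProj P lam φ r (Ghat j) z with hH
  have hprojm : ∀ g : Z → ℝ, Measurable (mercerProj P lam φ r g) := fun g =>
    Finset.measurable_sum _ fun i _ => (hφ i).const_mul _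
  have hHm : ∀ j, Measurable (H j) := fun j => (hGm j).sub (hprojm _)
  -- the deterministic bound for fixed sample points and signs
  have hpt : ∀ (z : Fin n → Z) (ε : Fin n → Bool),
      (⨆ g ∈ {g ∈ learnedBall Ghat 1 | eLpNorm g 2 P ≤ ENNReal.ofReal δ},
        ENNReal.ofReal |(n : ℝ)⁻¹ * ∑ i, (if ε i then 1 else -1) * g (z i)|)
      ≤ ENNReal.ofReal (δ ^ 2 / 2
        + ∑ l ∈ I, ((n : ℝ)⁻¹ * ∑ i, (if ε i then 1 else -1) * φ l (z i)) ^ 2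
        + (δ ^ 2 * m)⁻¹ * ∑ j, ((n : ℝ)⁻¹ * ∑ i, (if ε i then 1 else -1) * H j (z i)) ^ 2) := by
    intro z ε
    refine iSup₂_le fun f hf => ENNReal.ofReal_le_ofReal ?_
    obtain ⟨⟨θ, hθ, rfl⟩, hfδ⟩ := hf
    set f : Z → ℝ := fun z => ∑ j, θ j * Ghat j z with hf
    have hfm : MemLp f 2 P := memLp_finsetSum _ fun j _ => (hGhat j).const_mul _
    set c : ℕ → ℝ := fun l => ∫ z, φ l z * f z ∂P with hc
    have hsplit : ∀ z, f z = ∑ l ∈ I, c l * φ l z + ∑ j, θ j * H j z := fun z => by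
      have h1 : mercerProj P lam φ r f z = ∑ l ∈ I, c l * φ l z := rfl
      rw [← h1, h.mercerProj_sum r (fun j => θ j) (fun j _ => hGhat j)]
      simp only [hH, mul_sub, Finset.sum_sub_distrib]
      ring
    have hcδ : ∑ l ∈ I, c l ^ 2 ≤ δ ^ 2 := by
      refine (h.sum_sq_le hfm r).trans ?_
      have h1 := (lintegral_sq_le_iff hfm hδ.le).2 hfδ
      rw [← ofReal_integral_eq_lintegral_ofReal hfm.integrable_sq
        (Eventually.of_forall fun x => by positivity)] at h1
      exact (ENNReal.ofReal_le_ofReal_iff (by positivity)).1 h1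
    have hθm : m * ∑ j, θ j ^ 2 ≤ 1 := by
      rw [← EuclideanSpace.real_norm_sq_eq]
      have h1 : (√(m : ℝ) * ‖θ‖) ^ 2 ≤ 1 := pow_le_one₀ (by positivity) hθ
      rwa [mul_pow, Real.sq_sqrt hm'.le] at h1
    have hlin : (n : ℝ)⁻¹ * ∑ i, (if ε i then 1 else -1) * f (z i)
        = ∑ l ∈ I, c l * ((n : ℝ)⁻¹ * ∑ i, (if ε i then 1 else -1) * φ l (z i))
          + ∑ j, θ j * ((n : ℝ)⁻¹ * ∑ i, (if ε i then 1 else -1) * H j (z i)) := by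
      simp_rw [hsplit, mul_add, Finset.sum_add_distrib, mul_add, Finset.mul_sum]
      congr 1
      · rw [Finset.sum_comm]
        exact Finset.sum_congr rfl fun _ _ => Finset.sum_congr rfl fun _ _ => by ring
      · rw [Finset.sum_comm]
        exact Finset.sum_congr rfl fun _ _ => Finset.sum_congr rfl fun _ _ => by ring
    rw [hlin]
    refine (abs_add_le _ _).trans ?_
    have h1 := abs_sum_mul_le I c
      (fun l => (n : ℝ)⁻¹ * ∑ i, (if ε i then 1 else -1) * φ l (z i)) one_pos
    have h2 := abs_sum_mul_le Finset.univ (fun j => θ j)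
      (fun j => (n : ℝ)⁻¹ * ∑ i, (if ε i then 1 else -1) * H j (z i))
      (show 0 < δ ^ 2 * m by positivity)
    have h3 : δ ^ 2 * m / 4 * ∑ j, θ j ^ 2 ≤ δ ^ 2 / 4 := by
      have := mul_le_mul_of_nonneg_left hθm (show 0 ≤ δ ^ 2 / 4 by positivity)
      linarith
    rw [inv_one, one_mul] at h1
    linarith
  have hsq : ∀ (u : Z → ℝ) (z : Fin n → Z),
      ∑ ε : Fin n → Bool, ((n : ℝ)⁻¹ * ∑ i, (if ε i then 1 else -1) * u (z i)) ^ 2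
        = 2 ^ n * ((n : ℝ)⁻¹ ^ 2 * ∑ i, u (z i) ^ 2) := fun u z => by
    simp_rw [mul_pow]
    rw [← Finset.mul_sum, sum_signs_sq n fun i => u (z i)]
    ring
  -- the average over the signs
  have havg : ∀ z : Fin n → Z, (∑ ε : Fin n → Bool,
      ⨆ g ∈ {g ∈ learnedBall Ghat 1 | eLpNorm g 2 P ≤ ENNReal.ofReal δ},
        ENNReal.ofReal |(n : ℝ)⁻¹ * ∑ i, (if ε i then 1 else -1) * g (z i)|) / 2 ^ n
      ≤ ENNReal.ofReal (δ ^ 2 / 2) + (∑ l ∈ I, ENNReal.ofReal ((n : ℝ)⁻¹ ^ 2) *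
          ∑ i, ENNReal.ofReal (φ l (z i) ^ 2))
        + ENNReal.ofReal ((δ ^ 2 * m)⁻¹) * ∑ j, ENNReal.ofReal ((n : ℝ)⁻¹ ^ 2) *
          ∑ i, ENNReal.ofReal (H j (z i) ^ 2) := by
    intro z
    refine (ENNReal.div_le_div_right (Finset.sum_le_sum fun ε _ => hpt z ε) _).trans (le_of_eq ?_)
    rw [← ENNReal.ofReal_sum_of_nonneg fun ε _ => by positivity,
      show (2 : ℝ≥0∞) ^ n = ENNReal.ofReal (2 ^ n) by
        rw [ENNReal.ofReal_pow (by norm_num)]; norm_num,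
      ← ENNReal.ofReal_div_of_pos (by positivity), Finset.sum_add_distrib, Finset.sum_add_distrib,
      Finset.sum_comm, ← Finset.mul_sum,
      Finset.sum_comm (s := Finset.univ (α := Fin n → Bool)) (t := Finset.univ (α := Fin m))]
    simp_rw [hsq]
    have h2 : ∀ u : Z → ℝ, ENNReal.ofReal ((n : ℝ)⁻¹ ^ 2) * ∑ i, ENNReal.ofReal (u (z i) ^ 2)
        = ENNReal.ofReal ((n : ℝ)⁻¹ ^ 2 * ∑ i, u (z i) ^ 2) := fun u => by
      rw [ENNReal.ofReal_mul (by positivity),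
        ENNReal.ofReal_sum_of_nonneg fun i _ => by positivity]
    simp_rw [h2]
    rw [← ENNReal.ofReal_sum_of_nonneg fun i _ => by positivity,
      ← ENNReal.ofReal_sum_of_nonneg fun i _ => by positivity,
      ← ENNReal.ofReal_mul (by positivity), ← ENNReal.ofReal_add (by positivity) (by positivity),
      ← ENNReal.ofReal_add (by positivity) (by positivity)]
    congr 1
    simp_rw [← Finset.mul_sum]
    simp
    field_simp
  have hint : ∀ u : Z → ℝ, Measurable u → ∫⁻ z, ENNReal.ofReal ((n : ℝ)⁻¹ ^ 2) *
      ∑ i, ENNReal.ofReal (u (z i) ^ 2) ∂(Measure.pi fun _ : Fin n => P)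
      = ENNReal.ofReal (n : ℝ)⁻¹ * ∫⁻ z, ENNReal.ofReal (u z ^ 2) ∂P := fun u hu => by
    rw [lintegral_const_mul' _ _ ENNReal.ofReal_ne_top,
      lintegral_finsetSum _ fun i _ => by fun_prop]
    have h1 : ∀ i : Fin n, ∫⁻ z : Fin n → Z, ENNReal.ofReal (u (z i) ^ 2)
        ∂(Measure.pi fun _ : Fin n => P) = ∫⁻ z, ENNReal.ofReal (u z ^ 2) ∂P := fun i =>
      (measurePreserving_eval (fun _ : Fin n => P) i).lintegral_comp
        (f := fun z => ENNReal.ofReal (u z ^ 2)) (by fun_prop)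
    simp_rw [h1]
    rw [Finset.sum_const, Finset.card_univ, Fintype.card_fin, nsmul_eq_mul, ← mul_assoc,
      ← ENNReal.ofReal_natCast, ← ENNReal.ofReal_mul (by positivity)]
    congr 2
    field_simp
  have hφ1 : ∀ l ∈ I, ∫⁻ z, ENNReal.ofReal (φ l z ^ 2) ∂P = 1 := fun l hl => by
    have hl' := (Finset.mem_filter.1 hl).2
    rw [← ofReal_integral_eq_lintegral_ofReal (h.memLp l hl').integrable_sq
        (Eventually.of_forall fun x => by positivity)]
    have := h.orthonormal l l hl' hl'
    simp_rw [← sq] at this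
    rw [this]; simp
  calc _ ≤ _ := lintegral_mono havg
    _ = ENNReal.ofReal (δ ^ 2 / 2) + (∑ l ∈ I, ENNReal.ofReal (n : ℝ)⁻¹)
        + ENNReal.ofReal ((δ ^ 2 * m)⁻¹) * ∑ j, ENNReal.ofReal (n : ℝ)⁻¹ *
          ∫⁻ z, ENNReal.ofReal (H j z ^ 2) ∂P := by
        have e1 : Measurable fun z : Fin n → Z => ENNReal.ofReal (δ ^ 2 / 2) +
            (∑ l ∈ I, ENNReal.ofReal ((n : ℝ)⁻¹ ^ 2) * ∑ i, ENNReal.ofReal (φ l (z i) ^ 2)) := by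
          fun_prop
        rw [lintegral_add_left e1, lintegral_add_left measurable_const, lintegral_const,
          measure_univ, mul_one, lintegral_finsetSum _ fun l _ => by fun_prop,
          lintegral_const_mul' _ _ ENNReal.ofReal_ne_top,
          lintegral_finsetSum _ fun j _ => by fun_prop]
        congr 2
        · exact Finset.sum_congr rfl fun l hl => by rw [hint _ (hφ l), hφ1 l hl, mul_one]
        · exact Finset.sum_congr rfl fun j _ => hint _ (hHm j)
    _ ≤ ENNReal.ofReal (δ ^ 2 / 2) + ENNReal.ofReal (r / n)
        + ENNReal.ofReal ((δ ^ 2 * m)⁻¹) * (ENNReal.ofReal (n : ℝ)⁻¹ * ENNReal.ofReal (m * T)) := by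
        rw [← Finset.mul_sum]
        gcongr
        rw [Finset.sum_const, nsmul_eq_mul, ← ENNReal.ofReal_natCast,
          ← ENNReal.ofReal_mul (by positivity), div_eq_mul_inv]
        refine ENNReal.ofReal_le_ofReal (mul_le_mul_of_nonneg_right ?_ (by positivity))
        exact_mod_cast (Finset.card_filter_le _ _).trans_eq (Finset.card_range r)
    _ = _ := by
        rw [← ENNReal.ofReal_mul (by positivity), ← ENNReal.ofReal_mul (by positivity),
          ← ENNReal.ofReal_add (by positivity) (by positivity),
          ← ENNReal.ofReal_add (by positivity) (by positivity)]
        congr 1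
        field_simp

end Rademacher

/-! ### Eigenvalue tails -/

section Eigenvalues

/-- Comparison of a term of the series `∑ i^{-(b+1)}` with the integral of `x^{-(b+1)}`. -/
lemma rpow_neg_succ_le {b : ℝ} (hb : 0 < b) {M : ℕ} (hM : 1 ≤ M) :
    ((M : ℝ) + 1) ^ (-(b + 1)) ≤ ((M : ℝ) ^ (-b) - ((M : ℝ) + 1) ^ (-b)) / b := by
  have hM' : (0 : ℝ) < M := by exact_mod_cast hM
  have h1 : 1 - (((M : ℝ) + 1) / M)⁻¹ ≤ Real.log ((M + 1) / M) :=
    Real.one_sub_inv_le_log_of_pos (by positivity)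
  have h2 : 1 - (((M : ℝ) + 1) / M)⁻¹ = ((M : ℝ) + 1)⁻¹ := by field_simp; ring
  have h3 : (M : ℝ) ^ (-b) = ((M : ℝ) + 1) ^ (-b) * Real.exp (b * Real.log ((M + 1) / M)) := by
    rw [Real.rpow_def_of_pos hM', Real.rpow_def_of_pos (by positivity), ← Real.exp_add,
      Real.log_div (by positivity) (by positivity)]
    congr 1; ring
  have h4 : 1 + b * ((M : ℝ) + 1)⁻¹ ≤ Real.exp (b * Real.log ((M + 1) / M)) := by
    refine le_trans ?_ (Real.add_one_le_exp _)
    rw [h2] at h1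
    nlinarith
  have h5 : ((M : ℝ) + 1) ^ (-(b + 1)) = ((M : ℝ) + 1) ^ (-b) * ((M : ℝ) + 1)⁻¹ := by
    rw [neg_add, Real.rpow_add (by positivity), Real.rpow_neg_one]
  rw [le_div_iff₀ hb, h3, h5]
  have h6 := mul_le_mul_of_nonneg_left h4 (show 0 ≤ ((M : ℝ) + 1) ^ (-b) by positivity)
  linarith

variable {lam : ℕ → ℝ} {b D : ℝ}

lemma eigenvalue_le (hD : 0 ≤ D) (hb : 0 < b) (h : ∀ i : ℕ, lam i ≤ D * ((i : ℝ) + 1) ^ (-(b + 1)))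
    {r i : ℕ} (hr : 1 ≤ r) (hi : r ≤ i) : lam i ≤ D * (r : ℝ) ^ (-(b + 1)) := by
  refine (h i).trans (mul_le_mul_of_nonneg_left ?_ hD)
  refine Real.rpow_le_rpow_of_nonpos (by exact_mod_cast hr) ?_ (by linarith)
  have : (r : ℝ) ≤ i := by exact_mod_cast hi
  linarith

lemma sum_eigenvalues_le (hD : 0 ≤ D) (hb : 0 < b)
    (h : ∀ i : ℕ, lam i ≤ D * ((i : ℝ) + 1) ^ (-(b + 1))) {r : ℕ} (hr : 1 ≤ r) (M : ℕ) :
    ∑ i ∈ Finset.range M with r ≤ i ∧ lam i ≠ 0, lam i ≤ D / b * (r : ℝ) ^ (-b) := by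
  have h1 : ∀ M, r ≤ M → ∑ i ∈ Finset.Ico r M, ((i : ℝ) + 1) ^ (-(b + 1))
      ≤ ((r : ℝ) ^ (-b) - (M : ℝ) ^ (-b)) / b := by
    intro M hM
    induction M, hM using Nat.le_induction with
    | base => simp
    | succ M hM ih =>
      rw [Finset.sum_Ico_succ_top hM]
      have := rpow_neg_succ_le hb (hr.trans hM)
      push_cast
      calc _ ≤ _ := add_le_add ih this
        _ = _ := by ring
  have hle : ∑ i ∈ Finset.range M with r ≤ i ∧ lam i ≠ 0, lam i
      ≤ ∑ i ∈ Finset.Ico r (max r M), D * ((i : ℝ) + 1) ^ (-(b + 1)) := by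
    refine (Finset.sum_le_sum fun i _ => h i).trans ?_
    refine Finset.sum_le_sum_of_subset_of_nonneg ?_ fun i _ _ => by positivity
    intro i hi
    simp only [Finset.mem_filter, Finset.mem_range, Finset.mem_Ico] at hi ⊢
    exact ⟨hi.2.1, lt_max_of_lt_right hi.1⟩
  refine hle.trans ?_
  rw [← Finset.mul_sum, div_mul_eq_mul_div, mul_div_assoc]
  refine mul_le_mul_of_nonneg_left ((h1 _ (le_max_left _ _)).trans ?_) hD
  refine div_le_div_of_nonneg_right ?_ hb.le
  have : 0 ≤ ((max r M : ℕ) : ℝ) ^ (-b) := by positivity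
  linarith

end Eigenvalues

/-! ### Error of the truncated estimates -/

section Truncation

/-- Truncation to `[-T, T]`. -/
def clip (T x : ℝ) : ℝ := max (-T) (min T x)

lemma measurable_clip (T : ℝ) : Measurable (clip T) :=
  measurable_const.max (measurable_const.min measurable_id)

lemma abs_clip_sub_clip_le {T : ℝ} (x y : ℝ) : |clip T x - clip T y| ≤ |x - y| :=
  (abs_max_sub_max_le_max _ _ _ _).trans (max_le (by simp) ((abs_min_sub_min_le_max _ _ _ _).trans
    (max_le (by simp) le_rfl)))

/-- The truncation error vanishes unless `T ≤ |y|`, where the exponential factors exceed it. -/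
lemma sq_clip_sub_le {T s : ℝ} (hT : 0 ≤ T) (hs : 0 < s) (y : ℝ) :
    (clip T y - y) ^ 2 ≤ s⁻¹ * Real.exp (-(s * T ^ 2)) * Real.exp (2 * s * y ^ 2) := by
  unfold clip
  by_cases hy : |y| ≤ T
  · rw [abs_le] at hy
    rw [min_eq_right hy.2, max_eq_right hy.1, sub_self, zero_pow two_ne_zero]
    positivity
  · push Not at hy
    have h1 : (max (-T) (min T y) - y) ^ 2 ≤ y ^ 2 := by
      rcases lt_abs.1 hy with h | h
      · rw [min_eq_left h.le, max_eq_right (by linarith)]; nlinarith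
      · rw [min_eq_right (by linarith), max_eq_left (by linarith)]; nlinarith
    have h2 : T ^ 2 ≤ y ^ 2 := by rw [← sq_abs y]; gcongr
    have h3 : y ^ 2 ≤ s⁻¹ * Real.exp (s * y ^ 2) := by
      rw [← div_eq_inv_mul, le_div_iff₀ hs]
      linarith [Real.add_one_le_exp (s * y ^ 2)]
    rw [mul_assoc, ← Real.exp_add]
    refine (h1.trans h3).trans ?_
    gcongr
    nlinarith

variable {X : Type*} [MeasurableSpace X] {Q : Measure X}
  {k : X → X → ℝ} {U : Type*} [MeasurableSpace U] {ν : Measure U} [IsProbabilityMeasure ν]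
  {gp : U → X → ℝ} {K : ℝ}

/-- The mean squared truncation error of a value of the process is Gaussian-small in the
truncation level. -/
lemma IsGPSample.lintegral_sq_clip_sub (hgp : IsGPSample ν Q k gp) (hK0 : 0 < K)
    (hK : ∀ x, k x x ≤ K) {T : ℝ} (hT : 0 ≤ T) (x : X) :
    ∫⁻ u, ENNReal.ofReal ((clip T (gp u x) - gp u x) ^ 2) ∂ν
      ≤ ENNReal.ofReal (16 * K * Real.exp (-(T ^ 2 / (8 * K)))) := by
  have hxm : Measurable fun u => gp u x :=
    hgp.measurable.comp (measurable_id.prodMk measurable_const)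
  have hk0 : 0 ≤ k x x := by
    rw [← hgp.cov x x]; exact integral_nonneg fun u => mul_self_nonneg _
  have hmap := (hgp.gaussian.hasGaussianLaw_eval x).map_eq_gaussianReal
  rw [hgp.mean_zero, variance_of_integral_eq_zero hxm.aemeasurable (hgp.mean_zero x)] at hmap
  have hvar : ∫ u, gp u x ^ 2 ∂ν = k x x := by rw [← hgp.cov x x]; simp [sq]
  rw [hvar] at hmap
  have h1 : ∫⁻ u, ENNReal.ofReal (Real.exp (2 * (8 * K)⁻¹ * gp u x ^ 2)) ∂ν
      ≤ ENNReal.ofReal (Real.exp (1 / 2)) := by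
    have h2 := lintegral_exp_sum_sq_le (μ := ν) (ι := Unit) (Y := fun _ u => gp u x)
      (l := fun _ => k x x) (s := 2 * (8 * K)⁻¹) (fun _ => hxm) (by positivity) (fun _ => hk0)
      (fun _ => by
        rw [mul_inv, ← mul_assoc, mul_assoc, ← div_eq_inv_mul]
        have := (div_le_one hK0).2 (hK x)
        linarith)
      (fun ζ => by
        simp only [Finset.univ_unique, Finset.sum_singleton]
        refine le_of_eq (lintegral_exp_of_map_eq (hxm.const_mul _) (by positivity) ?_)
        have h3 := gaussianReal_map_const_mul (μ := 0) (v := (k x x).toNNReal) (ζ default)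
        rw [← hmap, Measure.map_map (by fun_prop) hxm] at h3
        refine h3.trans ?_
        rw [mul_zero]
        congr 1
        ext
        simp [hk0, mul_nonneg (sq_nonneg (ζ ())) hk0])
    simp only [Finset.univ_unique, Finset.sum_singleton] at h2
    refine h2.trans (ENNReal.ofReal_le_ofReal (Real.exp_le_exp.2 ?_))
    have := (div_le_one hK0).2 (hK x)
    rw [mul_inv]
    calc _ = 1 / 2 * (k x x / K) := by rw [div_eq_mul_inv]; ring
      _ ≤ _ := by linarith
  have he : Real.exp (1 / 2) ≤ 2 := by
    have h4 : Real.exp (1 / 2) ^ 2 = Real.exp 1 := by rw [← Real.exp_nat_mul]; norm_num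
    have h5 := Real.exp_one_lt_d9
    nlinarith [Real.exp_pos (1 / 2)]
  calc _ ≤ ∫⁻ u, ENNReal.ofReal (8 * K * Real.exp (-(T ^ 2 / (8 * K))))
        * ENNReal.ofReal (Real.exp (2 * (8 * K)⁻¹ * gp u x ^ 2)) ∂ν := by
        refine lintegral_mono fun u => ?_
        rw [← ENNReal.ofReal_mul (by positivity)]
        refine ENNReal.ofReal_le_ofReal ?_
        have := sq_clip_sub_le hT (show 0 < (8 * K)⁻¹ by positivity) (gp u x)
        rwa [inv_inv, ← div_eq_inv_mul] at this
    _ ≤ ENNReal.ofReal (8 * K * Real.exp (-(T ^ 2 / (8 * K)))) * ENNReal.ofReal 2 := by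
        rw [lintegral_const_mul' _ _ ENNReal.ofReal_ne_top]
        gcongr
        exact h1.trans (ENNReal.ofReal_le_ofReal he)
    _ = _ := by rw [← ENNReal.ofReal_mul (by positivity)]; congr 1; ring

end Truncation

section Regression

variable {Z X U W : Type*} [MeasurableSpace Z] [MeasurableSpace X] [MeasurableSpace U]
  [MeasurableSpace W] {P : Measure Z} [IsProbabilityMeasure P] {Φ : Z → X} {ν : Measure U}
  [IsProbabilityMeasure ν] {gp : U → X → ℝ} {κ : Kernel Z W} [IsMarkovKernel κ]
  {A : (n : ℕ) → (Fin n → Z × ℝ) → Z → ℝ} {ξ : ℕ → ℝ} {k : X → X → ℝ} {K Ck : ℝ}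
  {η : ℕ → U → Z → W → ℝ}

instance instIsProbabilityMeasureSampleMeasure (m n : ℕ) :
    IsProbabilityMeasure (sampleMeasure P ν κ m n) := by
  unfold sampleMeasure; infer_instance

lemma lintegral_sampleMeasure {m n : ℕ} (j : Fin m) {F : U → (Fin n → Z × W) → ℝ≥0∞}
    (hF : Measurable (Function.uncurry F)) :
    ∫⁻ ω, F (ω.1 j) ω.2 ∂(sampleMeasure P ν κ m n)
      = ∫⁻ u, ∫⁻ s, F u s ∂(Measure.pi fun _ : Fin n => P ⊗ₘ κ) ∂ν := by
  rw [sampleMeasure, lintegral_prod]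
  · exact (measurePreserving_eval (fun _ : Fin m => ν) j).lintegral_comp
      (f := fun u => ∫⁻ s, F u s ∂(Measure.pi fun _ : Fin n => P ⊗ₘ κ)) hF.lintegral_prod_right
  · have h1 : Measurable fun ω : (Fin m → U) × (Fin n → Z × W) => (ω.1 j, ω.2) := by fun_prop
    exact (hF.comp h1).aemeasurable

lemma lintegral_sampleMeasure_sum_le {m n : ℕ} {F : ℕ → U → (Fin n → Z × W) → ℝ≥0∞}
    (hF : ∀ j, Measurable (Function.uncurry (F j))) {a : ℝ≥0∞}
    (h : ∀ j, ∫⁻ u, ∫⁻ s, F j u s ∂(Measure.pi fun _ : Fin n => P ⊗ₘ κ) ∂ν ≤ a) :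
    ∫⁻ ω, ∑ j : Fin m, F j (ω.1 j) ω.2 ∂(sampleMeasure P ν κ m n) ≤ m * a := by
  rw [lintegral_finsetSum]
  · refine (Finset.sum_le_sum fun j _ => (lintegral_sampleMeasure j (hF j)).trans_le (h j)).trans ?_
    simp
  · intro j _
    have h1 : Measurable fun ω : (Fin m → U) × (Fin n → Z × W) => (ω.1 j, ω.2) := by fun_prop
    exact (hF j).comp h1

/-- Joint measurability of the untruncated estimate of a task in its random path, the shared data
and the evaluation point. -/
lemma measurable_estimate (hΦ : Measurable Φ) (hgp : Measurable (Function.uncurry gp))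
    (hA : ∀ n, Measurable (Function.uncurry (A n))) {e : U → Z → W → ℝ}
    (he : Measurable fun q : U × Z × W => e q.1 q.2.1 q.2.2) (n : ℕ) :
    Measurable fun p : (U × (Fin n → Z × W)) × Z =>
      A n (regressionData (fun z => gp p.1.1 (Φ z)) (e p.1.1) p.1.2) p.2 := by
  have h1 : Measurable fun p : (U × (Fin n → Z × W)) × Z =>
      regressionData (fun z => gp p.1.1 (Φ z)) (e p.1.1) p.1.2 := by
    refine measurable_pi_lambda _ fun i => ?_
    have hs : Measurable fun p : (U × (Fin n → Z × W)) × Z => p.1.2 i := by fun_prop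
    have hu : Measurable fun p : (U × (Fin n → Z × W)) × Z => p.1.1 := by fun_prop
    refine (measurable_fst.comp hs).prodMk (Measurable.add ?_ ?_)
    · exact hgp.comp (hu.prodMk (hΦ.comp (measurable_fst.comp hs)))
    · exact he.comp (hu.prodMk hs)
  exact (hA n).comp (h1.prodMk measurable_snd)

lemma eLpNorm_two_sq {f : Z → ℝ} :
    eLpNorm f 2 P ^ 2 = ∫⁻ z, ENNReal.ofReal (f z ^ 2) ∂P := by
  have := eLpNorm_nnreal_pow_eq_lintegral (μ := P) (f := f) (p := 2) two_ne_zero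
  simp only [NNReal.coe_ofNat, ENNReal.coe_ofNat, ENNReal.rpow_ofNat] at this
  rw [this]
  refine lintegral_congr fun z => ?_
  rw [← sq_abs, ENNReal.ofReal_pow (abs_nonneg _), Real.enorm_eq_ofReal_abs]

lemma lintegral_sq_clip_sub_le (T : ℝ) (f : Z → ℝ) {g : Z → ℝ} (hg : Measurable g) :
    ∫⁻ z, ENNReal.ofReal ((clip T (f z) - g z) ^ 2) ∂P
      ≤ 2 * eLpNorm (fun z => f z - g z) 2 P ^ 2
        + 2 * ∫⁻ z, ENNReal.ofReal ((clip T (g z) - g z) ^ 2) ∂P := by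
  have hm : Measurable fun z => ENNReal.ofReal ((clip T (g z) - g z) ^ 2) :=
    ((((measurable_clip T).comp hg).sub hg).pow_const 2).ennreal_ofReal
  rw [eLpNorm_two_sq, ← lintegral_const_mul' _ _ (by norm_num),
    ← lintegral_const_mul' _ _ (by norm_num), ← lintegral_add_right _ (hm.const_mul 2)]
  refine lintegral_mono fun z => ?_
  rw [show (2 : ℝ≥0∞) = ENNReal.ofReal 2 by norm_num, ← ENNReal.ofReal_mul (by norm_num),
    ← ENNReal.ofReal_mul (by norm_num), ← ENNReal.ofReal_add (by positivity) (by positivity)]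
  refine ENNReal.ofReal_le_ofReal ?_
  have h1 := sq_le_sq.2 (abs_clip_sub_clip_le (T := T) (f z) (g z))
  nlinarith [sq_nonneg ((clip T (f z) - clip T (g z)) - (clip T (g z) - g z))]

/-- The expected squared error of a truncated estimate. -/
lemma lintegral_sq_clip_estimate_le (hΦ : Measurable Φ) (hgp : IsGPSample ν (P.map Φ) k gp)
    (hK0 : 0 < K) (hK : ∀ x, k x x ≤ K) {e : U → Z → W → ℝ} (he : IsNoise P Φ ν gp κ e)
    (hA : IsRegressionOracle P Φ ν gp κ A ξ) (n : ℕ) {T : ℝ} (hT : 0 ≤ T) :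
    ∫⁻ u, ∫⁻ s, ∫⁻ z, ENNReal.ofReal ((clip T (A n (regressionData (fun z => gp u (Φ z)) (e u) s) z)
        - gp u (Φ z)) ^ 2) ∂P ∂(Measure.pi fun _ : Fin n => P ⊗ₘ κ) ∂ν
      ≤ ENNReal.ofReal (2 * ξ n ^ 2 + 32 * K * Real.exp (-(T ^ 2 / (8 * K)))) := by
  have hg : Measurable fun p : U × Z => gp p.1 (Φ p.2) :=
    hgp.measurable.comp (measurable_fst.prodMk (hΦ.comp measurable_snd))
  have hm : Measurable fun p : U × Z =>
      ENNReal.ofReal ((clip T (gp p.1 (Φ p.2)) - gp p.1 (Φ p.2)) ^ 2) :=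
    ((((measurable_clip T).comp hg).sub hg).pow_const 2).ennreal_ofReal
  have hB : ∫⁻ u, ∫⁻ z, ENNReal.ofReal ((clip T (gp u (Φ z)) - gp u (Φ z)) ^ 2) ∂P ∂ν
      ≤ ENNReal.ofReal (16 * K * Real.exp (-(T ^ 2 / (8 * K)))) := by
    rw [lintegral_lintegral_swap hm.aemeasurable]
    refine (lintegral_mono fun z => hgp.lintegral_sq_clip_sub hK0 hK hT (Φ z)).trans ?_
    rw [lintegral_const, measure_univ, mul_one]
  set B : U → ℝ≥0∞ := fun u => ∫⁻ z, ENNReal.ofReal ((clip T (gp u (Φ z)) - gp u (Φ z)) ^ 2) ∂P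
    with hBdef
  have hBm : Measurable B := hm.lintegral_prod_right'
  calc _ ≤ ∫⁻ u, ∫⁻ s, (2 * eLpNorm (fun z => A n (regressionData (fun z => gp u (Φ z)) (e u) s) z
            - gp u (Φ z)) 2 P ^ 2 + 2 * B u) ∂(Measure.pi fun _ : Fin n => P ⊗ₘ κ) ∂ν :=
        lintegral_mono fun u => lintegral_mono fun s => lintegral_sq_clip_sub_le T _
          (hg.comp (measurable_const.prodMk measurable_id))
    _ = 2 * (∫⁻ u, ∫⁻ s, eLpNorm (fun z => A n (regressionData (fun z => gp u (Φ z)) (e u) s) z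
            - gp u (Φ z)) 2 P ^ 2 ∂(Measure.pi fun _ : Fin n => P ⊗ₘ κ) ∂ν) + 2 * ∫⁻ u, B u ∂ν := by
        simp_rw [lintegral_add_right _ measurable_const, lintegral_const, measure_univ, mul_one]
        rw [lintegral_add_right _ (hBm.const_mul 2)]
        refine congrArg₂ (· + ·) ?_ (lintegral_const_mul' _ _ ENNReal.ofNat_ne_top)
        rw [← lintegral_const_mul' _ _ ENNReal.ofNat_ne_top]
        exact lintegral_congr fun u => lintegral_const_mul' _ _ ENNReal.ofNat_ne_top
    _ ≤ 2 * ENNReal.ofReal (ξ n ^ 2)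
        + 2 * ENNReal.ofReal (16 * K * Real.exp (-(T ^ 2 / (8 * K)))) :=
        add_le_add (mul_le_mul_right (hA.risk_le e he n) 2) (mul_le_mul_right hB 2)
    _ = _ := by
        rw [show (2 : ℝ≥0∞) = ENNReal.ofReal 2 by norm_num, ← ENNReal.ofReal_mul (by norm_num),
          ← ENNReal.ofReal_mul (by norm_num), ← ENNReal.ofReal_add (by positivity) (by positivity)]
        congr 1; ring

/-- The expected total squared error of the truncated estimates. -/
lemma lintegral_sum_sq_truncEstimates_le (hΦ : Measurable Φ) (hgp : IsGPSample ν (P.map Φ) k gp)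
    (hK0 : 0 < K) (hK : ∀ x, k x x ≤ K) (hCk : 0 ≤ Ck)
    (hη : ∀ j, IsNoise P Φ ν gp κ (η j)) (hA : IsRegressionOracle P Φ ν gp κ A ξ) (m n : ℕ) :
    ∫⁻ ω, ∑ j, ∫⁻ z, ENNReal.ofReal ((truncEstimates A Ck (dataset Φ gp η ω) j z
        - gpPaths Φ gp ω j z) ^ 2) ∂P ∂(sampleMeasure P ν κ m n)
      ≤ ENNReal.ofReal (m * (2 * ξ n ^ 2
        + 32 * K * Real.exp (-((Ck * Real.log n) ^ 2 / (8 * K))))) := by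
  set T := Ck * Real.log n with hTdef
  have hT : 0 ≤ T := mul_nonneg hCk (Real.log_natCast_nonneg n)
  have hest := fun j => measurable_estimate hΦ hgp.measurable hA.measurable (hη j).measurable n
  have hgz : Measurable fun p : (U × (Fin n → Z × W)) × Z => gp p.1.1 (Φ p.2) :=
    hgp.measurable.comp ((measurable_fst.comp measurable_fst).prodMk (hΦ.comp measurable_snd))
  rw [ENNReal.ofReal_mul (by positivity), ENNReal.ofReal_natCast]
  refine lintegral_sampleMeasure_sum_le (F := fun j u s => ∫⁻ z, ENNReal.ofReal
    ((clip T (A n (regressionData (fun z => gp u (Φ z)) (η j u) s) z) - gp u (Φ z)) ^ 2) ∂P)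
    (fun j => ?_) fun j => lintegral_sq_clip_estimate_le hΦ hgp hK0 hK (hη j) hA n hT
  exact Measurable.lintegral_prod_right' (f := fun p : (U × (Fin n → Z × W)) × Z => ENNReal.ofReal
    ((clip T (A n (regressionData (fun z => gp p.1.1 (Φ z)) (η j p.1.1) p.1.2) p.2)
      - gp p.1.1 (Φ p.2)) ^ 2))
    ((((measurable_clip T).comp (hest j)).sub hgz).pow_const 2).ennreal_ofReal

end Regression

/-! ### Failure probabilities of the good event -/

lemma measure_exists_mem_le {Ω α : Type*} [MeasurableSpace Ω] {μ : Measure Ω} (N : Finset α)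
    (p : α → Ω → Prop) {c B : ℝ} (hc : (N.card : ℝ) ≤ Real.exp c)
    (h : ∀ v ∈ N, μ {ω | p v ω} ≤ ENNReal.ofReal (Real.exp B)) :
    μ {ω | ∃ v ∈ N, p v ω} ≤ ENNReal.ofReal (Real.exp (c + B)) := by
  have h1 : {ω | ∃ v ∈ N, p v ω} = ⋃ v ∈ N, {ω | p v ω} := by ext; simp
  rw [h1]
  refine (measure_biUnion_finset_le N _).trans ((Finset.sum_le_sum h).trans ?_)
  rw [Finset.sum_const, nsmul_eq_mul, ← ENNReal.ofReal_natCast,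
    ← ENNReal.ofReal_mul (by positivity), Real.exp_add]
  exact ENNReal.ofReal_le_ofReal (mul_le_mul_of_nonneg_right hc (Real.exp_pos _).le)

/-- The cardinality `20001 ^ d` of a `1/10000`-net, in exponential form. -/
lemma pow_le_exp_mul {d : ℕ} {x : ℝ} (hx : (d : ℝ) * 10 ≤ x) : (20001 : ℝ) ^ d ≤ Real.exp x := by
  have h1 : (20001 : ℝ) ≤ Real.exp 10 := by
    have h2 : Real.exp 10 = Real.exp 1 ^ 10 := by rw [← Real.exp_nat_mul]; norm_num
    rw [h2]
    calc (20001 : ℝ) ≤ 2.7182 ^ 10 := by norm_num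
      _ ≤ _ := by gcongr; linarith [Real.exp_one_gt_d9]
  calc (20001 : ℝ) ^ d ≤ Real.exp 10 ^ d := by gcongr
    _ = Real.exp (d * 10) := by rw [← Real.exp_nat_mul]
    _ ≤ _ := Real.exp_le_exp.2 hx

section Events

variable {X : Type*} [MeasurableSpace X] {Q : Measure X} [IsProbabilityMeasure Q]
  {k : X → X → ℝ} {lam : ℕ → ℝ} {ψ : ℕ → X → ℝ}
  {U : Type*} [MeasurableSpace U] {ν : Measure U} [IsProbabilityMeasure ν]
  {gp : U → X → ℝ} {K b D : ℝ}

/-- The Gaussian matrix of whitened coefficients is well-conditioned on a net. The net has at most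
`exp (5 m)` elements; the constants `36` and `1 / 250000` make the probability of failure for a
single unit vector at most `exp (-17 m / 2)`, respectively `exp (-11 m / 2)`. -/
lemma IsGPSample.measure_not_wellConditioned (hgp : IsGPSample ν Q k gp) (hK : ∀ x, k x x ≤ K)
    (hk : IsBoundedKernel k) (h : IsMercerSystem Q k lam ψ) (hψ : ∀ i, Measurable (ψ i))
    {I : Finset ℕ} (hI : ∀ i ∈ I, lam i ≠ 0) {m : ℕ} (hIm : 2 * I.card ≤ m)
    {N : Finset (EuclideanSpace ℝ I)} (hN : ∀ v ∈ N, ‖v‖ = 1)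
    (hcard : (N.card : ℝ) ≤ 20001 ^ I.card) :
    (Measure.pi fun _ : Fin m => ν) {ω | ∃ v ∈ N, ¬ ((m : ℝ) / 250000
        ≤ ∑ j, (∑ i : I, v i * (coef Q gp (ψ i) (ω j) / √(lam i))) ^ 2 ∧
        ∑ j, (∑ i : I, v i * (coef Q gp (ψ i) (ω j) / √(lam i))) ^ 2 ≤ 36 * m)}
      ≤ ENNReal.ofReal (2 * Real.exp (-(m / 2))) := by
  have hc := fun i => hgp.measurable_coef (hψ i)
  set S : EuclideanSpace ℝ I → (Fin m → U) → ℝ := fun v ω =>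
    ∑ j, (∑ i : I, v i * (coef Q gp (ψ i) (ω j) / √(lam i))) ^ 2 with hS
  have hSm : ∀ v, Measurable (S v) := fun v => by simp only [hS]; fun_prop
  have hIm' : (I.card : ℝ) * 10 ≤ 5 * m := by
    have : (2 : ℝ) * I.card ≤ m := by exact_mod_cast hIm
    linarith
  have hcard' : (N.card : ℝ) ≤ Real.exp (5 * m) := hcard.trans (pow_le_exp_mul hIm')
  have hv : ∀ v ∈ N, ∑ i, v i ^ 2 = 1 := fun v hv => by
    rw [← EuclideanSpace.real_norm_sq_eq, hN v hv, one_pow]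
  have hup : ∀ v ∈ N, (Measure.pi fun _ : Fin m => ν) {ω | 36 * (m : ℝ) ≤ S v ω}
      ≤ ENNReal.ofReal (Real.exp (m / 2 - 9 * m)) := fun v hvN => by
    -- Chernoff's bound with the exponential moment of order `1 / 4`
    have h1 := hgp.lintegral_exp_white hK hk h hψ hI (hv v hvN) m (p := 1 / 4) (by norm_num)
    have h2 : (√(1 - 2 * (1 / 4)))⁻¹ ^ m ≤ Real.exp (m / 2) := by
      rw [show (m : ℝ) / 2 = m * (1 / 2) by ring, Real.exp_nat_mul]
      refine pow_le_pow_left₀ (by positivity) ?_ m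
      rw [← Real.sqrt_inv]
      have : (1 - 2 * (1 / 4) : ℝ)⁻¹ ≤ Real.exp (1 / 2) ^ 2 := by
        rw [← Real.exp_nat_mul]
        have := Real.exp_one_gt_d9
        norm_num
        linarith
      exact Real.sqrt_le_left (Real.exp_pos _).le |>.2 this
    have h3 := measure_le_of_lintegral_exp_le (hSm v) (h1.le.trans (ENNReal.ofReal_le_ofReal h2))
      (36 * m)
    refine (measure_mono fun ω hω => ?_).trans (h3.trans (le_of_eq ?_))
    · have hω' : 36 * (m : ℝ) ≤ S v ω := hω
      exact mul_le_mul_of_nonneg_left hω' (by norm_num)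
    · congr 2; ring
  have hlow : ∀ v ∈ N, (Measure.pi fun _ : Fin m => ν) {ω | S v ω ≤ (m : ℝ) / 250000}
      ≤ ENNReal.ofReal (Real.exp (m / 2 - 6 * m)) := fun v hvN => by
    -- a large negative order, as the small ball probability has to beat the size of the net
    have h1 := hgp.lintegral_exp_white hK hk h hψ hI (hv v hvN) m (p := -125000) (by norm_num)
    have h2 : (√(1 - 2 * (-125000)))⁻¹ ^ m ≤ Real.exp (-(6 * m)) := by
      rw [show -(6 * (m : ℝ)) = m * (-6) by ring, Real.exp_nat_mul]
      refine pow_le_pow_left₀ (by positivity) ?_ m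
      rw [Real.exp_neg]
      refine inv_anti₀ (Real.exp_pos _) (Real.le_sqrt_of_sq_le ?_)
      have h2 : Real.exp 6 ^ 2 = Real.exp 1 ^ 12 := by
        rw [← Real.exp_nat_mul, ← Real.exp_nat_mul]; norm_num
      rw [h2]
      calc Real.exp 1 ^ 12 ≤ 2.7183 ^ 12 := by gcongr; linarith [Real.exp_one_lt_d9]
        _ ≤ _ := by norm_num
    have h3 := measure_le_of_lintegral_exp_le (hSm v) (h1.le.trans (ENNReal.ofReal_le_ofReal h2))
      (m / 250000)
    refine (measure_mono fun ω hω => ?_).trans (h3.trans (le_of_eq ?_))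
    · have hω' : S v ω ≤ (m : ℝ) / 250000 := hω
      exact mul_le_mul_of_nonpos_left hω' (by norm_num)
    · congr 2; ring
  have h1 := measure_exists_mem_le N (fun v ω => 36 * (m : ℝ) ≤ S v ω) hcard' hup
  have h2 := measure_exists_mem_le N (fun v ω => S v ω ≤ (m : ℝ) / 250000) hcard' hlow
  refine (measure_mono (t := {ω | ∃ v ∈ N, 36 * (m : ℝ) ≤ S v ω}
    ∪ {ω | ∃ v ∈ N, S v ω ≤ (m : ℝ) / 250000})
    ?_).trans ((measure_union_le _ _).trans ((add_le_add h1 h2).trans ?_))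
  · rintro ω ⟨v, hvN, hω⟩
    rw [not_and_or, not_le, not_le] at hω
    rcases hω with hω | hω
    · exact Or.inr ⟨v, hvN, hω.le⟩
    · exact Or.inl ⟨v, hvN, hω.le⟩
  · rw [← ENNReal.ofReal_add (Real.exp_pos _).le (Real.exp_pos _).le, two_mul]
    have hm : (0 : ℝ) ≤ m := m.cast_nonneg
    refine ENNReal.ofReal_le_ofReal (add_le_add ?_ ?_) <;>
    exact Real.exp_le_exp.2 (by linarith)

/-- The order `r^{b+1} / (4 D)` is admissible for the exponential moments of the residual of
`Π_r`. -/
lemma mul_eigenvalue_le (hD : 0 < D) (hb : 0 < b)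
    (hdec : ∀ i : ℕ, lam i ≤ D * ((i : ℝ) + 1) ^ (-(b + 1))) {r : ℕ} (hr : 1 ≤ r) (i : ℕ)
    (hi : r ≤ i) : (r : ℝ) ^ (b + 1) / (4 * D) * lam i ≤ 1 / 4 := by
  have hr' : (0 : ℝ) < r := by exact_mod_cast hr
  have h1 := eigenvalue_le hD.le hb hdec hr hi
  rw [Real.rpow_neg hr'.le] at h1
  have h2 : 0 < (r : ℝ) ^ (b + 1) := by positivity
  rw [div_mul_eq_mul_div, div_le_iff₀ (by positivity)]
  have h3 := mul_le_mul_of_nonneg_left h1 h2.le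
  have h4 : (r : ℝ) ^ (b + 1) * (D * ((r : ℝ) ^ (b + 1))⁻¹) = D := by field_simp
  linarith

/-- All random linear combinations of the residuals are small on a net. -/
lemma IsGPSample.measure_residual_comb_net (hX : MeasurableSpace.CountablyGenerated X)
    (hgp : IsGPSample ν Q k gp) (hK : ∀ x, k x x ≤ K)
    (hk : IsBoundedKernel k) (h : IsMercerSystem Q k lam ψ) (hψ : ∀ i, Measurable (ψ i))
    (hD : 0 < D) (hb : 0 < b) (hdec : ∀ i : ℕ, lam i ≤ D * ((i : ℝ) + 1) ^ (-(b + 1)))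
    {m r : ℕ} (hr : 1 ≤ r) (hrm : r ≤ m) (hmr : m ≤ 3 * r)
    {N : Finset (EuclideanSpace ℝ (Fin m))} (hN : ∀ v ∈ N, ‖v‖ = 1)
    (hcard : (N.card : ℝ) ≤ 20001 ^ m) :
    (Measure.pi fun _ : Fin m => ν) {ω | ∃ θ ∈ N,
        ENNReal.ofReal (m * (D * (2 / b + 44) * 3 ^ (b + 1) * (m : ℝ) ^ (-(b + 1))))
          < ∫⁻ x, ENNReal.ofReal
            ((∑ j, θ j * (gp (ω j) x - mercerProj Q lam ψ r (gp (ω j)) x)) ^ 2) ∂Q}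
      ≤ ENNReal.ofReal (Real.exp (-m)) := by
  have hr' : (0 : ℝ) < r := by exact_mod_cast hr
  have hm' : (0 : ℝ) < m := hr'.trans_le (by exact_mod_cast hrm)
  set s : ℝ := (r : ℝ) ^ (b + 1) / (4 * D) with hs
  -- twice the expected residual, plus the deviation for which `s * t` exceeds the log-size `10 m`
  -- of the net by `m`
  set t : ℝ := 2 * (D / b * (r : ℝ) ^ (-b)) + 44 * D * m * (r : ℝ) ^ (-(b + 1)) with ht
  have hs0 : 0 < s := by positivity
  have hst : 2 * s * (D / b * (r : ℝ) ^ (-b)) - s * t = -(11 * m) := by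
    have h1 : (r : ℝ) ^ (b + 1) * (r : ℝ) ^ (-(b + 1)) = 1 := by
      rw [← Real.rpow_add hr']; simp
    rw [ht, hs]
    field_simp
    linear_combination (-44 * b * m) * h1
  have hle : t ≤ m * (D * (2 / b + 44) * 3 ^ (b + 1) * (m : ℝ) ^ (-(b + 1))) := by
    have h1 : (r : ℝ) ^ (-b) ≤ m * (r : ℝ) ^ (-(b + 1)) := by
      have : (r : ℝ) ^ (-b) = r * (r : ℝ) ^ (-(b + 1)) := by
        nth_rw 2 [← Real.rpow_one (r : ℝ)]
        rw [← Real.rpow_add hr']; congr 1; ring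
      rw [this]
      gcongr
    have h2 : (r : ℝ) ^ (-(b + 1)) ≤ 3 ^ (b + 1) * (m : ℝ) ^ (-(b + 1)) := by
      have h3 : (m : ℝ) / 3 ≤ r := by
        have : (m : ℝ) ≤ 3 * r := by exact_mod_cast hmr
        linarith
      refine (Real.rpow_le_rpow_of_nonpos (by positivity) h3 (by linarith)).trans (le_of_eq ?_)
      rw [Real.div_rpow hm'.le (by norm_num), Real.rpow_neg (by norm_num : (0:ℝ) ≤ 3),
        div_inv_eq_mul, mul_comm]
    calc t ≤ 2 * (D / b * (m * (r : ℝ) ^ (-(b + 1)))) + 44 * D * m * (r : ℝ) ^ (-(b + 1)) := by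
          rw [ht]; gcongr
      _ = m * (D * (2 / b + 44)) * (r : ℝ) ^ (-(b + 1)) := by ring
      _ ≤ m * (D * (2 / b + 44)) * (3 ^ (b + 1) * (m : ℝ) ^ (-(b + 1))) := by gcongr
      _ = _ := by ring
  have h1 := measure_exists_mem_le (μ := Measure.pi fun _ : Fin m => ν) N (fun θ ω =>
      ENNReal.ofReal t < ∫⁻ x, ENNReal.ofReal
        ((∑ j, θ j * (gp (ω j) x - mercerProj Q lam ψ r (gp (ω j)) x)) ^ 2) ∂Q)
    (hcard.trans (pow_le_exp_mul (x := 10 * m) (by linarith))) (B := -(11 * m)) fun θ hθ => by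
      rw [← hst]
      refine hgp.measure_residual_comb hX hK hk h hψ ?_ hs0.le
        (mul_eigenvalue_le hD hb hdec hr) (sum_eigenvalues_le hD.le hb hdec hr) t
      rw [← EuclideanSpace.real_norm_sq_eq, hN θ hθ, one_pow]
  refine (measure_mono ?_).trans (h1.trans (le_of_eq (by congr 2; ring)))
  rintro ω ⟨θ, hθ, hω⟩
  exact ⟨θ, hθ, (ENNReal.ofReal_le_ofReal hle).trans_lt hω⟩

/-- The total residuals of the sample paths are of the order of their expectations,
simultaneously for all projections. -/
lemma IsGPSample.measure_residual_sum_all (hX : MeasurableSpace.CountablyGenerated X)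
    (hgp : IsGPSample ν Q k gp) (hK : ∀ x, k x x ≤ K)
    (hk : IsBoundedKernel k) (h : IsMercerSystem Q k lam ψ) (hψ : ∀ i, Measurable (ψ i))
    (hD : 0 < D) (hb : 0 < b) (hdec : ∀ i : ℕ, lam i ≤ D * ((i : ℝ) + 1) ^ (-(b + 1)))
    {m : ℕ} (hm : 1 ≤ m) :
    (Measure.pi fun _ : Fin m => ν) {ω | ∃ r : ℕ, 1 ≤ r ∧
        ENNReal.ofReal (m * (D * (2 / b + 4) * (r : ℝ) ^ (-b))) < ∑ j, ∫⁻ x, ENNReal.ofReal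
          ((gp (ω j) x - mercerProj Q lam ψ r (gp (ω j)) x) ^ 2) ∂Q}
      ≤ ENNReal.ofReal (2 * Real.exp (-m)) := by
  have hm' : (1 : ℝ) ≤ m := by exact_mod_cast hm
  -- the failure probability for `r = q + 1` is at most `exp (-m r)`, which is summable
  have hbound : ∀ q : ℕ, (Measure.pi fun _ : Fin m => ν) {ω |
        ENNReal.ofReal (m * (D * (2 / b + 4) * ((q + 1 : ℕ) : ℝ) ^ (-b)))
          < ∑ j, ∫⁻ x, ENNReal.ofReal
            ((gp (ω j) x - mercerProj Q lam ψ (q + 1) (gp (ω j)) x) ^ 2) ∂Q}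
      ≤ ENNReal.ofReal (Real.exp (-m) * Real.exp (-1) ^ q) := by
    intro q
    set r : ℕ := q + 1 with hrdef
    have hr : 1 ≤ r := by omega
    have hr' : (0 : ℝ) < r := by exact_mod_cast hr
    refine (hgp.measure_residual_sum hX hK hk h hψ m (s := (r : ℝ) ^ (b + 1) / (4 * D))
      (by positivity) (mul_eigenvalue_le hD hb hdec hr) (sum_eigenvalues_le hD.le hb hdec hr)
      _).trans (ENNReal.ofReal_le_ofReal ?_)
    rw [← Real.exp_nat_mul, ← Real.exp_add, Real.exp_le_exp]
    have h1 : (r : ℝ) ^ (b + 1) * (r : ℝ) ^ (-b) = r := by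
      rw [← Real.rpow_add hr']; simp
    have h2 : (m : ℝ) * (2 * ((r : ℝ) ^ (b + 1) / (4 * D)) * (D / b * (r : ℝ) ^ (-b)))
        - (r : ℝ) ^ (b + 1) / (4 * D) * (m * (D * (2 / b + 4) * (r : ℝ) ^ (-b)))
        = -(m * ((r : ℝ) ^ (b + 1) * (r : ℝ) ^ (-b))) := by
      field_simp; ring
    rw [h2, h1, hrdef]
    push_cast
    have : (q : ℝ) ≤ m * q := le_mul_of_one_le_left q.cast_nonneg hm'
    linarith
  have h1 : {ω : Fin m → U | ∃ r : ℕ, 1 ≤ r ∧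
        ENNReal.ofReal (m * (D * (2 / b + 4) * (r : ℝ) ^ (-b))) < ∑ j, ∫⁻ x, ENNReal.ofReal
          ((gp (ω j) x - mercerProj Q lam ψ r (gp (ω j)) x) ^ 2) ∂Q}
      ⊆ ⋃ q : ℕ, {ω | ENNReal.ofReal (m * (D * (2 / b + 4) * ((q + 1 : ℕ) : ℝ) ^ (-b)))
        < ∑ j, ∫⁻ x, ENNReal.ofReal
          ((gp (ω j) x - mercerProj Q lam ψ (q + 1) (gp (ω j)) x) ^ 2) ∂Q} := by
    rintro ω ⟨r, hr, hω⟩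
    obtain ⟨q, rfl⟩ : ∃ q, r = q + 1 := ⟨r - 1, by omega⟩
    exact Set.mem_iUnion.2 ⟨q, hω⟩
  refine (measure_mono h1).trans ((measure_iUnion_le _).trans
    ((ENNReal.tsum_le_tsum hbound).trans ?_))
  have he : Real.exp (-1) ≤ 1 / 2 := by
    rw [Real.exp_neg, inv_le_comm₀ (Real.exp_pos _) (by norm_num)]
    linarith [Real.exp_one_gt_d9]
  have hgeo := (summable_geometric_of_lt_one (Real.exp_pos (-1)).le (by linarith)).mul_left
    (Real.exp (-m))
  rw [← ENNReal.ofReal_tsum_of_nonneg (fun q => by positivity) hgeo, tsum_mul_left,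
    tsum_geometric_of_lt_one (Real.exp_pos (-1)).le (by linarith), mul_comm]
  refine ENNReal.ofReal_le_ofReal (mul_le_mul_of_nonneg_right ?_ (Real.exp_pos _).le)
  rw [inv_le_comm₀ (by linarith) (by norm_num)]
  linarith

end Events

/-! ### The critical radius -/

section CriticalRadius

variable {Z : Type*} [MeasurableSpace Z] {P : Measure Z} [IsProbabilityMeasure P]
  {lam : ℕ → ℝ} {φ : ℕ → Z → ℝ} {m : ℕ}

/-- The residuals of the estimates are controlled by those of the sample paths, since `g - Π_r g` is
a contraction of `g`. -/
lemma sum_lintegral_sq_sub_proj_le (h : IsOrthonormalSystem P lam φ)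
    {G Ghat : Fin m → Z → ℝ} (hG : ∀ j, MemLp (G j) 2 P) (hGhat : ∀ j, MemLp (Ghat j) 2 P)
    (r : ℕ) {a c : ℝ} (ha : 0 ≤ a) (hc : 0 ≤ c)
    (herr : ∑ j, ∫⁻ z, ENNReal.ofReal ((Ghat j z - G j z) ^ 2) ∂P ≤ ENNReal.ofReal a)
    (hres : ∑ j, ∫⁻ z, ENNReal.ofReal ((G j z - mercerProj P lam φ r (G j) z) ^ 2) ∂P
      ≤ ENNReal.ofReal c) :
    ∑ j, ∫⁻ z, ENNReal.ofReal ((Ghat j z - mercerProj P lam φ r (Ghat j) z) ^ 2) ∂P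
      ≤ ENNReal.ofReal (2 * a + 2 * c) := by
  have hj : ∀ j, ∫⁻ z, ENNReal.ofReal ((Ghat j z - mercerProj P lam φ r (Ghat j) z) ^ 2) ∂P
      ≤ 2 * ∫⁻ z, ENNReal.ofReal ((Ghat j z - G j z) ^ 2) ∂P
        + 2 * ∫⁻ z, ENNReal.ofReal ((G j z - mercerProj P lam φ r (G j) z) ^ 2) ∂P := by
    intro j
    set d : Z → ℝ := fun z => Ghat j z - G j z with hd
    have hdm : MemLp d 2 P := (hGhat j).sub (hG j)
    have hproj : ∀ z, mercerProj P lam φ r d z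
        = mercerProj P lam φ r (Ghat j) z - mercerProj P lam φ r (G j) z := fun z => by
      have h1 := h.mercerProj_sum r (s := Finset.univ) ![1, -1] (g := ![Ghat j, G j])
        (fun i _ => by fin_cases i; exacts [hGhat j, hG j]) z
      simp only [Fin.sum_univ_two, Matrix.cons_val_zero, Matrix.cons_val_one, one_mul,
        neg_mul, ← sub_eq_add_neg] at h1
      exact h1
    have h1 : ∫⁻ z, ENNReal.ofReal ((d z - mercerProj P lam φ r d z) ^ 2) ∂P
        ≤ ∫⁻ z, ENNReal.ofReal (d z ^ 2) ∂P := by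
      rw [← ofReal_integral_eq_lintegral_ofReal hdm.integrable_sq
          (Eventually.of_forall fun x => by positivity),
        ← ofReal_integral_eq_lintegral_ofReal (f := fun z => (d z - mercerProj P lam φ r d z) ^ 2)
          (hdm.sub (h.memLp_proj r d)).integrable_sq
          (Eventually.of_forall fun x => by positivity)]
      exact ENNReal.ofReal_le_ofReal (h.integral_sq_sub_proj_le hdm r)
    refine le_trans ?_ (add_le_add_left (mul_le_mul_right h1 2) _)
    rw [← lintegral_const_mul' _ _ ENNReal.ofNat_ne_top,
      ← lintegral_const_mul' _ _ ENNReal.ofNat_ne_top, ← lintegral_add_left']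
    · refine lintegral_mono fun z => ?_
      rw [show (2 : ℝ≥0∞) = ENNReal.ofReal 2 by norm_num, ← ENNReal.ofReal_mul (by norm_num),
        ← ENNReal.ofReal_mul (by norm_num), ← ENNReal.ofReal_add (by positivity) (by positivity)]
      refine ENNReal.ofReal_le_ofReal ?_
      rw [hproj, hd]
      nlinarith [sq_nonneg ((Ghat j z - G j z - (mercerProj P lam φ r (Ghat j) z
        - mercerProj P lam φ r (G j) z)) - (G j z - mercerProj P lam φ r (G j) z))]
    · exact (((hdm.sub (h.memLp_proj r d)).1.aemeasurable.pow_const 2).ennreal_ofReal).const_mul 2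
  refine (Finset.sum_le_sum fun j _ => hj j).trans ?_
  rw [Finset.sum_add_distrib, ← Finset.mul_sum, ← Finset.mul_sum,
    ENNReal.ofReal_add (by positivity) (by positivity), ENNReal.ofReal_mul (by norm_num),
    ENNReal.ofReal_mul (by norm_num), ENNReal.ofReal_ofNat]
  gcongr

/-- The dimension `r ≈ n ^ (1 / (b + 2))` balances `r / n` and `r ^ (-b) / n` against the second and
fourth powers of the rate. -/
lemma exists_split_dimension {n : ℕ} (hn : 1 ≤ n) {b : ℝ} (hb : 0 < b) :
    ∃ r : ℕ, 1 ≤ r ∧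
      (r : ℝ) / n ≤ 2 * ((n : ℝ) ^ (-((b + 1) / (2 * (b + 2))))) ^ 2 ∧
      (r : ℝ) ^ (-b) * (n : ℝ)⁻¹ ≤ ((n : ℝ) ^ (-((b + 1) / (2 * (b + 2))))) ^ 4 ∧
      (n : ℝ)⁻¹ ≤ ((n : ℝ) ^ (-((b + 1) / (2 * (b + 2))))) ^ 2 := by
  have hn' : (1 : ℝ) ≤ n := by exact_mod_cast hn
  have hn0 : (0 : ℝ) < n := by linarith
  have hρ2 : ((n : ℝ) ^ (-((b + 1) / (2 * (b + 2))))) ^ 2 = (n : ℝ) ^ (-((b + 1) / (b + 2))) := by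
    rw [← Real.rpow_natCast, ← Real.rpow_mul hn0.le]
    congr 1; push_cast; field_simp
  have hρ4 : ((n : ℝ) ^ (-((b + 1) / (2 * (b + 2))))) ^ 4
      = (n : ℝ) ^ (-(b / (b + 2))) * (n : ℝ)⁻¹ := by
    rw [← Real.rpow_natCast, ← Real.rpow_mul hn0.le, ← Real.rpow_neg_one,
      ← Real.rpow_add hn0]
    congr 1; push_cast; field_simp; ring
  have hx1 : 1 ≤ (n : ℝ) ^ (1 / (b + 2)) := Real.one_le_rpow hn' (by positivity)
  have hxr : (n : ℝ) ^ (1 / (b + 2)) ≤ (⌈(n : ℝ) ^ (1 / (b + 2))⌉₊ : ℝ) := Nat.le_ceil _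
  have hrle : (⌈(n : ℝ) ^ (1 / (b + 2))⌉₊ : ℝ) ≤ 2 * (n : ℝ) ^ (1 / (b + 2)) := by
    have := (Nat.ceil_lt_add_one (by positivity : 0 ≤ (n : ℝ) ^ (1 / (b + 2)))).le
    linarith
  generalize ⌈(n : ℝ) ^ (1 / (b + 2))⌉₊ = r at hxr hrle
  refine ⟨r, by exact_mod_cast hx1.trans hxr, ?_, ?_, ?_⟩
  · rw [div_le_iff₀ hn0]
    refine hrle.trans (le_of_eq ?_)
    rw [hρ2, mul_assoc]
    congr 1
    nth_rw 3 [← Real.rpow_one (n : ℝ)]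
    rw [← Real.rpow_add hn0]
    congr 1; field_simp; ring
  · rw [hρ4]
    refine mul_le_mul_of_nonneg_right ?_ (by positivity)
    refine (Real.rpow_le_rpow_of_nonpos (by positivity) hxr (by linarith)).trans (le_of_eq ?_)
    rw [← Real.rpow_mul hn0.le]
    congr 1; field_simp
  · rw [hρ2, ← Real.rpow_neg_one]
    refine Real.rpow_le_rpow_of_exponent_le hn' ?_
    rw [neg_le_neg_iff, div_le_one (by linarith)]
    linarith

/-- The arithmetic of the critical inequality for `δ = (8 + 8 c) √L (ρ + β)`: here `x` stands for
`r / n` and `y` for the tail of the learned space divided by `n`. -/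
lemma critical_inequality {ρ β c L δ x y : ℝ} (hρ : 0 < ρ) (hβ : 0 ≤ β) (hc : 0 ≤ c)
    (hL : 1 ≤ L) (hδ : δ = (8 + 8 * c) * √L * (ρ + β)) (hx : x ≤ 2 * ρ ^ 2)
    (hy : y ≤ 2 * L * β ^ 2 * ρ ^ 2 + 2 * c * ρ ^ 4) :
    δ ^ 2 / 2 + x + y / δ ^ 2 ≤ δ ^ 2 := by
  have hδ2 : δ ^ 2 = 64 * (1 + c) ^ 2 * L * (ρ + β) ^ 2 := by
    rw [hδ, mul_pow, mul_pow, Real.sq_sqrt (by linarith)]; ring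
  have hρβ : ρ ^ 2 ≤ (ρ + β) ^ 2 := pow_le_pow_left₀ hρ.le (by linarith) 2
  have hββ : β ^ 2 ≤ (ρ + β) ^ 2 := pow_le_pow_left₀ hβ (by linarith) 2
  have hs0 : 0 < (ρ + β) ^ 2 := by positivity
  have h4 : ρ ^ 4 = ρ ^ 2 * ρ ^ 2 := by ring
  rw [h4] at hy
  generalize (ρ + β) ^ 2 = s at hδ2 hρβ hββ hs0
  have hA : 64 * ((1 + c) * (L * s)) ≤ δ ^ 2 := by
    have h : (1 + c) * (L * s) ≤ (1 + c) * ((1 + c) * (L * s)) :=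
      le_mul_of_one_le_left (by positivity) (by linarith)
    rw [hδ2]; linarith
  have hLs : s ≤ L * s := le_mul_of_one_le_left hs0.le hL
  have hcs : L * s ≤ (1 + c) * (L * s) := le_mul_of_one_le_left (by positivity) (by linarith)
  have hδ0 : 0 < δ ^ 2 := by linarith
  have hy' : y ≤ 2 * ((1 + c) * (L * s)) * s := by
    have h1 : L * β ^ 2 * ρ ^ 2 ≤ L * s * s :=
      mul_le_mul (mul_le_mul_of_nonneg_left hββ (by linarith)) hρβ (by positivity) (by positivity)
    have h2 : c * (ρ ^ 2 * ρ ^ 2) ≤ c * (L * s * s) :=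
      mul_le_mul_of_nonneg_left (mul_le_mul (hρβ.trans hLs) hρβ (by positivity) (by positivity)) hc
    nlinarith
  have h5 : y / δ ^ 2 ≤ s := by
    rw [div_le_iff₀ hδ0]
    refine hy'.trans ?_
    rw [mul_comm s]
    exact mul_le_mul_of_nonneg_right (by linarith) hs0.le
  linarith

/-- The critical radius, from the choice `r ≈ n ^ (1 / (b + 2))` of the dimension of the split. -/
lemma criticalRadius_le (h : IsOrthonormalSystem P lam φ) (hφ : ∀ i, Measurable (φ i))
    (hm : 0 < m) {Ghat : Fin m → Z → ℝ} (hGm : ∀ j, Measurable (Ghat j))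
    (hGhat : ∀ j, MemLp (Ghat j) 2 P) {b c L β : ℝ} (hb : 0 < b) (hc : 0 ≤ c) (hL : 1 ≤ L)
    (hβ : 0 ≤ β)
    (htail : ∀ r : ℕ, 1 ≤ r →
      ∑ j, ∫⁻ z, ENNReal.ofReal ((Ghat j z - mercerProj P lam φ r (Ghat j) z) ^ 2) ∂P
        ≤ ENNReal.ofReal (m * (2 * (L * β ^ 2) + 2 * (c * (r : ℝ) ^ (-b)))))
    {n : ℕ} (hn : 1 ≤ n) :
    criticalRadius P n (learnedBall Ghat 1) ≤ ENNReal.ofReal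
      ((8 + 8 * c) * √L * ((n : ℝ) ^ (-((b + 1) / (2 * (b + 2)))) + β)) := by
  have hn0 : (0 : ℝ) < n := by exact_mod_cast hn
  obtain ⟨r, hr1, hrn, hrb, hninv⟩ := exists_split_dimension hn hb
  have hρ : 0 < (n : ℝ) ^ (-((b + 1) / (2 * (b + 2)))) := by positivity
  generalize (n : ℝ) ^ (-((b + 1) / (2 * (b + 2)))) = ρ at hrn hrb hninv hρ
  have hL0 : 0 < √L := Real.sqrt_pos.2 (by linarith)
  obtain ⟨δ, hδ⟩ : ∃ δ, δ = (8 + 8 * c) * √L * (ρ + β) := ⟨_, rfl⟩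
  have hδ0 : 0 < δ := by rw [hδ]; positivity
  rw [← hδ]
  have ht := htail r hr1
  obtain ⟨T, hT⟩ : ∃ T, T = 2 * (L * β ^ 2) + 2 * (c * (r : ℝ) ^ (-b)) := ⟨_, rfl⟩
  have hT0 : 0 ≤ T := by rw [hT]; positivity
  rw [← hT] at ht
  have hTn : T / n ≤ 2 * L * β ^ 2 * ρ ^ 2 + 2 * c * ρ ^ 4 := by
    have h1 : 2 * (L * β ^ 2) * (n : ℝ)⁻¹ ≤ 2 * (L * β ^ 2) * ρ ^ 2 :=
      mul_le_mul_of_nonneg_left hninv (by positivity)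
    have h2 : 2 * c * ((r : ℝ) ^ (-b) * (n : ℝ)⁻¹) ≤ 2 * c * ρ ^ 4 :=
      mul_le_mul_of_nonneg_left hrb (by positivity)
    rw [hT, div_eq_mul_inv]
    linarith
  refine iInf₂_le_of_le δ ⟨hδ0, ?_⟩ le_rfl
  refine (localRademacher_le h hφ hm hGm hGhat (by omega) hδ0 hT0 ht).trans
    (ENNReal.ofReal_le_ofReal ?_)
  have h5 := critical_inequality hρ hβ hc hL hδ hrn hTn
  rw [div_div] at h5
  linarith

end CriticalRadius

/-! ### The good event and its consequences -/

section Event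

/-- A finite `1/10000`-net of the unit sphere. -/
def sphereNet (E : Type*) [NormedAddCommGroup E] [NormedSpace ℝ E] [FiniteDimensional ℝ E] :
    Finset E :=
  (exists_sphere_net E (ε := 1 / 10000) (by norm_num)).choose

lemma sphereNet_spec (E : Type*) [NormedAddCommGroup E] [NormedSpace ℝ E]
    [FiniteDimensional ℝ E] :
    (∀ x ∈ sphereNet E, ‖x‖ = 1) ∧ (∀ x : E, ‖x‖ = 1 → ∃ y ∈ sphereNet E, ‖x - y‖ ≤ 1 / 10000) ∧
      ((sphereNet E).card : ℝ) ≤ 20001 ^ Module.finrank ℝ E := by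
  have h := (exists_sphere_net E (ε := 1 / 10000) (by norm_num)).choose_spec
  exact ⟨h.1, h.2.1, h.2.2.trans_eq (by norm_num)⟩

/-- The indices of the nonzero eigenvalues among the first `r`. -/
def activeIndices (lam : ℕ → ℝ) (r : ℕ) : Finset ℕ := {i ∈ Finset.range r | lam i ≠ 0}

/-- The squared norm of the combination with coefficients `v` of the rows of the matrix of
whitened coefficients `λ_i^{-1/2} ⟨φ i, G j⟩`. -/
def whitenedSq {Z : Type*} [MeasurableSpace Z] (P : Measure Z) (lam : ℕ → ℝ) (φ : ℕ → Z → ℝ)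
    {m : ℕ} (I : Finset ℕ) (v : EuclideanSpace ℝ I) (G : Fin m → Z → ℝ) : ℝ :=
  ∑ j, (∑ i : I, v i * ((∫ z, φ i z * G j z ∂P) / √(lam i))) ^ 2

/-- The event on which the guarantees hold: the sample paths `G` are square integrable, the
estimates `Ghat` are close to them on average, the matrix of whitened coefficients is
well-conditioned on a net, and the residuals `G j - Π_r G j` are small, in operator norm on a
net for `r = ⌊m / 2⌋` and in mean square for every `r`. The lower bounds for `m` and for `L`, which
stands for `log n₁`, make the event empty for small sample sizes. -/
structure IsGoodSample {Z : Type*} [MeasurableSpace Z] (P : Measure Z) (lam : ℕ → ℝ)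
    (φ : ℕ → Z → ℝ) (b D ξ L : ℝ) {m : ℕ} (G Ghat : Fin m → Z → ℝ) : Prop where
  two_le : 2 ≤ m
  one_le : 1 ≤ L
  le_log : 4 * (D * (2 / b + 44) * 3 ^ (b + 1)) ≤ L
  sq_lt_top : ∀ j, ∫⁻ z, ENNReal.ofReal (G j z ^ 2) ∂P < ∞
  estimate : ∑ j, ∫⁻ z, ENNReal.ofReal ((Ghat j z - G j z) ^ 2) ∂P
    ≤ ENNReal.ofReal (m * (L * (ξ ^ 2 + (m : ℝ) ^ (-(b + 1)))))
  wellConditioned : ∀ v ∈ sphereNet (EuclideanSpace ℝ (activeIndices lam (m / 2))),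
    (m : ℝ) / 250000 ≤ whitenedSq P lam φ (activeIndices lam (m / 2)) v G ∧
      whitenedSq P lam φ (activeIndices lam (m / 2)) v G ≤ 36 * m
  residual_comb : ∀ θ ∈ sphereNet (EuclideanSpace ℝ (Fin m)),
    ∫⁻ z, ENNReal.ofReal ((∑ j, θ j * (G j z - mercerProj P lam φ (m / 2) (G j) z)) ^ 2) ∂P
      ≤ ENNReal.ofReal (m * (D * (2 / b + 44) * 3 ^ (b + 1) * (m : ℝ) ^ (-(b + 1))))
  residual_sum : ∀ r : ℕ, 1 ≤ r →
    ∑ j, ∫⁻ z, ENNReal.ofReal ((G j z - mercerProj P lam φ r (G j) z) ^ 2) ∂P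
      ≤ ENNReal.ofReal (m * (D * (2 / b + 4) * (r : ℝ) ^ (-b)))

variable {Z : Type*} [MeasurableSpace Z] {P : Measure Z} [IsProbabilityMeasure P]
  {lam : ℕ → ℝ} {φ : ℕ → Z → ℝ} {m : ℕ} {b D ξ : ℝ} {G Ghat : Fin m → Z → ℝ}

lemma rpow_half_sq {x : ℝ} (hx : 0 ≤ x) (b : ℝ) : (x ^ (-((b + 1) / 2))) ^ 2 = x ^ (-(b + 1)) := by
  rw [← Real.rpow_natCast, ← Real.rpow_mul hx]; congr 1; push_cast; ring

lemma IsGoodSample.memLp {L : ℝ} (hs : IsGoodSample P lam φ b D ξ L G Ghat)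
    (hG : ∀ j, Measurable (G j)) (j : Fin m) : MemLp (G j) 2 P := by
  refine ⟨(hG j).aestronglyMeasurable, ?_⟩
  have h1 := hs.sq_lt_top j
  rw [← eLpNorm_two_sq] at h1
  rw [lt_top_iff_ne_top] at h1 ⊢
  intro h2
  simp [h2] at h1

lemma IsGoodSample.sq_le {L : ℝ} (hs : IsGoodSample P lam φ b D ξ L G Ghat) (hξ : 0 ≤ ξ) :
    L * (ξ ^ 2 + (m : ℝ) ^ (-(b + 1))) ≤ L * (ξ + (m : ℝ) ^ (-((b + 1) / 2))) ^ 2 := by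
  have h1 : 0 ≤ (m : ℝ) ^ (-((b + 1) / 2)) := by positivity
  rw [← rpow_half_sq m.cast_nonneg]
  refine mul_le_mul_of_nonneg_left ?_ (by linarith [hs.one_le])
  nlinarith [mul_nonneg hξ h1]

lemma IsGoodSample.approximationBound {n : ℕ} (hs : IsGoodSample P lam φ b D ξ (Real.log n) G Ghat)
    (h : IsOrthonormalSystem P lam φ) (hlam : ∀ i, 0 ≤ lam i) (hb : 0 < b) (hD : 0 < D)
    (hξ : 0 ≤ ξ) (hG : ∀ j, Measurable (G j)) (hGhat : ∀ j, MemLp (Ghat j) 2 P) :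
    ApproximationBound P lam φ b 2000 ξ n Ghat := by
  intro g hg
  set L := Real.log n with hL
  have hm : 0 < m := by have := hs.two_le; omega
  have hL1 := hs.one_le
  obtain ⟨-, hN, -⟩ := sphereNet_spec (EuclideanSpace ℝ (activeIndices lam (m / 2)))
  obtain ⟨-, hN', -⟩ := sphereNet_spec (EuclideanSpace ℝ (Fin m))
  set q : ℝ := (m : ℝ) ^ (-((b + 1) / 2)) with hq
  have hq0 : 0 ≤ q := by positivity
  set c3 : ℝ := D * (2 / b + 44) * 3 ^ (b + 1) with hc3
  have hc30 : 0 ≤ c3 := by positivity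
  have hLsq : √L ^ 2 = L := Real.sq_sqrt (by linarith)
  obtain ⟨f, hf, hfg⟩ := exists_mem_learnedBall h hlam hm (r := m / 2) (hs.memLp hG) hGhat rfl hN
    hs.wellConditioned hN' (ρ := √c3 * q) (τ := √L * (ξ + q)) (by positivity) (by positivity)
    (fun θ hθ => by
      rw [mul_pow, Real.sq_sqrt hc30, hq, rpow_half_sq m.cast_nonneg]
      exact hs.residual_comb θ hθ)
    (hs.estimate.trans (ENNReal.ofReal_le_ofReal (by
      rw [mul_pow, hLsq]
      exact mul_le_mul_of_nonneg_left (hs.sq_le hξ) m.cast_nonneg))) hg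
  set p := mercerProjNorm P lam φ (m / 2) g with hp
  have hp0 : 0 ≤ p := Real.sqrt_nonneg _
  refine ⟨f, ?_, hfg.trans ?_⟩
  · obtain ⟨θ, hθ, rfl⟩ := hf
    exact ⟨θ, by linarith, rfl⟩
  · gcongr ENNReal.ofReal ?_ + _
    -- the residuals of the sample paths are absorbed into the logarithmic factor, so that the
    -- constant is universal
    have h1 : 2 * √c3 ≤ √L := by
      refine Real.le_sqrt_of_sq_le ?_
      rw [mul_pow, Real.sq_sqrt hc30]
      linarith [hs.le_log]
    have h2 : √L * (ξ + q) + 2 * (√c3 * q) ≤ 2 * ((ξ + q) * √L) := by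
      have h3 := mul_le_mul_of_nonneg_right h1 hq0
      have h4 : 0 ≤ √L * ξ := by positivity
      linarith
    calc 1000 * p * (√L * (ξ + q) + 2 * (√c3 * q)) ≤ 1000 * p * (2 * ((ξ + q) * √L)) := by gcongr
      _ = _ := by ring

lemma IsGoodSample.criticalRadius_le {L : ℝ} (hs : IsGoodSample P lam φ b D ξ L G Ghat)
    (h : IsOrthonormalSystem P lam φ) (hφ : ∀ i, Measurable (φ i)) (hb : 0 < b) (hD : 0 < D)
    (hξ : 0 ≤ ξ) (hG : ∀ j, Measurable (G j)) (hGm : ∀ j, Measurable (Ghat j))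
    (hGhat : ∀ j, MemLp (Ghat j) 2 P) {n : ℕ} (hn : 1 ≤ n) :
    criticalRadius P n (learnedBall Ghat 1) ≤ ENNReal.ofReal
      ((8 + 8 * (D * (2 / b + 4))) * √L * ((n : ℝ) ^ (-((b + 1) / (2 * (b + 2))))
        + (m : ℝ) ^ (-((b + 1) / 2)) + ξ)) := by
  have hm : 0 < m := by have := hs.two_le; omega
  have hL1 := hs.one_le
  refine (KernelLearning.criticalRadius_le h hφ hm hGm hGhat (L := L)
    (β := ξ + (m : ℝ) ^ (-((b + 1) / 2))) (c := D * (2 / b + 4)) hb (by positivity) hL1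
    (by positivity) (fun r hr => ?_) hn).trans (le_of_eq (by congr 2; ring))
  refine (sum_lintegral_sq_sub_proj_le h (hs.memLp hG) hGhat r (by positivity) (by positivity)
    hs.estimate (hs.residual_sum r hr)).trans (ENNReal.ofReal_le_ofReal ?_)
  have := mul_le_mul_of_nonneg_left (hs.sq_le hξ) (m.cast_nonneg (α := ℝ))
  linarith

end Event

/-! ### Changing the eigenfunctions on null sets -/

section Congr

variable {X : Type*} [MeasurableSpace X] {Q : Measure X} {k : X → X → ℝ} {lam : ℕ → ℝ}
  {ψ ψ' : ℕ → X → ℝ}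

lemma IsMercerSystem.congr (h : IsMercerSystem Q k lam ψ)
    (hψ : ∀ i, lam i ≠ 0 → ψ' i =ᵐ[Q] ψ i) : IsMercerSystem Q k lam ψ' where
  antitone := h.antitone
  nonneg := h.nonneg
  memLp i hi := (memLp_congr_ae (hψ i hi)).2 (h.memLp i hi)
  orthonormal i j hi hj := by
    rw [← h.orthonormal i j hi hj]
    exact integral_congr_ae ((hψ i hi).mul (hψ j hj))
  eigen i hi := by
    filter_upwards [h.eigen i hi, hψ i hi] with x h1 h2
    rw [h2, ← h1]
    refine integral_congr_ae ?_
    filter_upwards [hψ i hi] with y hy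
    rw [hy]
  complete f hf hf0 := by
    refine h.complete f hf fun i hi => ?_
    rw [← hf0 i hi]
    refine integral_congr_ae ?_
    filter_upwards [hψ i hi] with y hy
    rw [hy]

/-- Measurable versions of the eigenfunctions; those with eigenvalue zero, which are arbitrary
functions, are not kept. -/
lemma IsMercerSystem.exists_measurable (h : IsMercerSystem Q k lam ψ) :
    ∃ ψ' : ℕ → X → ℝ, (∀ i, Measurable (ψ' i)) ∧ ∀ i, lam i ≠ 0 → ψ' i =ᵐ[Q] ψ i := by
  have : ∀ i, ∃ f : X → ℝ, Measurable f ∧ (lam i ≠ 0 → f =ᵐ[Q] ψ i) := fun i => by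
    by_cases hi : lam i = 0
    · exact ⟨0, measurable_zero, fun h0 => absurd hi h0⟩
    · exact ⟨(h.memLp i hi).1.mk _, (h.memLp i hi).1.stronglyMeasurable_mk.measurable,
        fun _ => (h.memLp i hi).1.ae_eq_mk.symm⟩
  choose f hf hf' using this
  exact ⟨f, hf, hf'⟩

lemma ApproximationBound.congr {φ φ' : ℕ → X → ℝ} {b c ξ : ℝ} {n m : ℕ} {G : Fin m → X → ℝ}
    (h : ApproximationBound Q lam φ' b c ξ n G) (hφ : ∀ i, lam i ≠ 0 → φ' i =ᵐ[Q] φ i) :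
    ApproximationBound Q lam φ b c ξ n G := by
  intro g hg
  have hint : ∀ i, lam i ≠ 0 → ∫ x, φ' i x * g x ∂Q = ∫ x, φ i x * g x ∂Q := fun i hi => by
    refine integral_congr_ae ?_
    filter_upwards [hφ i hi] with y hy
    rw [hy]
  have h1 : mercerProjNorm Q lam φ' (m / 2) g = mercerProjNorm Q lam φ (m / 2) g := by
    unfold mercerProjNorm
    congr 1
    exact Finset.sum_congr rfl fun i hi => by rw [hint i (Finset.mem_filter.1 hi).2]
  have h2 : mercerProj Q lam φ' (m / 2) g =ᵐ[Q] mercerProj Q lam φ (m / 2) g := by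
    have : ∀ᵐ x ∂Q, ∀ i ∈ (Finset.range (m / 2)).filter (fun i => lam i ≠ 0), φ' i x = φ i x :=
      (Finset.eventually_all _).2 fun i hi => hφ i (Finset.mem_filter.1 hi).2
    filter_upwards [this] with x hx
    exact Finset.sum_congr rfl fun i hi => by rw [hint i (Finset.mem_filter.1 hi).2, hx i hi]
  have h3 := h g hg
  rwa [h1, eLpNorm_congr_ae ((EventuallyEq.refl _ g).sub h2)] at h3

end Congr

/-! ### From the feature space to the input space -/

section Transfer

variable {Z X : Type*} [MeasurableSpace Z] [MeasurableSpace X] {P : Measure Z} {Φ : Z → X}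
  {lam : ℕ → ℝ} {ψ : ℕ → X → ℝ}

lemma integral_comp_mul_comp (hΦ : Measurable Φ) {f g : X → ℝ} (hf : Measurable f)
    (hg : Measurable g) : ∫ z, f (Φ z) * g (Φ z) ∂P = ∫ x, f x * g x ∂(P.map Φ) :=
  (integral_map (f := fun x => f x * g x) hΦ.aemeasurable (hf.mul hg).aestronglyMeasurable).symm

lemma IsOrthonormalSystem.comp (h : IsOrthonormalSystem (P.map Φ) lam ψ) (hΦ : Measurable Φ)
    (hψ : ∀ i, Measurable (ψ i)) : IsOrthonormalSystem P lam fun i z => ψ i (Φ z) where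
  memLp i hi := (h.memLp i hi).comp_of_map hΦ.aemeasurable
  orthonormal i j hi hj := by
    rw [integral_comp_mul_comp hΦ (hψ i) (hψ j), h.orthonormal i j hi hj]

lemma mercerProj_comp (hΦ : Measurable Φ) (hψ : ∀ i, Measurable (ψ i)) {g : X → ℝ}
    (hg : Measurable g) (r : ℕ) (z : Z) :
    mercerProj P lam (fun i z => ψ i (Φ z)) r (fun z => g (Φ z)) z
      = mercerProj (P.map Φ) lam ψ r g (Φ z) :=
  Finset.sum_congr rfl fun i _ => by rw [integral_comp_mul_comp hΦ (hψ i) hg]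

end Transfer

/-! ### Measurability and probability of the good event -/

section Probability

variable {Z X U W : Type*} [MeasurableSpace Z] [MeasurableSpace X] [MeasurableSpace U]
  [MeasurableSpace W] {P : Measure Z} [IsProbabilityMeasure P] {Φ : Z → X} {ν : Measure U}
  [IsProbabilityMeasure ν] {gp : U → X → ℝ} {κ : Kernel Z W} [IsMarkovKernel κ]
  {A : (n : ℕ) → (Fin n → Z × ℝ) → Z → ℝ} {ξ : ℕ → ℝ} {k : X → X → ℝ} {K Ck b D : ℝ}
  {η : ℕ → U → Z → W → ℝ} {lam : ℕ → ℝ} {ψ : ℕ → X → ℝ} {Q : Measure X} [IsProbabilityMeasure Q]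

lemma IsGPSample.measurable_path (hgp : IsGPSample ν Q k gp) (u : U) : Measurable (gp u) :=
  hgp.measurable.comp (measurable_const.prodMk measurable_id)

lemma IsGPSample.measurable_residual (hgp : IsGPSample ν Q k gp) (hψ : ∀ i, Measurable (ψ i))
    (r : ℕ) {m : ℕ} (j : Fin m) : Measurable fun p : (Fin m → U) × X =>
      gp (p.1 j) p.2 - mercerProj Q lam ψ r (gp (p.1 j)) p.2 := by
  have hj : Measurable fun p : (Fin m → U) × X => p.1 j := by fun_prop
  refine (hgp.measurable.comp (hj.prodMk measurable_snd)).sub ?_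
  exact Finset.measurable_sum _ fun i _ =>
    ((hgp.measurable_coef (hψ i)).comp hj).mul ((hψ i).comp measurable_snd)

lemma IsGPSample.measurable_whitened (hgp : IsGPSample ν Q k gp) (hψ : ∀ i, Measurable (ψ i))
    {m : ℕ} {I : Finset ℕ} (v : EuclideanSpace ℝ I) : Measurable fun ω : Fin m → U =>
      ∑ j, (∑ i : I, v i * (coef Q gp (ψ i) (ω j) / √(lam i))) ^ 2 := by
  have := fun i => hgp.measurable_coef (hψ i)
  fun_prop

lemma measurable_truncEstimates (hΦ : Measurable Φ) (hgp : IsGPSample ν Q k gp)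
    (hη : ∀ j, IsNoise P Φ ν gp κ (η j)) (hA : IsRegressionOracle P Φ ν gp κ A ξ) {m n : ℕ}
    (j : Fin m) : Measurable fun p : ((Fin m → U) × (Fin n → Z × W)) × Z =>
      truncEstimates A Ck (dataset Φ gp η p.1) j p.2 := by
  have h1 := measurable_estimate hΦ hgp.measurable hA.measurable (hη j).measurable n
  have h2 : Measurable fun p : ((Fin m → U) × (Fin n → Z × W)) × Z =>
      (((p.1.1 j, p.1.2), p.2) : (U × (Fin n → Z × W)) × Z) := by fun_prop
  exact (measurable_clip _).comp (h1.comp h2)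

lemma memLp_truncEstimates (hΦ : Measurable Φ) (hgp : IsGPSample ν Q k gp)
    (hη : ∀ j, IsNoise P Φ ν gp κ (η j)) (hA : IsRegressionOracle P Φ ν gp κ A ξ) (hCk : 0 < Ck)
    {m n : ℕ} (ω : (Fin m → U) × (Fin n → Z × W)) (j : Fin m) :
    MemLp (truncEstimates A Ck (dataset Φ gp η ω) j) 2 P := by
  have hm : Measurable (truncEstimates A Ck (dataset Φ gp η ω) j) :=
    (measurable_truncEstimates hΦ hgp hη hA j).comp (measurable_const.prodMk measurable_id)
  refine MemLp.of_bound hm.aestronglyMeasurable (Ck * Real.log n)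
    (Eventually.of_forall fun z => ?_)
  have hT : 0 ≤ Ck * Real.log n := mul_nonneg hCk.le (Real.log_natCast_nonneg n)
  exact abs_le.2 ⟨le_max_left _ _, max_le (by linarith) (min_le_left _ _)⟩

lemma measurable_sum_sq_truncEstimates (hΦ : Measurable Φ) (hgp : IsGPSample ν Q k gp)
    (hη : ∀ j, IsNoise P Φ ν gp κ (η j)) (hA : IsRegressionOracle P Φ ν gp κ A ξ) (m n : ℕ) :
    Measurable fun ω : (Fin m → U) × (Fin n → Z × W) => ∑ j, ∫⁻ z,
      ENNReal.ofReal ((truncEstimates A Ck (dataset Φ gp η ω) j z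
        - gpPaths Φ gp ω j z) ^ 2) ∂P := by
  refine Finset.measurable_sum _ fun j _ => Measurable.lintegral_prod_right' (f := fun p =>
    ENNReal.ofReal ((truncEstimates A Ck (dataset Φ gp η p.1) j p.2
      - gpPaths Φ gp p.1 j p.2) ^ 2)) ?_
  have hj : Measurable fun p : ((Fin m → U) × (Fin n → Z × W)) × Z => p.1.1 j := by fun_prop
  have h1 : Measurable fun p : ((Fin m → U) × (Fin n → Z × W)) × Z =>
      gpPaths Φ gp p.1 j p.2 :=
    hgp.measurable.comp (hj.prodMk (hΦ.comp measurable_snd))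
  exact (((measurable_truncEstimates hΦ hgp hη hA j).sub h1).pow_const 2).ennreal_ofReal

/-- The good event, with all conditions on the sample paths transferred to the feature space. -/
lemma isGoodSample_iff (hΦ : Measurable Φ) (hgp : IsGPSample ν (P.map Φ) k gp)
    (hψ : ∀ i, Measurable (ψ i)) {m n : ℕ} (ω : (Fin m → U) × (Fin n → Z × W)) {ξ L : ℝ}
    {Ghat : Fin m → Z → ℝ} :
    IsGoodSample P lam (fun i z => ψ i (Φ z)) b D ξ L (gpPaths Φ gp ω) Ghat ↔
      (2 ≤ m ∧ 1 ≤ L ∧ 4 * (D * (2 / b + 44) * 3 ^ (b + 1)) ≤ L) ∧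
      (∀ j, ∫⁻ x, ENNReal.ofReal (gp (ω.1 j) x ^ 2) ∂(P.map Φ) < ∞) ∧
      (∑ j, ∫⁻ z, ENNReal.ofReal ((Ghat j z - gpPaths Φ gp ω j z) ^ 2) ∂P
        ≤ ENNReal.ofReal (m * (L * (ξ ^ 2 + (m : ℝ) ^ (-(b + 1)))))) ∧
      (∀ v ∈ sphereNet (EuclideanSpace ℝ (activeIndices lam (m / 2))), (m : ℝ) / 250000
        ≤ ∑ j, (∑ i : activeIndices lam (m / 2),
          v i * (coef (P.map Φ) gp (ψ i) (ω.1 j) / √(lam i))) ^ 2 ∧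
        ∑ j, (∑ i : activeIndices lam (m / 2),
          v i * (coef (P.map Φ) gp (ψ i) (ω.1 j) / √(lam i))) ^ 2 ≤ 36 * m) ∧
      (∀ θ ∈ sphereNet (EuclideanSpace ℝ (Fin m)), ∫⁻ x, ENNReal.ofReal
        ((∑ j, θ j * (gp (ω.1 j) x - mercerProj (P.map Φ) lam ψ (m / 2) (gp (ω.1 j)) x)) ^ 2)
          ∂(P.map Φ)
        ≤ ENNReal.ofReal (m * (D * (2 / b + 44) * 3 ^ (b + 1) * (m : ℝ) ^ (-(b + 1))))) ∧
      (∀ r : ℕ, 1 ≤ r → ∑ j, ∫⁻ x, ENNReal.ofReal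
        ((gp (ω.1 j) x - mercerProj (P.map Φ) lam ψ r (gp (ω.1 j)) x) ^ 2) ∂(P.map Φ)
        ≤ ENNReal.ofReal (m * (D * (2 / b + 4) * (r : ℝ) ^ (-b)))) := by
  have := Measure.isProbabilityMeasure_map (μ := P) hΦ.aemeasurable
  have hg := fun u => hgp.measurable_path u
  have hproj : ∀ r j z, gpPaths Φ gp ω j z
      - mercerProj P lam (fun i z => ψ i (Φ z)) r (gpPaths Φ gp ω j) z
      = gp (ω.1 j) (Φ z) - mercerProj (P.map Φ) lam ψ r (gp (ω.1 j)) (Φ z) := fun r j z => by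
    rw [← mercerProj_comp hΦ hψ (hg (ω.1 j))]; rfl
  have hres : ∀ r j, Measurable fun x =>
      gp (ω.1 j) x - mercerProj (P.map Φ) lam ψ r (gp (ω.1 j)) x := fun r j =>
    (hgp.measurable_residual hψ r j).comp (measurable_const.prodMk measurable_id)
  have h1 : ∀ j, ∫⁻ z, ENNReal.ofReal (gpPaths Φ gp ω j z ^ 2) ∂P
      = ∫⁻ x, ENNReal.ofReal (gp (ω.1 j) x ^ 2) ∂(P.map Φ) := fun j =>
    (lintegral_map (f := fun x => ENNReal.ofReal (gp (ω.1 j) x ^ 2))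
      ((hg _).pow_const 2).ennreal_ofReal hΦ).symm
  have h2 : ∀ v, whitenedSq P lam (fun i z => ψ i (Φ z)) (activeIndices lam (m / 2)) v
      (gpPaths Φ gp ω) = ∑ j, (∑ i : activeIndices lam (m / 2),
          v i * (coef (P.map Φ) gp (ψ i) (ω.1 j) / √(lam i))) ^ 2 := fun v => by
    simp only [whitenedSq, coef, gpPaths]
    simp_rw [fun i j => integral_comp_mul_comp (P := P) hΦ (hψ i) (hg (ω.1 j))]
  have h3 : ∀ θ : EuclideanSpace ℝ (Fin m), ∫⁻ z, ENNReal.ofReal ((∑ j, θ j * (gpPaths Φ gp ω j z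
      - mercerProj P lam (fun i z => ψ i (Φ z)) (m / 2) (gpPaths Φ gp ω j) z)) ^ 2) ∂P
      = ∫⁻ x, ENNReal.ofReal ((∑ j, θ j * (gp (ω.1 j) x
        - mercerProj (P.map Φ) lam ψ (m / 2) (gp (ω.1 j)) x)) ^ 2) ∂(P.map Φ) := fun θ => by
    simp_rw [hproj]
    exact (lintegral_map (f := fun x => ENNReal.ofReal ((∑ j, θ j * (gp (ω.1 j) x
        - mercerProj (P.map Φ) lam ψ (m / 2) (gp (ω.1 j)) x)) ^ 2))
      ((Finset.measurable_sum _ fun j _ => (hres (m / 2) j).const_mul _).pow_const 2).ennreal_ofReal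
      hΦ).symm
  have h4 : ∀ r j, ∫⁻ z, ENNReal.ofReal ((gpPaths Φ gp ω j z
      - mercerProj P lam (fun i z => ψ i (Φ z)) r (gpPaths Φ gp ω j) z) ^ 2) ∂P
      = ∫⁻ x, ENNReal.ofReal ((gp (ω.1 j) x
        - mercerProj (P.map Φ) lam ψ r (gp (ω.1 j)) x) ^ 2) ∂(P.map Φ) := fun r j => by
    simp_rw [hproj]
    exact (lintegral_map (f := fun x => ENNReal.ofReal ((gp (ω.1 j) x
        - mercerProj (P.map Φ) lam ψ r (gp (ω.1 j)) x) ^ 2))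
      ((hres r j).pow_const 2).ennreal_ofReal hΦ).symm
  simp_rw [← h1, ← h2, ← h3, ← h4]
  exact ⟨fun h => ⟨⟨h.1, h.2, h.3⟩, h.4, h.5, h.6, h.7, h.8⟩,
    fun ⟨⟨a, b, c⟩, d, e, f, g, h⟩ => ⟨a, b, c, d, e, f, g, h⟩⟩

lemma measurable_forall_mem {Ω α : Type*} [MeasurableSpace Ω] (N : Finset α) {p : α → Ω → Prop}
    (hp : ∀ v, Measurable (p v)) : Measurable fun ω => ∀ v ∈ N, p v ω := by
  have : {ω | ∀ v ∈ N, p v ω} = ⋂ v ∈ N, {ω | p v ω} := by ext; simp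
  refine measurableSet_setOfPred.1 ?_
  rw [this]
  exact N.measurableSet_biInter fun v _ => measurableSet_setOfPred.2 (hp v)

lemma measurableSet_isGoodSample (hΦ : Measurable Φ) (hgp : IsGPSample ν (P.map Φ) k gp)
    (hψ : ∀ i, Measurable (ψ i)) (hη : ∀ j, IsNoise P Φ ν gp κ (η j))
    (hA : IsRegressionOracle P Φ ν gp κ A ξ) (m n : ℕ) :
    MeasurableSet {ω : (Fin m → U) × (Fin n → Z × W) |
      IsGoodSample P lam (fun i z => ψ i (Φ z)) b D (ξ n) (Real.log n) (gpPaths Φ gp ω)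
        (truncEstimates A Ck (dataset Φ gp η ω))} := by
  have := Measure.isProbabilityMeasure_map (μ := P) hΦ.aemeasurable
  simp_rw [isGoodSample_iff hΦ hgp hψ]
  have hres : ∀ r (j : Fin m), Measurable fun p : (Fin m → U) × X =>
      gp (p.1 j) p.2 - mercerProj (P.map Φ) lam ψ r (gp (p.1 j)) p.2 := fun r j =>
    hgp.measurable_residual hψ r j
  have h1 : ∀ j : Fin m, Measurable fun ω : Fin m → U =>
      ∫⁻ x, ENNReal.ofReal (gp (ω j) x ^ 2) ∂(P.map Φ) := fun j => by
    refine Measurable.lintegral_prod_right'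
      (f := fun p : (Fin m → U) × X => ENNReal.ofReal (gp (p.1 j) p.2 ^ 2)) ?_
    have hj : Measurable fun p : (Fin m → U) × X => p.1 j := by fun_prop
    exact ((hgp.measurable.comp (hj.prodMk measurable_snd)).pow_const 2).ennreal_ofReal
  have h3 : ∀ θ : EuclideanSpace ℝ (Fin m), Measurable fun ω : Fin m → U =>
      ∫⁻ x, ENNReal.ofReal ((∑ j, θ j * (gp (ω j) x
        - mercerProj (P.map Φ) lam ψ (m / 2) (gp (ω j)) x)) ^ 2) ∂(P.map Φ) := fun θ =>
    Measurable.lintegral_prod_right' (f := fun p : (Fin m → U) × X => ENNReal.ofReal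
      ((∑ j, θ j * (gp (p.1 j) p.2 - mercerProj (P.map Φ) lam ψ (m / 2) (gp (p.1 j)) p.2)) ^ 2))
      ((Finset.measurable_sum _ fun j _ => (hres (m / 2) j).const_mul _).pow_const 2).ennreal_ofReal
  have h4 : ∀ r, Measurable fun ω : Fin m → U => ∑ j, ∫⁻ x, ENNReal.ofReal
      ((gp (ω j) x - mercerProj (P.map Φ) lam ψ r (gp (ω j)) x) ^ 2) ∂(P.map Φ) := fun r =>
    Finset.measurable_sum _ fun j _ => Measurable.lintegral_prod_right'
      (f := fun p : (Fin m → U) × X => ENNReal.ofReal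
        ((gp (p.1 j) p.2 - mercerProj (P.map Φ) lam ψ r (gp (p.1 j)) p.2) ^ 2))
      ((hres r j).pow_const 2).ennreal_ofReal
  refine measurableSet_setOfPred.2 (measurable_const.and (.and (.forall fun j => ?_) (.and ?_
    (.and (measurable_forall_mem _ fun v => ?_) (.and (measurable_forall_mem _ fun θ => ?_)
      (.forall fun r => measurable_const.imp ?_))))))
  · exact measurableSet_setOfPred.1 (measurableSet_lt ((h1 j).comp measurable_fst) measurable_const)
  · exact measurableSet_setOfPred.1 (measurableSet_le
      (measurable_sum_sq_truncEstimates hΦ hgp hη hA m n) measurable_const)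
  · have h2 : Measurable fun ω : (Fin m → U) × (Fin n → Z × W) =>
        ∑ j, (∑ i : activeIndices lam (m / 2),
          v i * (coef (P.map Φ) gp (ψ i) (ω.1 j) / √(lam i))) ^ 2 :=
      (hgp.measurable_whitened hψ v).comp measurable_fst
    exact (measurableSet_setOfPred.1 (measurableSet_le measurable_const h2)).and
      (measurableSet_setOfPred.1 (measurableSet_le h2 measurable_const))
  · exact measurableSet_setOfPred.1 (measurableSet_le ((h3 θ).comp measurable_fst) measurable_const)
  · exact measurableSet_setOfPred.1 (measurableSet_le ((h4 r).comp measurable_fst) measurable_const)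

/-- The good event fails with small probability; the hypothesis `hmn` makes the truncation error of
the estimates at most of the order of `m^{-(b+1)}`. -/
lemma measure_not_isGoodSample_le (hX : MeasurableSpace.CountablyGenerated X) (hΦ : Measurable Φ)
    (hgp : IsGPSample ν (P.map Φ) k gp) (hk : IsBoundedKernel k) (hK0 : 0 < K)
    (hK : ∀ x, k x x ≤ K) (h : IsMercerSystem (P.map Φ) k lam ψ) (hψ : ∀ i, Measurable (ψ i))
    (hD : 0 < D) (hb : 0 < b) (hdec : ∀ i : ℕ, lam i ≤ D * ((i : ℝ) + 1) ^ (-(b + 1)))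
    (hη : ∀ j, IsNoise P Φ ν gp κ (η j)) (hA : IsRegressionOracle P Φ ν gp κ A ξ) (hCk : 0 < Ck)
    {m n : ℕ} (hm : 2 ≤ m) (hL : 1 ≤ Real.log n)
    (hL' : 4 * (D * (2 / b + 44) * 3 ^ (b + 1)) ≤ Real.log n)
    (hmn : (b + 1) * Real.log m ≤ (Ck * Real.log n) ^ 2 / (8 * K)) :
    sampleMeasure P ν κ m n {ω | ¬ IsGoodSample P lam (fun i z => ψ i (Φ z)) b D (ξ n) (Real.log n)
      (gpPaths Φ gp ω) (truncEstimates A Ck (dataset Φ gp η ω))}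
      ≤ ENNReal.ofReal ((2 + 32 * K) / Real.log n) + (ENNReal.ofReal (2 * Real.exp (-(m / 2)))
        + (ENNReal.ofReal (Real.exp (-m)) + ENNReal.ofReal (2 * Real.exp (-m)))) := by
  have := Measure.isProbabilityMeasure_map (μ := P) hΦ.aemeasurable
  have hm0 : (0 : ℝ) < m := by exact_mod_cast (by omega : 0 < m)
  set μ := sampleMeasure P ν κ m n with hμ
  obtain ⟨hN1, -, hN3⟩ := sphereNet_spec (EuclideanSpace ℝ (activeIndices lam (m / 2)))
  obtain ⟨hM1, -, hM3⟩ := sphereNet_spec (EuclideanSpace ℝ (Fin m))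
  rw [finrank_euclideanSpace, Fintype.card_coe] at hN3
  rw [finrank_euclideanSpace, Fintype.card_fin] at hM3
  have hI : 2 * (activeIndices lam (m / 2)).card ≤ m := by
    have := (Finset.card_filter_le (Finset.range (m / 2)) fun i => lam i ≠ 0)
    rw [Finset.card_range] at this
    unfold activeIndices
    omega
  have hfst : ∀ s : Set (Fin m → U), μ {ω | ω.1 ∈ s} ≤ (Measure.pi fun _ : Fin m => ν) s :=
    fun s => by
      have : MeasurePreserving Prod.fst μ (Measure.pi fun _ : Fin m => ν) := measurePreserving_fst
      exact this.measure_preimage_le s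
  -- square integrability of the sample paths
  have h0 : μ {ω | ¬ ∀ j, ∫⁻ x, ENNReal.ofReal (gp (ω.1 j) x ^ 2) ∂(P.map Φ) < ∞} = 0 := by
    refine le_antisymm ((hfst
      {ω | ¬ ∀ j, ∫⁻ x, ENNReal.ofReal (gp (ω j) x ^ 2) ∂(P.map Φ) < ∞}).trans (le_of_eq ?_)) bot_le
    refine ae_iff.1 (ae_all_iff.2 fun j => ?_)
    have h1 : ∀ᵐ u ∂ν, ∫⁻ x, ENNReal.ofReal (gp u x ^ 2) ∂(P.map Φ) < ∞ := by
      filter_upwards [hgp.ae_memLp] with u hu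
      rw [← eLpNorm_two_sq]
      exact ENNReal.pow_lt_top hu.2
    exact (measurePreserving_eval (fun _ : Fin m => ν) j).quasiMeasurePreserving.ae h1
  -- Markov's inequality for the estimates
  have h1 : μ {ω | ENNReal.ofReal (m * (Real.log n * (ξ n ^ 2 + (m : ℝ) ^ (-(b + 1)))))
      < ∑ j, ∫⁻ z, ENNReal.ofReal ((truncEstimates A Ck (dataset Φ gp η ω) j z
        - gpPaths Φ gp ω j z) ^ 2) ∂P} ≤ ENNReal.ofReal ((2 + 32 * K) / Real.log n) := by
    have hx : 0 < (m : ℝ) ^ (-(b + 1)) := by positivity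
    have hexp : Real.exp (-((Ck * Real.log n) ^ 2 / (8 * K))) ≤ (m : ℝ) ^ (-(b + 1)) := by
      rw [Real.rpow_def_of_pos hm0]
      exact Real.exp_le_exp.2 (by linarith)
    have ha : 0 < m * (Real.log n * (ξ n ^ 2 + (m : ℝ) ^ (-(b + 1)))) := by positivity
    have hmark := meas_ge_le_lintegral_div (μ := μ)
      (measurable_sum_sq_truncEstimates (Ck := Ck) hΦ hgp hη hA m n).aemeasurable
      (ENNReal.ofReal_pos.2 ha).ne' ENNReal.ofReal_ne_top
    refine (measure_mono fun ω hω => ?_).trans (hmark.trans ?_)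
    · exact le_of_lt (Set.mem_ofPred.1 hω)
    refine ENNReal.div_le_of_le_mul
      ((lintegral_sum_sq_truncEstimates_le hΦ hgp hK0 hK hCk.le hη hA m n).trans ?_)
    rw [← ENNReal.ofReal_mul (by positivity)]
    refine ENNReal.ofReal_le_ofReal ?_
    have : (2 + 32 * K) / Real.log n * (m * (Real.log n * (ξ n ^ 2 + (m : ℝ) ^ (-(b + 1)))))
        = m * ((2 + 32 * K) * (ξ n ^ 2 + (m : ℝ) ^ (-(b + 1)))) := by
      field_simp
    rw [this]
    refine mul_le_mul_of_nonneg_left ?_ hm0.le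
    have h1 := mul_le_mul_of_nonneg_left hexp (by positivity : 0 ≤ 32 * K)
    have h2 : 0 ≤ K * ξ n ^ 2 := by positivity
    nlinarith
  have h2 := (hfst _).trans (hgp.measure_not_wellConditioned (m := m) hK hk h hψ
    (I := activeIndices lam (m / 2)) (fun i hi => (Finset.mem_filter.1 hi).2) hI hN1 hN3)
  have h3 := (hfst _).trans (hgp.measure_residual_comb_net hX hK hk h hψ hD hb hdec (r := m / 2)
    (by omega) (by omega) (by omega) hM1 hM3)
  have h4 := (hfst _).trans (hgp.measure_residual_sum_all hX hK hk h hψ hD hb hdec (m := m)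
    (by omega))
  rw [← add_zero (ENNReal.ofReal (2 * Real.exp (-(m : ℝ))))]
  refine le_trans (measure_mono ?_) <| (measure_union_le _ _).trans <| add_le_add h1 <|
    (measure_union_le _ _).trans <| add_le_add h2 <| (measure_union_le _ _).trans <|
    add_le_add h3 <| (measure_union_le _ _).trans <| add_le_add h4 h0.le
  intro ω hω
  simp only [Set.mem_ofPred_eq, isGoodSample_iff hΦ hgp hψ] at hω
  by_contra hcon
  simp only [Set.mem_union, Set.mem_ofPred_eq, not_or, not_lt, not_not, not_exists, not_and] at hcon
  obtain ⟨c1, c2, c3, c4, c5⟩ := hcon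
  exact hω ⟨⟨hm, hL, hL'⟩, c5, c1, fun v hv =>
    by_contra fun hc => c2 v hv fun c6 c7 => hc ⟨c6, c7⟩, fun θ hθ => c3 θ hθ, fun r hr => c4 r hr⟩

end Probability

variable {Z X U W : Type*} [MeasurableSpace Z] [MeasurableSpace X] [MeasurableSpace U]
  [MeasurableSpace W] {P : Measure Z} [IsProbabilityMeasure P] {Φ : Z → X} {ν : Measure U}
  [IsProbabilityMeasure ν] {gp : U → X → ℝ} {κ : Kernel Z W} [IsMarkovKernel κ]
  {A : (n : ℕ) → (Fin n → Z × ℝ) → Z → ℝ} {ξ : ℕ → ℝ} {k : X → X → ℝ} {Ck b D : ℝ}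
  {η : ℕ → U → Z → W → ℝ} {lam : ℕ → ℝ} {ψ : ℕ → X → ℝ} {m : ℕ → ℕ}

lemma tendsto_measure_isGoodSample (hX : MeasurableSpace.CountablyGenerated X) (hΦ : Measurable Φ)
    (hgp : IsGPSample ν (P.map Φ) k gp) (hk : IsBoundedKernel k)
    (h : IsMercerSystem (P.map Φ) k lam ψ) (hψ : ∀ i, Measurable (ψ i))
    (hD : 0 < D) (hb : 0 < b) (hdec : ∀ i : ℕ, lam i ≤ D * ((i : ℝ) + 1) ^ (-(b + 1)))
    (hη : ∀ j, IsNoise P Φ ν gp κ (η j)) (hA : IsRegressionOracle P Φ ν gp κ A ξ) (hCk : 0 < Ck)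
    (hm : Tendsto m atTop atTop)
    (hlog : (fun n : ℕ => Real.log (m n)) =o[atTop] (fun n : ℕ => Real.log n ^ 2)) :
    Tendsto (fun n => sampleMeasure P ν κ (m n) n
      {ω | IsGoodSample P lam (fun i z => ψ i (Φ z)) b D (ξ n) (Real.log n) (gpPaths Φ gp ω)
        (truncEstimates A Ck (dataset Φ gp η ω))}) atTop (𝓝 1) := by
  obtain ⟨B, hB⟩ := hk.bounded
  set K : ℝ := max B 1 with hKdef
  have hK0 : 0 < K := lt_max_of_lt_right one_pos
  have hK : ∀ x, k x x ≤ K := fun x => ((le_abs_self _).trans (hB x x)).trans (le_max_left _ _)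
  have hL : Tendsto (fun n : ℕ => Real.log n) atTop atTop :=
    Real.tendsto_log_atTop.comp tendsto_natCast_atTop_atTop
  have hm' : Tendsto (fun n => (m n : ℝ)) atTop atTop := tendsto_natCast_atTop_atTop.comp hm
  have hc : 0 < Ck ^ 2 / (8 * K) / (b + 1) := by positivity
  have hbound : ∀ᶠ n in atTop, sampleMeasure P ν κ (m n) n
      {ω | ¬ IsGoodSample P lam (fun i z => ψ i (Φ z)) b D (ξ n) (Real.log n) (gpPaths Φ gp ω)
        (truncEstimates A Ck (dataset Φ gp η ω))}
      ≤ ENNReal.ofReal ((2 + 32 * K) / Real.log n) + (ENNReal.ofReal (2 * Real.exp (-(m n / 2)))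
        + (ENNReal.ofReal (Real.exp (-(m n))) + ENNReal.ofReal (2 * Real.exp (-(m n))))) := by
    filter_upwards [hm.eventually_ge_atTop 2, hL.eventually_ge_atTop 1,
      hL.eventually_ge_atTop (4 * (D * (2 / b + 44) * 3 ^ (b + 1))), hlog.bound hc]
      with n h1 h2 h3 h4
    refine measure_not_isGoodSample_le hX hΦ hgp hk hK0 hK h hψ hD hb hdec hη hA hCk h1 h2 h3 ?_
    rw [Real.norm_of_nonneg (Real.log_natCast_nonneg _), Real.norm_of_nonneg (by positivity),
      div_mul_eq_mul_div, le_div_iff₀ (by positivity)] at h4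
    calc (b + 1) * Real.log (m n) = Real.log (m n) * (b + 1) := mul_comm _ _
      _ ≤ _ := h4
      _ = _ := by ring
  have hlim : Tendsto (fun n : ℕ => ENNReal.ofReal ((2 + 32 * K) / Real.log n)
      + (ENNReal.ofReal (2 * Real.exp (-(m n / 2 : ℝ)))
        + (ENNReal.ofReal (Real.exp (-(m n : ℝ))) + ENNReal.ofReal (2 * Real.exp (-(m n : ℝ))))))
      atTop (𝓝 0) := by
    have e1 : Tendsto (fun n => Real.exp (-(m n : ℝ))) atTop (𝓝 0) :=
      Real.tendsto_exp_neg_atTop_nhds_zero.comp hm'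
    have e2 : Tendsto (fun n => Real.exp (-(m n / 2 : ℝ))) atTop (𝓝 0) :=
      Real.tendsto_exp_neg_atTop_nhds_zero.comp (hm'.atTop_div_const two_pos)
    have e3 : Tendsto (fun n : ℕ => (2 + 32 * K) / Real.log n) atTop (𝓝 0) :=
      hL.const_div_atTop _
    have := (ENNReal.tendsto_ofReal e3).add ((ENNReal.tendsto_ofReal (e2.const_mul 2)).add
      ((ENNReal.tendsto_ofReal e1).add (ENNReal.tendsto_ofReal (e1.const_mul 2))))
    simpa using this
  have hcompl := tendsto_of_tendsto_of_tendsto_of_le_of_le' tendsto_const_nhds hlim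
    (Eventually.of_forall fun _ => zero_le) hbound
  have hone := ENNReal.Tendsto.sub (tendsto_const_nhds (x := (1 : ℝ≥0∞))) hcompl
    (Or.inl ENNReal.one_ne_top)
  rw [tsub_zero] at hone
  refine hone.congr fun n => ?_
  have hms := measurableSet_isGoodSample (Ck := Ck) (b := b) (D := D) (lam := lam) hΦ hgp hψ hη hA
    (m n) n
  rw [show {ω | ¬ IsGoodSample P lam (fun i z => ψ i (Φ z)) b D (ξ n) (Real.log n)
      (gpPaths Φ gp ω) (truncEstimates A Ck (dataset Φ gp η ω))}
      = {ω | IsGoodSample P lam (fun i z => ψ i (Φ z)) b D (ξ n) (Real.log n)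
      (gpPaths Φ gp ω) (truncEstimates A Ck (dataset Φ gp η ω))}ᶜ from rfl,
    ← prob_compl_eq_one_sub hms.compl, compl_compl]

end KernelLearning

end

theorem mainTheorem2 :
    ∃ c_r : ℝ, 0 < c_r ∧
    ∀ {Z : Type*} [TopologicalSpace Z] [MeasurableSpace Z] [BorelSpace Z]
      (P : Measure Z) [IsProbabilityMeasure P]
      {d : ℕ} {Zbar : Set (EuclideanSpace ℝ (Fin d))} (Φ : Z → Zbar) (kbar : Zbar → Zbar → ℝ)
      (lam : ℕ → ℝ) (ψ : ℕ → Zbar → ℝ) (b D Ck : ℝ),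
      KernelLearning.IsLatentKernel P Φ kbar lam ψ b D → 0 < Ck →
    ∃ C : ℝ, 0 < C ∧
    ∀ {U : Type*} [MeasurableSpace U] (ν : Measure U) [IsProbabilityMeasure ν]
      (gp : U → Zbar → ℝ) {W : Type*} [MeasurableSpace W]
      (κ : Kernel Z W) [IsMarkovKernel κ] (η : ℕ → U → Z → W → ℝ)
      (A : (n : ℕ) → (Fin n → Z × ℝ) → Z → ℝ) (ξ : ℕ → ℝ) (m : ℕ → ℕ),
      KernelLearning.IsGPSample ν (P.map Φ) kbar gp →
      (∀ j, KernelLearning.IsNoise P Φ ν gp κ (η j)) →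
      KernelLearning.IsRegressionOracle P Φ ν gp κ A ξ →
      Tendsto m atTop atTop →
      (fun n : ℕ => Real.log (m n)) =o[atTop] (fun n : ℕ => Real.log n ^ 2) →
    -- the events `E n₁`, determined by the GP samples and the data set
    ∃ E : (n₁ : ℕ) → Set ((Fin (m n₁) → Z → ℝ) × (Fin (m n₁) → Fin n₁ → Z × ℝ)),
      (∀ n₁, MeasurableSet {ω : (Fin (m n₁) → U) × (Fin n₁ → Z × W) |
        (KernelLearning.gpPaths Φ gp ω, KernelLearning.dataset Φ gp η ω) ∈ E n₁}) ∧
      Tendsto (fun n₁ => KernelLearning.sampleMeasure P ν κ (m n₁) n₁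
        {ω | (KernelLearning.gpPaths Φ gp ω, KernelLearning.dataset Φ gp η ω) ∈ E n₁})
        atTop (𝓝 1) ∧
      ∀ (n₁ : ℕ) (ω : (Fin (m n₁) → U) × (Fin n₁ → Z × W)),
        (KernelLearning.gpPaths Φ gp ω, KernelLearning.dataset Φ gp η ω) ∈ E n₁ →
        KernelLearning.ApproximationBound P lam (fun i z => ψ i (Φ z)) b c_r (ξ n₁) n₁
          (KernelLearning.truncEstimates A Ck (KernelLearning.dataset Φ gp η ω)) ∧
        ∀ n₂ : ℕ, 1 ≤ n₂ →
          KernelLearning.criticalRadius P n₂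
            (KernelLearning.learnedBall
              (KernelLearning.truncEstimates A Ck (KernelLearning.dataset Φ gp η ω)) 1) ≤
          ENNReal.ofReal (C * √(Real.log n₁) *
            ((n₂ : ℝ) ^ (-((b + 1) / (2 * (b + 2)))) + (m n₁ : ℝ) ^ (-((b + 1) / 2)) + ξ n₁)) := by
  refine ⟨2000, by norm_num, ?_⟩
  intro Z _ _ _ P _ d Zbar Φ kbar lam ψ b D Ck hlat hCk
  have hb := hlat.b_pos
  -- the decay constant may be enlarged to make it positive
  have hD : 0 < max D 1 := lt_max_of_lt_right one_pos
  have hdec : ∀ i : ℕ, lam i ≤ max D 1 * ((i : ℝ) + 1) ^ (-(b + 1)) := fun i =>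
    (hlat.decay i).trans (mul_le_mul_of_nonneg_right (le_max_left _ _) (by positivity))
  refine ⟨8 + 8 * (max D 1 * (2 / b + 4)), by positivity, ?_⟩
  intro U _ ν _ gp W _ κ _ η A ξ m hgp hη hA hm hlog
  have hΦ : Measurable Φ := hlat.continuous.measurable
  have := Measure.isProbabilityMeasure_map (μ := P) hΦ.aemeasurable
  -- the eigenfunctions are only a.e. measurable, and arbitrary for eigenvalue zero
  obtain ⟨ψ', hψ', hψψ'⟩ := hlat.mercer.exists_measurable
  have hmer := hlat.mercer.congr hψψ'
  have hsys := hmer.isOrthonormalSystem.comp hΦ hψ'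
  refine ⟨fun n => {q | KernelLearning.IsGoodSample P lam (fun i z => ψ' i (Φ z)) b (max D 1) (ξ n)
    (Real.log n) q.1 (KernelLearning.truncEstimates A Ck q.2)}, fun n =>
    KernelLearning.measurableSet_isGoodSample hΦ hgp hψ' hη hA (m n) n,
    KernelLearning.tendsto_measure_isGoodSample inferInstance hΦ hgp hlat.kernel hmer hψ' hD hb hdec
      hη hA hCk hm hlog, fun n ω hω => ?_⟩
  have hG : ∀ j, Measurable (KernelLearning.gpPaths Φ gp ω j) := fun j =>
    (hgp.measurable_path _).comp hΦ
  have hGm : ∀ j, Measurable (KernelLearning.truncEstimates A Ck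
      (KernelLearning.dataset Φ gp η ω) j) := fun j =>
    (KernelLearning.measurable_truncEstimates hΦ hgp hη hA j).comp
      (measurable_const.prodMk measurable_id)
  have hGhat := KernelLearning.memLp_truncEstimates hΦ hgp hη hA hCk ω
  refine ⟨(hω.approximationBound hsys hlat.mercer.nonneg hb hD (hA.nonneg n) hG hGhat).congr
    fun i hi => ?_, fun n₂ hn₂ => ?_⟩
  · exact ae_of_ae_map hΦ.aemeasurable (hψψ' i hi)
  · exact hω.criticalRadius_le hsys (fun i => (hψ' i).comp hΦ) hb hD (hA.nonneg n) hG hGm hGhat hn₂
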